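/- Let $V=\mathbb C^N$. For $X\in\mathrm{End}(V^{\otimes 2})$ let $X_m$ denote $X$ acting in the factors $m,m+1$ of $V^{\otimes n}$, and let $P$ be the permutation operator. $X$ is skew invertible if there is $\Psi_X$ with $\mathrm{Tr}_{(2)}X_{12}(\Psi_X)_{23}=\mathrm{Tr}_{(2)}(\Psi_X)_{12}X_{23}=P_{13}$; put $C_X=\mathrm{Tr}_{(1)}\Psi_X$, $D_X=\mathrm{Tr}_{(2)}\Psi_X$. It is strict skew invertible if moreover $C_X$ or $D_X$ is invertible. An R-matrix is an invertible $R$ with $R_1R_2R_1=R_2R_1R_2$. Let $R,F$ be strict skew invertible R-matrices forming a compatible pair: $R_1F_2F_1=F_2F_1R_2$ and $R_2F_1F_2=F_1F_2R_1$. Let $R$ be of BMW type: for some $q\in\mathbb C\setminus\{0,\pm1\}$ and $\mu\in\mathbb C\setminus\{0,q,-q^{-1}\}$ the minimal polynomial of $R$ is $(x-q)(x+q^{-1})(x-\mu)$, and $K:=\mu^{-1}(q-q^{-1})^{-1}(qI-R)(q^{-1}I+R)$ satisfies $K_2K_1=R_1R_2K_1=R_1^{-1}R_2^{-1}K_1$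 and $K_1K_2K_1=K_1$. For an $N\times N$ matrix $M$ over a $\mathbb C$-algebra put $M_{\overline 1}=M_1$, $M_{\overline{i+1}}=F_iM_{\overline i}F_i^{-1}$. Let $\mathcal M(R,F)$ be the unital associative $\mathbb C$-algebra generated by the $N^2$ entries of a matrix $M$ subject to $R_1M_{\overline 1}M_{\overline 2}=M_{\overline 1}M_{\overline 2}R_1$. Let $\mathcal B_n$ be the braid group on $n$ strands with generators $\sigma_1,\dots,\sigma_{n-1}$, let $\rho_R(\sigma_i)=R_i$ on $V^{\otimes n}$, let $\alpha^{\uparrow i}$ be the image of $\alpha$ under $\sigma_j\mapsto\sigma_{j+i}$, and let $\mathrm{Tr}_{R}$ denote the trace with $D_R$ inserted in every factor over which the trace is taken. For $n\ge1$ and $\alpha\in\mathcal B_n$ put $$ch(\alpha)=\mathrm{Tr}_{R(1,\dots,n)}\big(M_{\overline1}\cdots M_{\overline n}\,\rho_R(\alpha)\big),\qquad (M^{\alpha})_1=\mathrm{Tr}_{R(2,\dots,n)}\big(M_{\overline1}\cdots M_{\overline n}\,\rho_R(\alpha)\big)$$ (so $M^{\alpha}=M$ for $n=1$). Let $\mathcal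 C(R,F)\subseteq\mathcal M(R,F)$ be the linear span of $1$ and all $ch(\alpha)$, and let $\mathcal P(R,F)\subseteq\mathrm{Mat}_N(\mathcal M(R,F))$ be the linear span of all $I\,c$ with $c\in\mathcal C(R,F)$ and all $M^\alpha$. Then $\mathcal C(R,F)$ is closed under multiplication, and $\mathcal P(R,F)$ is a right $\mathcal C(R,F)$-module under entrywise right multiplication. There is exactly one bilinear product $\star$ on $\mathcal P(R,F)$ such that, for all $\alpha\in\mathcal B_n$, $\beta\in\mathcal B_i$ and $c,d\in\mathcal C(R,F)$, $$M^{\alpha}\star M^{\beta}=M^{\alpha\,\beta^{\uparrow n}\,(\sigma_n\cdots\sigma_2\sigma_1\sigma_2^{-1}\cdots\sigma_n^{-1})},\quad (I c)\star M^{\alpha}=M^{\alpha}\star(Ic)=M^{\alpha}c,\quad (Ic)\star(Id)=I\,(cd),$$ and it is associative and commutative. Put $M^{\overline 0}=I$, $M^{\overline{n+1}}=M\star M^{\overline n}$, and $M^{\intercal}(X)=M\cdot\xi(X)$ (usual matrix product), where $\xi(X)_1=\mathrm{Tr}_{R(2)}\big(F_{12}X_1F_{12}^{-1}K_{12}\big)$.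 As a $\mathcal C(R,F)$-module, $\mathcal P(R,F)$ is spanned by the matrices $$M^{\overline n}\quad\text{and}\quad M^{\intercal}\big(M^{\overline{n+2}}\big),\qquad n=0,1,2,\dots$$ -/

import Mathlib

open scoped BigOperators Matrix

/-! ### Operators on tensor powers

`V = ℂ^N` with its standard basis.  An operator on `V^{⊗ n}` with coefficients in an algebra `A`
(an element of `End(V^{⊗ n}) ⊗ A`) is a matrix indexed by multi-indices `Fin n → Fin N`. -/

/-- Matrices of operators on the `n`-th tensor power of an `N`-dimensional space, with entries
in `A`. -/
abbrev TensorOp (N n : ℕ) (A : Type*) := Matrix (Fin n → Fin N) (Fin n → Fin N) A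

/-- The operator `X` on `k` tensor factors, acting in the factors `f 0, …, f (k-1)` of
`V^{⊗ n}` and as the identity in all others. -/
def place {N k n : ℕ} (f : Fin k → Fin n) (X : TensorOp N k ℂ) : TensorOp N n ℂ :=
  Matrix.of fun i j => open Classical in
    if ∀ p, p ∉ Set.range f → i p = j p then X (i ∘ f) (j ∘ f) else 0

theorem place_one {N k n : ℕ} {f : Fin k → Fin n} : place f (1 : TensorOp N k ℂ) = 1 := by
  classical
  ext i j
  simp only [place, Matrix.of_apply, Matrix.one_apply]
  by_cases h : i = j
  · subst h; simp
  · rw [if_neg h]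
    split_ifs with h1 h2
    · exfalso
      apply h
      funext p
      by_cases hp : p ∈ Set.range f
      · obtain ⟨a, rfl⟩ := hp
        exact congrFun h2 a
      · exact h1 p hp
    · rfl
    · rfl

theorem place_mul {N k n : ℕ} {f : Fin k → Fin n} (hf : Function.Injective f)
    (X Y : TensorOp N k ℂ) : place f (X * Y) = place f X * place f Y := by
  classical
  ext i j
  simp only [place, Matrix.of_apply, Matrix.mul_apply]
  have key : ∀ z : Fin k → Fin N, Function.extend f z i ∘ f = z := fun z => by
    funext a; simp [hf.extend_apply]
  have off : ∀ (z : Fin k → Fin N) p, p ∉ Set.range f → Function.extend f z i p = i p :=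
    fun z p hp => Function.extend_apply' _ _ _ (fun ⟨a, ha⟩ => hp ⟨a, ha⟩)
  have inj : Function.Injective (fun z : Fin k → Fin N => Function.extend f z i) := by
    intro z z' h
    have h' : Function.extend f z i = Function.extend f z' i := h
    rw [← key z, h', key z']
  symm
  split_ifs with hij
  · symm
    refine Finset.sum_of_injOn (fun z : Fin k → Fin N => Function.extend f z i)
      inj.injOn (by simp) ?_ ?_
    · intro w _ hw
      rw [if_neg, zero_mul]
      intro h
      apply hw
      refine ⟨w ∘ f, by simp, ?_⟩
      funext p
      by_cases hp : p ∈ Set.range f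
      · obtain ⟨a, rfl⟩ := hp
        simp [hf.extend_apply]
      · simp only []
        rw [off _ p hp, h p hp]
    · intro z _
      rw [if_pos (fun p hp => (off z p hp).symm),
        if_pos (fun p hp => (off z p hp).trans (hij p hp)), key]
  · refine Finset.sum_eq_zero fun w _ => ?_
    split_ifs with h1 h2
    · exact absurd (fun p hp => (h1 p hp).trans (h2 p hp)) hij
    all_goals simp

theorem place_place {N k l n : ℕ} {f : Fin l → Fin n} (hf : Function.Injective f)
    (g : Fin k → Fin l) (X : TensorOp N k ℂ) : place f (place g X) = place (f ∘ g) X := by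
  classical
  ext i j
  simp only [place, Matrix.of_apply]
  have : (∀ p, p ∉ Set.range (f ∘ g) → i p = j p) ↔
      (∀ p, p ∉ Set.range f → i p = j p) ∧
        (∀ p, p ∉ Set.range g → (i ∘ f) p = (j ∘ f) p) := by
    constructor
    · intro h
      refine ⟨fun p hp => h p fun ⟨a, ha⟩ => hp ⟨g a, ha⟩, fun p hp => h (f p) ?_⟩
      rintro ⟨a, ha⟩
      exact hp ⟨a, hf ha⟩
    · rintro ⟨h1, h2⟩ p hp
      by_cases hpf : p ∈ Set.range f
      · obtain ⟨a, rfl⟩ := hpf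
        exact h2 a fun ⟨b, hb⟩ => hp ⟨b, by simp [← hb]⟩
      · exact h1 p hpf
  by_cases h1 : ∀ p, p ∉ Set.range f → i p = j p
  · by_cases h2 : ∀ p, p ∉ Set.range g → (i ∘ f) p = (j ∘ f) p
    · rw [if_pos h1, if_pos h2, if_pos (this.2 ⟨h1, h2⟩)]; rfl
    · rw [if_pos h1, if_neg h2, if_neg fun h => h2 (this.1 h).2]
  · rw [if_neg h1, if_neg fun h => h1 (this.1 h).1]

theorem place_comm {N k l n : ℕ} {f : Fin k → Fin n} {g : Fin l → Fin n}
    (hf : Function.Injective f) (hg : Function.Injective g)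
    (hfg : ∀ a b, f a ≠ g b) (X : TensorOp N k ℂ) (Y : TensorOp N l ℂ) :
    place f X * place g Y = place g Y * place f X := by
  classical
  have main : ∀ {k l : ℕ} {f : Fin k → Fin n} {g : Fin l → Fin n}
      (_ : Function.Injective f) (_ : ∀ a b, f a ≠ g b)
      (X : TensorOp N k ℂ) (Y : TensorOp N l ℂ) (i j : Fin n → Fin N),
      (place f X * place g Y) i j =
        if ∀ p, p ∉ Set.range f → p ∉ Set.range g → i p = j p then
          X (i ∘ f) (j ∘ f) * Y (i ∘ g) (j ∘ g) else 0 := by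
    intro k l f g hf hfg X Y i j
    simp only [place, Matrix.of_apply, Matrix.mul_apply]
    rw [Finset.sum_eq_single (Function.extend f (j ∘ f) i)]
    · have e1 : Function.extend f (j ∘ f) i ∘ f = j ∘ f := by
        funext a; simp [hf.extend_apply]
      have off : ∀ p, p ∉ Set.range f → Function.extend f (j ∘ f) i p = i p :=
        fun p hp => Function.extend_apply' _ _ _ (fun ⟨a, ha⟩ => hp ⟨a, ha⟩)
      have e2 : Function.extend f (j ∘ f) i ∘ g = i ∘ g := by
        funext b
        exact off _ fun ⟨a, ha⟩ => hfg a b ha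
      rw [if_pos (fun p hp => (off p hp).symm), e1, e2]
      have : (∀ p, p ∉ Set.range g → Function.extend f (j ∘ f) i p = j p) ↔
          ∀ p, p ∉ Set.range f → p ∉ Set.range g → i p = j p := by
        constructor
        · intro h p h1 h2
          rw [← off p h1]; exact h p h2
        · intro h p h2
          by_cases hp : p ∈ Set.range f
          · obtain ⟨a, rfl⟩ := hp
            exact congrFun e1 a
          · rw [off p hp]; exact h p hp h2
      simp only [this, mul_ite, mul_zero]
    · intro w _ hw
      by_cases h1 : ∀ p, p ∉ Set.range f → i p = w p
      · rw [if_pos h1]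
        rw [if_neg, mul_zero]
        intro h2
        apply hw
        funext p
        by_cases hp : p ∈ Set.range f
        · obtain ⟨a, rfl⟩ := hp
          rw [hf.extend_apply]
          exact h2 _ fun ⟨b, hb⟩ => hfg a b hb.symm
        · rw [Function.extend_apply' _ _ _ (fun ⟨a, ha⟩ => hp ⟨a, ha⟩)]
          exact (h1 p hp).symm
      · rw [if_neg h1, zero_mul]
    · simp
  ext i j
  rw [main hf hfg, main hg (fun a b h => hfg b a h.symm)]
  have : (∀ p, p ∉ Set.range f → p ∉ Set.range g → i p = j p) ↔
      ∀ p, p ∉ Set.range g → p ∉ Set.range f → i p = j p :=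
    ⟨fun h p h1 h2 => h p h2 h1, fun h p h1 h2 => h p h2 h1⟩
  simp only [this, mul_comm]

/-- The two neighbouring positions `m`, `m+1` among `n+1` tensor factors. -/
def adj {n : ℕ} (m : Fin n) : Fin 2 → Fin (n + 1) := ![m.castSucc, m.succ]

theorem adj_injective {n : ℕ} (m : Fin n) : Function.Injective (adj m) := by
  intro a b h
  fin_cases a <;> fin_cases b <;> simp [adj, Fin.ext_iff] at h ⊢

/-- `X_m` on `V^{⊗ (n+1)}`: the operator `X ∈ End(V ⊗ V)` acting in the neighbouring factors
`m`, `m+1` (counted from `0`). -/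
def opAt {N n : ℕ} (X : TensorOp N 2 ℂ) (m : Fin n) : TensorOp N (n + 1) ℂ := place (adj m) X

/-! ### R-matrices -/

/-- An (invertible) R-matrix: `R ∈ Aut(V ⊗ V)` with the Yang-Baxter equation
`R₁ R₂ R₁ = R₂ R₁ R₂` on `V^{⊗ 3}`. -/
structure RMatrix (N : ℕ) where
  toUnits : (TensorOp N 2 ℂ)ˣ
  ybe : opAt (n := 2) toUnits.val 0 * opAt toUnits.val 1 * opAt toUnits.val 0
    = opAt toUnits.val 1 * opAt toUnits.val 0 * opAt toUnits.val 1

namespace RMatrix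

/-- The operator `R`. -/
def op {N : ℕ} (R : RMatrix N) : TensorOp N 2 ℂ := R.toUnits.val

/-- The operator `R⁻¹`. -/
def inv {N : ℕ} (R : RMatrix N) : TensorOp N 2 ℂ := R.toUnits⁻¹.val

end RMatrix

/-- The twist relations `X₁ F₂ F₁ = F₂ F₁ X₂` and `X₂ F₁ F₂ = F₁ F₂ X₁` on `V^{⊗ 3}`. -/
def IsCompatiblePair {N : ℕ} (X F : TensorOp N 2 ℂ) : Prop :=
  (opAt (n := 2) X 0 * opAt F 1 * opAt F 0 = opAt F 1 * opAt F 0 * opAt X 1) ∧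
  (opAt (n := 2) X 1 * opAt F 0 * opAt F 1 = opAt F 0 * opAt F 1 * opAt X 0)

/-- The permutation operator on `V ⊗ V`. -/
def permOp (N : ℕ) : TensorOp N 2 ℂ :=
  Matrix.of fun i j => if i 0 = j 1 ∧ i 1 = j 0 then 1 else 0

/-- The trace over the middle factor of `V^{⊗ 3}`; the result acts in the factors 1 and 3, which
are relabelled as the two factors of `V ⊗ V`. -/
def trMid {N : ℕ} (X : TensorOp N 3 ℂ) : TensorOp N 2 ℂ :=
  Matrix.of fun i j => ∑ x, X ![i 0, x, i 1] ![j 0, x, j 1]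

/-- `Ψ` is a skew inverse of `X`: `Tr₂ X₁₂ Ψ₂₃ = Tr₂ Ψ₁₂ X₂₃ = P₁₃`. -/
def IsSkewInverse {N : ℕ} (X Ψ : TensorOp N 2 ℂ) : Prop :=
  trMid (opAt X 0 * opAt Ψ 1) = permOp N ∧ trMid (opAt Ψ 0 * opAt X 1) = permOp N

/-- `X` is skew invertible. -/
def IsSkewInvertible {N : ℕ} (X : TensorOp N 2 ℂ) : Prop := ∃ Ψ, IsSkewInverse X Ψ

open Classical in
/-- The skew inverse `Ψ_X` of a skew invertible operator (it is unique). -/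
noncomputable def skewInverse {N : ℕ} (X : TensorOp N 2 ℂ) : TensorOp N 2 ℂ :=
  if h : IsSkewInvertible X then h.choose else 0

/-- `C_X = Tr₁ Ψ_X`. -/
noncomputable def skewC {N : ℕ} (X : TensorOp N 2 ℂ) : Matrix (Fin N) (Fin N) ℂ :=
  Matrix.of fun a b => ∑ x, skewInverse X ![x, a] ![x, b]

/-- `D_X = Tr₂ Ψ_X`. -/
noncomputable def skewD {N : ℕ} (X : TensorOp N 2 ℂ) : Matrix (Fin N) (Fin N) ℂ :=
  Matrix.of fun a b => ∑ x, skewInverse X ![a, x] ![b, x]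

/-- `X` is strict skew invertible: skew invertible with `C_X` or `D_X` invertible. -/
def IsStrictSkewInvertible {N : ℕ} (X : TensorOp N 2 ℂ) : Prop :=
  IsSkewInvertible X ∧ (IsUnit (skewC X) ∨ IsUnit (skewD X))

/-- `K = μ⁻¹ (q - q⁻¹)⁻¹ (q I - R)(q⁻¹ I + R)`. -/
noncomputable def bmwK {N : ℕ} (R : RMatrix N) (q μ : ℂ) : TensorOp N 2 ℂ :=
  (μ⁻¹ * (q - q⁻¹)⁻¹) • ((q • 1 - R.op) * (q⁻¹ • 1 + R.op))

/-- `R` is an R-matrix of the BMW type with parameters `q`, `μ`. -/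
structure IsBMWType {N : ℕ} (R : RMatrix N) (q μ : ℂ) : Prop where
  q_ne_zero : q ≠ 0
  q_ne_one : q ≠ 1
  q_ne_neg_one : q ≠ -1
  μ_ne_zero : μ ≠ 0
  μ_ne_q : μ ≠ q
  μ_ne_neg_q_inv : μ ≠ -q⁻¹
  /-- The minimal polynomial of `R` is the cubic `(x - q)(x + q⁻¹)(x - μ)`. -/
  minpoly_eq : minpoly ℂ R.op = (Polynomial.X - Polynomial.C q) *
    (Polynomial.X + Polynomial.C q⁻¹) * (Polynomial.X - Polynomial.C μ)
  /-- `K₂ K₁ = R₁ R₂ K₁`. -/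
  K_R : opAt (n := 2) (bmwK R q μ) 1 * opAt (bmwK R q μ) 0
    = opAt R.op 0 * opAt R.op 1 * opAt (bmwK R q μ) 0
  /-- `K₂ K₁ = R₁⁻¹ R₂⁻¹ K₁`. -/
  K_R_inv : opAt (n := 2) (bmwK R q μ) 1 * opAt (bmwK R q μ) 0
    = opAt R.inv 0 * opAt R.inv 1 * opAt (bmwK R q μ) 0
  /-- `K₁ K₂ K₁ = K₁`. -/
  K_K_K : opAt (n := 2) (bmwK R q μ) 0 * opAt (bmwK R q μ) 1 * opAt (bmwK R q μ) 0
    = opAt (bmwK R q μ) 0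

/-! ### Braid groups and their representations -/

/-- Artin's braid relations among the generators `σ_0, …, σ_{n-1}`. -/
def braidRels (n : ℕ) : Set (FreeGroup (Fin n)) :=
  {r | ∃ i j : Fin n, (i : ℕ) + 1 = j ∧
    r = (FreeGroup.of i * FreeGroup.of j * FreeGroup.of i) *
      (FreeGroup.of j * FreeGroup.of i * FreeGroup.of j)⁻¹} ∪
  {r | ∃ i j : Fin n, (i : ℕ) + 1 < j ∧
    r = (FreeGroup.of i * FreeGroup.of j) * (FreeGroup.of j * FreeGroup.of i)⁻¹}

/-- The braid group on `n + 1` strands, in Artin's presentation. -/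
abbrev Braid (n : ℕ) := PresentedGroup (braidRels n)

/-- The Artin generator `σ_i` (indices start from `0`). -/
def Braid.σ {n : ℕ} (i : Fin n) : Braid n := PresentedGroup.of i

theorem Braid.σ_braid {n : ℕ} {i j : Fin n} (h : (i : ℕ) + 1 = j) :
    Braid.σ i * Braid.σ j * Braid.σ i = Braid.σ j * Braid.σ i * Braid.σ j :=
  PresentedGroup.mk_eq_mk_of_mul_inv_mem (rels := braidRels n)
    (x := FreeGroup.of i * FreeGroup.of j * FreeGroup.of i)
    (y := FreeGroup.of j * FreeGroup.of i * FreeGroup.of j) (Or.inl ⟨i, j, h, rfl⟩)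

theorem Braid.σ_comm {n : ℕ} {i j : Fin n} (h : (i : ℕ) + 1 < j) :
    Braid.σ i * Braid.σ j = Braid.σ j * Braid.σ i :=
  PresentedGroup.mk_eq_mk_of_mul_inv_mem (rels := braidRels n)
    (x := FreeGroup.of i * FreeGroup.of j)
    (y := FreeGroup.of j * FreeGroup.of i) (Or.inr ⟨i, j, h, rfl⟩)

/-- A homomorphism from a braid group, given by the images of the generators. -/
def Braid.lift {n : ℕ} {G : Type*} [Group G] (f : Fin n → G)
    (h1 : ∀ i j : Fin n, (i : ℕ) + 1 = j → f i * f j * f i = f j * f i * f j)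
    (h2 : ∀ i j : Fin n, (i : ℕ) + 1 < j → f i * f j = f j * f i) : Braid n →* G :=
  PresentedGroup.toGroup (f := f) (by
    rintro r (⟨i, j, h, rfl⟩ | ⟨i, j, h, rfl⟩)
    · simp only [map_mul, map_inv, FreeGroup.lift_apply_of, h1 i j h, mul_inv_cancel]
    · simp only [map_mul, map_inv, FreeGroup.lift_apply_of, h2 i j h, mul_inv_cancel])

/-- The homomorphism `σ_i ↦ σ_{i+s}` into a braid group on more strands (`α ↦ α^{↑ s}`).
For `s = 0` this is the standard inclusion. -/
def Braid.shift {m n : ℕ} (s : ℕ) (h : m + s ≤ n) : Braid m →* Braid n :=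
  Braid.lift (fun i => Braid.σ ⟨i + s, by omega⟩)
    (fun i j hij => Braid.σ_braid (by simp only []; omega))
    (fun i j hij => Braid.σ_comm (by simp only []; omega))

/-- `R_m` as an invertible operator on `V^{⊗ (n+1)}`. -/
def RMatrix.unitAt {N n : ℕ} (R : RMatrix N) (m : Fin n) : (TensorOp N (n + 1) ℂ)ˣ where
  val := opAt R.op m
  inv := opAt R.inv m
  val_inv := by
    simp only [opAt]
    rw [← place_mul (adj_injective m)]
    simp [RMatrix.op, RMatrix.inv, place_one]
  inv_val := by
    simp only [opAt]
    rw [← place_mul (adj_injective m)]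
    simp [RMatrix.op, RMatrix.inv, place_one]

/-- The representation `ρ_R : σ_i ↦ R_i` of the braid group on `n + 1` strands on
`V^{⊗ (n+1)}`. -/
def RMatrix.rep {N : ℕ} (R : RMatrix N) (n : ℕ) : Braid n →* (TensorOp N (n + 1) ℂ)ˣ :=
  Braid.lift (fun i => R.unitAt i)
    (fun i j hij => by
      apply Units.ext
      simp only [RMatrix.unitAt, Units.val_mul]
      set f : Fin 3 → Fin (n + 1) := ![i.castSucc, j.castSucc, j.succ] with hf
      have finj : Function.Injective f := by
        intro a b h
        fin_cases a <;> fin_cases b <;> simp [hf, Fin.ext_iff] at h ⊢ <;> omega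
      have e0 : opAt R.op i = place f (opAt (n := 2) R.op 0) := by
        simp only [opAt]
        rw [place_place finj]
        congr 1
        funext a
        fin_cases a <;> simp [adj, hf, Fin.ext_iff, hij]
      have e1 : opAt R.op j = place f (opAt (n := 2) R.op 1) := by
        simp only [opAt]
        rw [place_place finj]
        congr 1
        funext a
        fin_cases a <;> simp [adj, hf]
      rw [e0, e1, ← place_mul finj, ← place_mul finj, ← place_mul finj, ← place_mul finj]
      exact congrArg _ R.ybe)
    (fun i j hij => by
      apply Units.ext
      simp only [RMatrix.unitAt, Units.val_mul]
      refine place_comm (adj_injective i) (adj_injective j) ?_ _ _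
      intro a b
      fin_cases a <;> fin_cases b <;> simp [adj, Fin.ext_iff] <;> omega)

/-- The exponent of the `⋆`-product of matrix descendants.  For `α` on `a = n + 1` strands and
`β` on `m + 1` strands it is, with generators numbered from `1` as usual,
`α β^{↑ a} (σ_a ⋯ σ_2 σ_1 σ_2⁻¹ ⋯ σ_a⁻¹)`, a braid on `n + m + 2` strands. -/
def Braid.star {n m : ℕ} (α : Braid n) (β : Braid m) : Braid (n + m + 1) :=
  Braid.shift 0 (by omega) α * Braid.shift (n + 1) (by omega) β *
    ((List.ofFn fun k : Fin (n + 1) => (Braid.σ ⟨k, by omega⟩ : Braid (n + m + 1))).reverse.prod *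
      (List.ofFn fun k : Fin n => (Braid.σ ⟨k + 1, by omega⟩ : Braid (n + m + 1))⁻¹).prod)

/-! ### Matrix copies, R-traces and the quantum matrix algebra -/

section Copies

variable {N : ℕ} {A : Type*} [Ring A] [Algebra ℂ A]

/-- Scalar operators regarded as operators with coefficients in `A`. -/
def coeffs {n : ℕ} (A : Type*) [Ring A] [Algebra ℂ A] (X : TensorOp N n ℂ) : TensorOp N n A :=
  X.map (algebraMap ℂ A)

/-- `M₁`: a matrix `M ∈ Mat_N(A)` acting in the first of `n + 1` factors. -/
def firstSite {n : ℕ} (M : Matrix (Fin N) (Fin N) A) : TensorOp N (n + 1) A :=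
  Matrix.of fun i j => if ∀ k : Fin n, i k.succ = j k.succ then M (i 0) (j 0) else 0

/-- The matrix copies on `V^{⊗ (n+1)}`, numbered from `0`: the first one is `M₁`, and the next one
is obtained by conjugation, `M_{i+1} = F_i M_i F_i⁻¹` (indices with an overline). -/
def matrixCopy (F : RMatrix N) (M : Matrix (Fin N) (Fin N) A) {n : ℕ} (i : Fin (n + 1)) :
    TensorOp N (n + 1) A :=
  Fin.induction (motive := fun _ => TensorOp N (n + 1) A) (firstSite M)
    (fun k X => coeffs A (opAt F.op k) * X * coeffs A (opAt F.inv k)) i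

/-- The ordered product of all `n + 1` matrix copies on `V^{⊗ (n+1)}`. -/
def copyProd (F : RMatrix N) (M : Matrix (Fin N) (Fin N) A) (n : ℕ) : TensorOp N (n + 1) A :=
  (List.ofFn fun i : Fin (n + 1) => matrixCopy F M i).prod

/-- The trace over all factors, weighted by `D` in each of them. -/
def fullTrace (D : Matrix (Fin N) (Fin N) ℂ) {n : ℕ} (X : TensorOp N n A) : A :=
  ∑ x : Fin n → Fin N, ∑ y : Fin n → Fin N, (∏ k, D (x k) (y k)) • X y x

/-- The trace over all factors but the first, weighted by `D` in each of them. -/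
def tailTrace (D : Matrix (Fin N) (Fin N) ℂ) {n : ℕ} (X : TensorOp N (n + 1) A) :
    Matrix (Fin N) (Fin N) A :=
  Matrix.of fun a b => ∑ x : Fin n → Fin N, ∑ y : Fin n → Fin N,
    (∏ k, D (x k) (y k)) • X (Fin.cons a y) (Fin.cons b x)

end Copies

section QuantumMatrixAlgebra

variable {N : ℕ} (R F : RMatrix N)

/-- The matrix of free generators `M_a^b`. -/
def freeGen (N : ℕ) : Matrix (Fin N) (Fin N) (FreeAlgebra ℂ (Fin N × Fin N)) :=
  Matrix.of fun a b => FreeAlgebra.ι ℂ (a, b)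

/-- The matrix relation `R₁ M₁ M₂ = M₁ M₂ R₁` (overlined copies), entry by entry. -/
inductive QMRel : FreeAlgebra ℂ (Fin N × Fin N) → FreeAlgebra ℂ (Fin N × Fin N) → Prop
  | entry (i j : Fin 2 → Fin N) :
      QMRel
        ((coeffs (FreeAlgebra ℂ (Fin N × Fin N)) R.op * copyProd F (freeGen N) 1 :
          TensorOp N 2 (FreeAlgebra ℂ (Fin N × Fin N))) i j)
        ((copyProd F (freeGen N) 1 * coeffs (FreeAlgebra ℂ (Fin N × Fin N)) R.op :
          TensorOp N 2 (FreeAlgebra ℂ (Fin N × Fin N))) i j)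

/-- The quantum matrix algebra of the pair `R`, `F`: the quotient of the free unital algebra on
the `N²` generators by the two-sided ideal generated by the relations. -/
abbrev QMAlgebra := RingQuot (QMRel R F)

/-- The matrix `M` of generators. -/
noncomputable def genM : Matrix (Fin N) (Fin N) (QMAlgebra R F) :=
  (freeGen N).map (RingQuot.mkAlgHom ℂ (QMRel R F))

/-- `ch(α)`: the R-trace over all factors of the product of the matrix copies and `ρ_R(α)`. -/
noncomputable def ch {n : ℕ} (α : Braid n) : QMAlgebra R F :=
  fullTrace (skewD R.op) (copyProd F (genM R F) n * coeffs _ (R.rep n α).val)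

/-- The characteristic subalgebra, as the linear span of `1` and of all `ch(α)`. -/
noncomputable def charSpace : Submodule ℂ (QMAlgebra R F) :=
  Submodule.span ℂ ({1} ∪ {x | ∃ (n : ℕ) (α : Braid n), x = ch R F α})

/-- The matrix `I c`. -/
def scalarMat (c : QMAlgebra R F) : Matrix (Fin N) (Fin N) (QMAlgebra R F) :=
  Matrix.diagonal fun _ => c

/-- The matrix `X c`, all of whose entries are multiplied by `c` from the right. -/
def rightMul (X : Matrix (Fin N) (Fin N) (QMAlgebra R F)) (c : QMAlgebra R F) :
    Matrix (Fin N) (Fin N) (QMAlgebra R F) :=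
  X.map fun x => x * c

/-- The matrix descendant `M^α`: the R-trace over all factors but the first of the product of the
matrix copies and `ρ_R(α)`.  For the trivial braid on one strand it is `M` itself. -/
noncomputable def descendant {n : ℕ} (α : Braid n) : Matrix (Fin N) (Fin N) (QMAlgebra R F) :=
  tailTrace (skewD R.op) (copyProd F (genM R F) n * coeffs _ (R.rep n α).val)

/-- The space of matrix descendants of `M`: the span of the matrices `I c` with `c` in the
characteristic subalgebra and of all `M^α`. -/
noncomputable def descSpace : Submodule ℂ (Matrix (Fin N) (Fin N) (QMAlgebra R F)) :=
  Submodule.span ℂ ({X | ∃ c ∈ charSpace R F, X = scalarMat R F c} ∪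
    {X | ∃ (n : ℕ) (α : Braid n), X = descendant R F α})

theorem descendant_one : descendant R F (1 : Braid 0) = genM R F := by
  ext a b
  have hone : coeffs (QMAlgebra R F) (1 : TensorOp N 1 ℂ) = 1 := by
    simp [coeffs]
  simp [descendant, tailTrace, copyProd, matrixCopy, firstSite, hone]

theorem one_mem_descSpace :
    (1 : Matrix (Fin N) (Fin N) (QMAlgebra R F)) ∈ descSpace R F :=
  Submodule.subset_span (Or.inl ⟨1, Submodule.subset_span (Or.inl rfl),
    by simp [scalarMat]⟩)

theorem genM_mem_descSpace : genM R F ∈ descSpace R F :=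
  Submodule.subset_span (Or.inr ⟨0, 1, (descendant_one R F).symm⟩)

/-- The bilinear operation `s` on the space of descendants obeys the formulas that define the
`⋆`-product on the spanning set:
`M^α ⋆ M^β = M^{α ⋆ β}`, `(I c) ⋆ M^α = M^α ⋆ (I c) = M^α c`, `(I c) ⋆ (I d) = I (c d)`. -/
structure IsStarProduct
    (s : descSpace R F →ₗ[ℂ] descSpace R F →ₗ[ℂ] descSpace R F) : Prop where
  desc_desc : ∀ {n m : ℕ} (α : Braid n) (β : Braid m) (x y : descSpace R F),
    x.val = descendant R F α → y.val = descendant R F β →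
      (s x y).val = descendant R F (Braid.star α β)
  scalar_desc : ∀ {n : ℕ} (c : QMAlgebra R F) (α : Braid n) (x y : descSpace R F),
    c ∈ charSpace R F → x.val = scalarMat R F c → y.val = descendant R F α →
      (s x y).val = rightMul R F (descendant R F α) c
  desc_scalar : ∀ {n : ℕ} (c : QMAlgebra R F) (α : Braid n) (x y : descSpace R F),
    c ∈ charSpace R F → x.val = descendant R F α → y.val = scalarMat R F c →
      (s x y).val = rightMul R F (descendant R F α) c
  scalar_scalar : ∀ (c d : QMAlgebra R F) (x y : descSpace R F),
    c ∈ charSpace R F → d ∈ charSpace R F →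
    x.val = scalarMat R F c → y.val = scalarMat R F d →
      (s x y).val = scalarMat R F (c * d)

/-- The `⋆`-powers of `M`: the zeroth power is `I`, the next one is `M ⋆` the previous one. -/
noncomputable def starPow (s : descSpace R F →ₗ[ℂ] descSpace R F →ₗ[ℂ] descSpace R F) :
    ℕ → descSpace R F
  | 0 => ⟨1, one_mem_descSpace R F⟩
  | n + 1 => s ⟨genM R F, genM_mem_descSpace R F⟩ (starPow s n)

/-- The map `ξ(X)₁ = Tr_{R(2)} (F₁₂ X₁ F₁₂⁻¹ K₁₂)`. -/
noncomputable def xiMap (q μ : ℂ) (X : Matrix (Fin N) (Fin N) (QMAlgebra R F)) :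
    Matrix (Fin N) (Fin N) (QMAlgebra R F) :=
  tailTrace (n := 1) (skewD R.op)
    (coeffs _ (opAt F.op 0) * firstSite X * coeffs _ (opAt F.inv 0) *
      coeffs _ (opAt (bmwK R q μ) 0))

/-- The map `X ↦ M · ξ(X)`, with the usual matrix product (the transposition-type
multiplication by `M`). -/
noncomputable def MtMap (q μ : ℂ) (X : Matrix (Fin N) (Fin N) (QMAlgebra R F)) :
    Matrix (Fin N) (Fin N) (QMAlgebra R F) :=
  genM R F * xiMap R F q μ X

end QuantumMatrixAlgebra

/-! Let $E$ be an algebra of operators on infinitely many strands with coefficients in the quantum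
matrix algebra. The descendant $D(w)$ of a word $w$ is the weighted trace of $M_{\overline 1}\cdots
M_{\overline{n+1}}\,w$ over all strands but the first. Four facts about it drive the argument: the
BMW relations among the letters $r_i$, $k_i$; cyclicity of the weighted trace for letters in the
traced strands; the weighted traces of $R$ and $K$ over their second factor, which are $1$ and
$\mu$; and the translation of strands by conjugation with $F$. They are packaged in `BMWTower` and
`DescentSystem`, and the rest of the algebra is done with words.

Spanning. The BMW relations put every word into the form $a$, $a r_0 b$ or $a k_0 b$ with $a$, $b$
free of letters at position zero (`W_le_dec`). Cyclicity joins $a$ and $b$, so each descendant is a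
combination of $M\,ch(y)$, $A(D(y))$ and $T(D(y))$ with shorter $y$, where $A$ is
$\star$-multiplication by $M$ and $T=M^{\intercal}$ (`D_induction`). It remains to see that the span
of $A^n I\,c$ and $T A^n I\,c$ is stable under $A$ and $T$. This follows from $T^2=\mu g$
(`opT_opT_D`) and from a formula for $A T A$ (`opA_opT_opA`), where $g$ is the characteristic
element defined by $D(k_0)=Ig$. Since $T(I)=\mu M$ and $T(M)=Ig$, the images under $T$ are needed
only from $A^2 I$ on.

The product. The descendant of $w\star v$ is a linear function of $D(v)$ (`D_star_eq`), but it is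
not clear that it depends on $w$ only through $D(w)$. The way out is to prove $D(w\star v)=D(v\star
w)$ for words first (`D_star_comm`): a symmetric family of operators always extends to a bilinear
product (`exists_bilinear_of_symm`). For the commutativity, `trace_induction` reduces each word, by
operations that both sides respect, to chains $k_0 s_1\cdots s_n$, and the product of two chains
depends only on their total length (`D_b_star_b`). Associativity then follows because left
multiplications commute, which rests on the braid identity `S_mul_S`.

Realization. Strict skew invertibility forces $K$ to have rank one (`rank_one`). Hence
$M_{\overline1}M_{\overline2}K$ is $K$ times an operator that acts trivially in every strand, and
the weighted traces of $K$ and of $1$ can be computed by cancelling $K$. The weight commutes with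
$R$ in the form $D\otimes D$, which gives cyclicity. The algebra $E$ itself is realized by
endomorphisms of the space of functions of infinite sequences of indices. -/

/-! ### Partial traces and numerical operators in infinitely many strands -/

/-- A sequence of commuting systems of matrix units in a `ℂ`-algebra `E`, one for every strand, that
also commute with the image of a coefficient algebra `A`, together with the shift of strands. -/
structure StrandSystem (N : ℕ) (A E : Type*) [Ring A] [Algebra ℂ A] [Ring E] [Algebra ℂ E] where
  e : ℕ → Fin N → Fin N → E
  e_mul : ∀ k a b c d, e k a b * e k c d = if b = c then e k a d else 0
  e_comm : ∀ k l, k ≠ l → ∀ a b c d, e k a b * e l c d = e l c d * e k a b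
  sum_e : ∀ k, ∑ a, e k a a = 1
  ι : A →ₐ[ℂ] E
  ι_injective : Function.Injective ι
  ι_comm : ∀ x k a b, ι x * e k a b = e k a b * ι x
  sh : E →ₐ[ℂ] E
  sh_e : ∀ k a b, sh (e k a b) = e (k + 1) a b

namespace StrandSystem

variable {N : ℕ} {A E : Type*} [Ring A] [Algebra ℂ A] [Ring E] [Algebra ℂ E]
  (S : StrandSystem N A E)

/-- The operators that act trivially in the strand `k`. -/
def cen (k : ℕ) : Subalgebra ℂ E :=
  Subalgebra.centralizer ℂ (Set.range fun p : Fin N × Fin N => S.e k p.1 p.2)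

theorem mem_cen {k : ℕ} {X : E} : X ∈ S.cen k ↔ ∀ a b, S.e k a b * X = X * S.e k a b := by
  simp only [cen, Subalgebra.mem_centralizer_iff, Set.forall_mem_range, Prod.forall]

/-- The operators that act in the first `m` strands only. -/
def loc (m : ℕ) : Subalgebra ℂ E := ⨅ k : ℕ, S.cen (m + k)

theorem mem_loc {m : ℕ} {X : E} : X ∈ S.loc m ↔ ∀ k, m ≤ k → X ∈ S.cen k := by
  simp only [loc, Algebra.mem_iInf]
  constructor
  · intro h k hk
    obtain ⟨j, rfl⟩ := Nat.exists_eq_add_of_le hk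
    exact h j
  · intro h k
    exact h _ (by omega)

theorem loc_mono {m n : ℕ} (h : m ≤ n) : S.loc m ≤ S.loc n := fun _ hX =>
  S.mem_loc.2 fun k hk => S.mem_loc.1 hX k (h.trans hk)

theorem e_mem_cen {k l : ℕ} (h : k ≠ l) (a b : Fin N) : S.e k a b ∈ S.cen l :=
  S.mem_cen.2 fun _ _ => S.e_comm _ _ h.symm _ _ _ _

theorem ι_mem_cen (x : A) (k : ℕ) : S.ι x ∈ S.cen k :=
  S.mem_cen.2 fun _ _ => (S.ι_comm _ _ _ _).symm

theorem ι_mem_loc (x : A) (k : ℕ) : S.ι x ∈ S.loc k :=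
  S.mem_loc.2 fun _ _ => S.ι_mem_cen _ _

/-- The partial trace over the strand `k`. -/
def tr (k : ℕ) : E →ₗ[ℂ] E where
  toFun X := ∑ x, ∑ z, S.e k z x * X * S.e k x z
  map_add' X Y := by simp only [mul_add, add_mul, Finset.sum_add_distrib]
  map_smul' c X := by
    simp only [mul_smul_comm, smul_mul_assoc, Finset.smul_sum, RingHom.id_apply]

theorem tr_apply (k : ℕ) (X : E) : S.tr k X = ∑ x, ∑ z, S.e k z x * X * S.e k x z := rfl

theorem tr_mul_left {k : ℕ} {Y : E} (hY : Y ∈ S.cen k) (X : E) :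
    S.tr k (Y * X) = Y * S.tr k X := by
  rw [mem_cen] at hY
  simp only [tr_apply, Finset.mul_sum]
  refine Finset.sum_congr rfl fun x _ => Finset.sum_congr rfl fun z _ => ?_
  rw [← mul_assoc, hY]; simp only [mul_assoc]

theorem tr_mul_right {k : ℕ} {Y : E} (hY : Y ∈ S.cen k) (X : E) :
    S.tr k (X * Y) = S.tr k X * Y := by
  rw [mem_cen] at hY
  simp only [tr_apply, Finset.sum_mul]
  refine Finset.sum_congr rfl fun x _ => Finset.sum_congr rfl fun z _ => ?_
  simp only [mul_assoc, ← hY]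

/-- Both sides collapse to `∑ z, S.e k z b * X * S.e k a z`. A partial trace is cyclic only for
factors that live in the traced strand. -/
theorem tr_e_mul (k : ℕ) (a b : Fin N) (X : E) :
    S.tr k (S.e k a b * X) = S.tr k (X * S.e k a b) := by
  have h1 : S.tr k (S.e k a b * X) = ∑ z, S.e k z b * X * S.e k a z := by
    simp only [tr_apply, ← mul_assoc, S.e_mul]
    rw [Finset.sum_eq_single a]
    · simp
    · intro x _ hx; simp [hx]
    · simp
  have h2 : S.tr k (X * S.e k a b) = ∑ z, S.e k z b * X * S.e k a z := by
    simp only [tr_apply]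
    rw [Finset.sum_eq_single b]
    · refine Finset.sum_congr rfl fun z _ => ?_
      rw [mul_assoc, mul_assoc X, S.e_mul, if_pos rfl, ← mul_assoc]
    · intro x _ hx
      refine Finset.sum_eq_zero fun z _ => ?_
      rw [mul_assoc, mul_assoc X, S.e_mul, if_neg (Ne.symm hx), mul_zero, mul_zero]
    · simp
  rw [h1, h2]

theorem tr_e (k : ℕ) (a b : Fin N) : S.tr k (S.e k a b) = if a = b then 1 else 0 := by
  simp only [tr_apply, S.e_mul]
  rw [Finset.sum_eq_single a]
  · simp only [if_true, S.e_mul]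
    by_cases h : a = b
    · subst h; simp [S.sum_e]
    · simp [h, Ne.symm h]
  · intro x _ hx; simp [hx]
  · simp

theorem tr_comm {k l : ℕ} (h : k ≠ l) (X : E) : S.tr k (S.tr l X) = S.tr l (S.tr k X) := by
  have hl : ∀ a b a' b', S.e k a b * S.e l a' b' = S.e l a' b' * S.e k a b := S.e_comm k l h
  simp only [tr_apply, Finset.mul_sum, Finset.sum_mul]
  rw [Finset.sum_congr rfl fun x _ => Finset.sum_comm]
  rw [Finset.sum_comm]
  refine Finset.sum_congr rfl fun x' _ => ?_
  rw [Finset.sum_congr rfl fun x _ => Finset.sum_comm]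
  rw [Finset.sum_comm]
  refine Finset.sum_congr rfl fun z' _ => Finset.sum_congr rfl fun x _ =>
    Finset.sum_congr rfl fun z _ => ?_
  simp only [← mul_assoc, hl]
  simp only [mul_assoc, hl]

theorem tr_mem_cen_self (k : ℕ) (X : E) : S.tr k X ∈ S.cen k := by
  rw [mem_cen]
  intro a b
  simp only [tr_apply, Finset.mul_sum, Finset.sum_mul]
  refine Finset.sum_congr rfl fun x _ => ?_
  rw [Finset.sum_eq_single b, Finset.sum_eq_single a]
  · rw [mul_assoc _ (S.e k x a), S.e_mul, ← mul_assoc, ← mul_assoc, S.e_mul]; simp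
  · intro z _ hz
    rw [mul_assoc, S.e_mul, if_neg hz, mul_zero]
  · simp
  · intro z _ hz
    rw [← mul_assoc, ← mul_assoc, S.e_mul, if_neg (Ne.symm hz), zero_mul, zero_mul]
  · simp

theorem tr_mem_cen {k l : ℕ} {X : E} (hX : X ∈ S.cen l) : S.tr k X ∈ S.cen l := by
  by_cases h : k = l
  · subst h; exact S.tr_mem_cen_self _ _
  · rw [tr_apply]
    exact Subalgebra.sum_mem _ fun x _ => Subalgebra.sum_mem _ fun z _ =>
      mul_mem (mul_mem (S.e_mem_cen h _ _) hX) (S.e_mem_cen h _ _)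

/-- The decomposition of an operator into its matrix elements in the strand `k`. -/
theorem eq_sum_e (k : ℕ) (X : E) :
    X = ∑ a, ∑ b, S.e k a b * S.tr k (S.e k b a * X) := by
  have h : ∀ a b, S.e k a b * S.tr k (S.e k b a * X) = S.e k a a * X * S.e k b b := by
    intro a b
    simp only [tr_apply, ← mul_assoc, S.e_mul]
    rw [Finset.sum_eq_single b, Finset.mul_sum, Finset.sum_eq_single b]
    · rw [if_pos rfl, ← mul_assoc, ← mul_assoc, S.e_mul, if_pos rfl]
    · intro z _ hz
      rw [if_pos rfl, ← mul_assoc, ← mul_assoc, S.e_mul, if_neg (Ne.symm hz), zero_mul, zero_mul]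
    · simp
    · intro x _ hx; simp [hx]
    · simp
  simp only [h, ← Finset.mul_sum, S.sum_e, mul_one, ← Finset.sum_mul, one_mul]

/-- A numerical matrix acting in the strand `k`. -/
def one (k : ℕ) (X : Matrix (Fin N) (Fin N) ℂ) : E := ∑ a, ∑ b, X a b • S.e k a b

/-- A numerical operator on `V ⊗ V` acting in the strands `k`, `l`. -/
def two (k l : ℕ) (X : TensorOp N 2 ℂ) : E :=
  ∑ a, ∑ b, ∑ c, ∑ d, X ![a, b] ![c, d] • (S.e k a c * S.e l b d)

theorem one_mem_cen {k l : ℕ} (h : k ≠ l) (X : Matrix (Fin N) (Fin N) ℂ) :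
    S.one k X ∈ S.cen l :=
  Subalgebra.sum_mem _ fun _ _ => Subalgebra.sum_mem _ fun _ _ =>
    Subalgebra.smul_mem _ (S.e_mem_cen h _ _) _

theorem two_mem_cen {k l m : ℕ} (h : k ≠ m) (h' : l ≠ m) (X : TensorOp N 2 ℂ) :
    S.two k l X ∈ S.cen m :=
  Subalgebra.sum_mem _ fun _ _ => Subalgebra.sum_mem _ fun _ _ => Subalgebra.sum_mem _ fun _ _ =>
    Subalgebra.sum_mem _ fun _ _ =>
    Subalgebra.smul_mem _ (mul_mem (S.e_mem_cen h _ _) (S.e_mem_cen h' _ _)) _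

theorem one_comm {k : ℕ} {Y : E} (hY : Y ∈ S.cen k) (X : Matrix (Fin N) (Fin N) ℂ) :
    S.one k X * Y = Y * S.one k X := by
  rw [mem_cen] at hY
  simp only [one, Finset.sum_mul, Finset.mul_sum, smul_mul_assoc, mul_smul_comm, hY]

theorem two_comm {k l : ℕ} {Y : E} (hY : Y ∈ S.cen k) (hY' : Y ∈ S.cen l)
    (X : TensorOp N 2 ℂ) : S.two k l X * Y = Y * S.two k l X := by
  rw [mem_cen] at hY hY'
  simp only [two, Finset.sum_mul, Finset.mul_sum, smul_mul_assoc, mul_smul_comm]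
  simp only [mul_assoc, hY']
  simp only [← mul_assoc, hY]

theorem tr_one_mul (k : ℕ) (X : Matrix (Fin N) (Fin N) ℂ) (Y : E) :
    S.tr k (S.one k X * Y) = S.tr k (Y * S.one k X) := by
  simp only [one, Finset.sum_mul, Finset.mul_sum, smul_mul_assoc, mul_smul_comm, map_sum, map_smul,
    tr_e_mul]

/-- Cyclicity of the trace over the strand `l` for elements that have only this strand in common. -/
theorem tr_two_mul {k l : ℕ} (X : TensorOp N 2 ℂ) {Y : E} (hY : Y ∈ S.cen k) (hkl : k ≠ l) :
    S.tr l (S.two k l X * Y) = S.tr l (Y * S.two k l X) := by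
  rw [mem_cen] at hY
  simp only [two, Finset.sum_mul, Finset.mul_sum, smul_mul_assoc, mul_smul_comm, map_sum, map_smul]
  refine Finset.sum_congr rfl fun a _ => Finset.sum_congr rfl fun b _ =>
    Finset.sum_congr rfl fun c _ => Finset.sum_congr rfl fun d _ => ?_
  rw [mul_assoc, S.tr_mul_left (S.e_mem_cen hkl _ _), tr_e_mul,
    ← S.tr_mul_left (S.e_mem_cen hkl _ _), ← mul_assoc, ← mul_assoc, hY]

theorem sum_fin_two {M : Type*} [AddCommMonoid M] (f : (Fin 2 → Fin N) → M) :
    ∑ i, f i = ∑ a, ∑ b, f ![a, b] := by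
  rw [← (finTwoArrowEquiv (Fin N)).symm.sum_comp, Fintype.sum_prod_type]
  rfl

/-- The matrix units of a pair of strands. -/
def unit₂ (k l : ℕ) (i j : Fin 2 → Fin N) : E := S.e k (i 0) (j 0) * S.e l (i 1) (j 1)

theorem two_eq (k l : ℕ) (X : TensorOp N 2 ℂ) :
    S.two k l X = ∑ i, ∑ j, X i j • S.unit₂ k l i j := by
  simp only [sum_fin_two, unit₂, two]
  rfl

theorem unit₂_mul {k l : ℕ} (h : k ≠ l) (i j i' j' : Fin 2 → Fin N) :
    S.unit₂ k l i j * S.unit₂ k l i' j' = if j = i' then S.unit₂ k l i j' else 0 := by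
  have : j = i' ↔ j 0 = i' 0 ∧ j 1 = i' 1 := by
    rw [funext_iff, Fin.forall_fin_two]
  simp only [unit₂, this, ite_and]
  rw [mul_assoc, ← mul_assoc (S.e l _ _), S.e_comm l k h.symm, mul_assoc, ← mul_assoc,
    S.e_mul, S.e_mul]
  split_ifs <;> simp

theorem two_mul {k l : ℕ} (h : k ≠ l) (X Y : TensorOp N 2 ℂ) :
    S.two k l (X * Y) = S.two k l X * S.two k l Y := by
  simp only [two_eq, Finset.sum_mul, Finset.mul_sum, smul_mul_assoc, mul_smul_comm,
    S.unit₂_mul h, Matrix.mul_apply, Finset.sum_smul, smul_ite, smul_zero,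
    Finset.sum_ite_eq', Finset.mem_univ, if_true]
  rw [Finset.sum_comm]
  refine Eq.trans (Finset.sum_congr rfl fun j _ => Finset.sum_comm) ?_
  rw [Finset.sum_comm]
  refine Finset.sum_congr rfl fun x _ => Finset.sum_congr rfl fun j _ => ?_
  rw [Finset.smul_sum]
  refine Finset.sum_congr rfl fun i _ => ?_
  rw [mul_comm, mul_smul]

theorem two_one {k l : ℕ} : S.two k l 1 = 1 := by
  have : ∀ i j : Fin 2 → Fin N, (1 : TensorOp N 2 ℂ) i j • S.unit₂ k l i j =
      if i = j then S.unit₂ k l i j else 0 := by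
    intro i j; rw [Matrix.one_apply]; split_ifs <;> simp
  simp only [two_eq, this, Finset.sum_ite_eq, Finset.mem_univ, if_true]
  simp only [sum_fin_two, unit₂, Matrix.cons_val_zero, Matrix.cons_val_one, ← Finset.mul_sum, S.sum_e, mul_one]

theorem sh_two (k l : ℕ) (X : TensorOp N 2 ℂ) :
    S.sh (S.two k l X) = S.two (k + 1) (l + 1) X := by
  simp only [two, map_sum, map_smul, map_mul, S.sh_e]

/-- The partial trace over the second factor. -/
def ptr₂ (X : TensorOp N 2 ℂ) : Matrix (Fin N) (Fin N) ℂ :=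
  Matrix.of fun a b => ∑ x, X ![a, x] ![b, x]

/-- The partial trace over the first factor. -/
def ptr₁ (X : TensorOp N 2 ℂ) : Matrix (Fin N) (Fin N) ℂ :=
  Matrix.of fun a b => ∑ x, X ![x, a] ![x, b]

theorem tr_two_right {k l : ℕ} (h : k ≠ l) (X : TensorOp N 2 ℂ) :
    S.tr l (S.two k l X) = S.one k (ptr₂ X) := by
  simp only [two, one, ptr₂, Matrix.of_apply, map_sum, map_smul, S.tr_mul_left (S.e_mem_cen h _ _),
    S.tr_e, mul_ite, mul_one, mul_zero, smul_ite, smul_zero, Finset.sum_ite_eq, Finset.mem_univ,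
    if_true, Finset.sum_smul]
  exact Finset.sum_congr rfl fun a _ => Finset.sum_comm

/-- The permutation of the strands `k`, `l`. -/
def perm (k l : ℕ) : E := ∑ a, ∑ b, S.e k a b * S.e l b a

theorem perm_symm {k l : ℕ} (h : k ≠ l) : S.perm k l = S.perm l k := by
  rw [perm, perm, Finset.sum_comm]
  exact Finset.sum_congr rfl fun a _ => Finset.sum_congr rfl fun b _ => S.e_comm _ _ h _ _ _ _

theorem perm_mem_cen {k l m : ℕ} (h : k ≠ m) (h' : l ≠ m) : S.perm k l ∈ S.cen m :=
  Subalgebra.sum_mem _ fun _ _ => Subalgebra.sum_mem _ fun _ _ =>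
    mul_mem (S.e_mem_cen h _ _) (S.e_mem_cen h' _ _)

/-- Both sides equal `∑ c, S.e k c b * S.e l a c`. This is what relabels strands in the contractions
with a skew inverse. -/
theorem perm_mul_e {k l : ℕ} (h : k ≠ l) (a b : Fin N) :
    S.perm k l * S.e k a b = S.e l a b * S.perm k l := by
  have h1 : S.perm k l * S.e k a b = ∑ c, S.e k c b * S.e l a c := by
    simp only [perm, Finset.sum_mul]
    refine Finset.sum_congr rfl fun c _ => ?_
    rw [Finset.sum_eq_single a]
    · rw [mul_assoc, S.e_comm l k h.symm, ← mul_assoc, S.e_mul, if_pos rfl]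
    · intro x _ hx
      rw [mul_assoc, S.e_comm l k h.symm, ← mul_assoc, S.e_mul, if_neg hx, zero_mul]
    · simp
  have h2 : S.e l a b * S.perm k l = ∑ c, S.e k c b * S.e l a c := by
    simp only [perm, Finset.mul_sum]
    refine Finset.sum_congr rfl fun c _ => ?_
    rw [Finset.sum_eq_single b]
    · rw [← mul_assoc, S.e_comm l k h.symm, mul_assoc, S.e_mul, if_pos rfl]
    · intro x _ hx
      rw [← mul_assoc, S.e_comm l k h.symm, mul_assoc, S.e_mul, if_neg (Ne.symm hx), mul_zero]
    · simp
  rw [h1, h2]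

theorem perm_mul_two {k l m : ℕ} (h : k ≠ l) (hk : k ≠ m) (hl : l ≠ m) (X : TensorOp N 2 ℂ) :
    S.perm k l * S.two k m X = S.two l m X * S.perm k l := by
  have hm := S.mem_cen.1 (S.perm_mem_cen (k := k) (l := l) (m := m) hk hl)
  simp only [two, Finset.sum_mul, Finset.mul_sum, smul_mul_assoc, mul_smul_comm]
  refine Finset.sum_congr rfl fun a _ => Finset.sum_congr rfl fun b _ =>
    Finset.sum_congr rfl fun c _ => Finset.sum_congr rfl fun d _ => ?_
  rw [← mul_assoc, S.perm_mul_e h, mul_assoc, ← hm, mul_assoc]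

theorem perm_mul_one {k l : ℕ} (h : k ≠ l) (X : Matrix (Fin N) (Fin N) ℂ) :
    S.perm k l * S.one k X = S.one l X * S.perm k l := by
  simp only [one, Finset.sum_mul, Finset.mul_sum, smul_mul_assoc, mul_smul_comm, S.perm_mul_e h]

theorem perm_eq_two (k l : ℕ) : S.perm k l = S.two k l (permOp N) := by
  simp only [perm, two, permOp, Matrix.of_apply, Matrix.cons_val_zero, Matrix.cons_val_one, ite_and]
  refine Finset.sum_congr rfl fun a _ => Finset.sum_congr rfl fun b _ => ?_
  rw [Finset.sum_eq_single b (by intro z _ hz; simp [Ne.symm hz]) (by simp)]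
  simp

theorem permOp_mul_self : permOp N * permOp N = 1 := by
  ext i j
  have hi : i = ![i 0, i 1] := by ext x; fin_cases x <;> rfl
  have hj : j = ![j 0, j 1] := by ext x; fin_cases x <;> rfl
  have hij : i = j ↔ i 0 = j 0 ∧ i 1 = j 1 := by rw [funext_iff, Fin.forall_fin_two]
  rw [Matrix.mul_apply, sum_fin_two, Matrix.one_apply]
  simp only [permOp, Matrix.of_apply, Matrix.cons_val_zero, Matrix.cons_val_one, hij]
  rw [Finset.sum_eq_single (i 1) (by intro z _ hz; simp [Ne.symm hz]) (by simp),
    Finset.sum_eq_single (i 0) (by intro z _ hz; simp [Ne.symm hz]) (by simp)]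
  simp [and_comm]

theorem perm_mul_self {k l : ℕ} (h : k ≠ l) : S.perm k l * S.perm k l = 1 := by
  rw [perm_eq_two, ← S.two_mul h, permOp_mul_self, two_one]

theorem tr_perm {k l : ℕ} (h : k ≠ l) : S.tr l (S.perm k l) = 1 := by
  simp only [perm, map_sum, S.tr_mul_left (S.e_mem_cen h _ _), S.tr_e, mul_ite, mul_one, mul_zero,
    Finset.sum_ite_eq', Finset.mem_univ, if_true, S.sum_e]

theorem sum_fin_three {M : Type*} [AddCommMonoid M] (f : (Fin 3 → Fin N) → M) :
    ∑ i, f i = ∑ a, ∑ b, ∑ c, f ![a, b, c] := by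
  rw [← (Fin.consEquiv fun _ : Fin 3 => Fin N).sum_comp, Fintype.sum_prod_type]
  refine Finset.sum_congr rfl fun a _ => ?_
  rw [sum_fin_two]
  rfl

/-- The matrix units of a triple of strands. -/
def unit₃ (k l m : ℕ) (i j : Fin 3 → Fin N) : E :=
  S.e k (i 0) (j 0) * S.e l (i 1) (j 1) * S.e m (i 2) (j 2)

/-- A numerical operator on `V ⊗ V ⊗ V` acting in the strands `k`, `l`, `m`. -/
def three (k l m : ℕ) (X : TensorOp N 3 ℂ) : E := ∑ i, ∑ j, X i j • S.unit₃ k l m i j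

theorem unit₃_mul {k l m : ℕ} (h : k ≠ l) (h' : k ≠ m) (h'' : l ≠ m) (i j i' j' : Fin 3 → Fin N) :
    S.unit₃ k l m i j * S.unit₃ k l m i' j' = if j = i' then S.unit₃ k l m i j' else 0 := by
  have : j = i' ↔ j 2 = i' 2 ∧ (![j 0, j 1] = ![i' 0, i' 1]) := by
    constructor
    · rintro rfl; simp
    · rintro ⟨h1, h2⟩
      have h3 := congrFun h2 0
      have h4 := congrFun h2 1
      ext x; fin_cases x
      · exact congrArg Fin.val h3
      · exact congrArg Fin.val h4
      · exact congrArg Fin.val h1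
  have hu := S.unit₂_mul h ![i 0, i 1] ![j 0, j 1] ![i' 0, i' 1] ![j' 0, j' 1]
  simp only [unit₂, Matrix.cons_val_zero, Matrix.cons_val_one] at hu
  have hc : S.e m (i 2) (j 2) * (S.e k (i' 0) (j' 0) * S.e l (i' 1) (j' 1)) =
      (S.e k (i' 0) (j' 0) * S.e l (i' 1) (j' 1)) * S.e m (i 2) (j 2) :=
    S.mem_cen.1 (mul_mem (S.e_mem_cen h' _ _) (S.e_mem_cen h'' _ _)) _ _
  simp only [unit₃, this, ite_and]
  rw [mul_assoc (S.e k (i 0) (j 0) * S.e l (i 1) (j 1)), ← mul_assoc (S.e m _ _), hc,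
    mul_assoc (S.e k (i' 0) (j' 0) * S.e l (i' 1) (j' 1)), ← mul_assoc, hu, S.e_mul]
  split_ifs <;> simp

theorem three_mul {k l m : ℕ} (h : k ≠ l) (h' : k ≠ m) (h'' : l ≠ m) (X Y : TensorOp N 3 ℂ) :
    S.three k l m (X * Y) = S.three k l m X * S.three k l m Y := by
  simp only [three, Finset.sum_mul, Finset.mul_sum, smul_mul_assoc, mul_smul_comm,
    S.unit₃_mul h h' h'', Matrix.mul_apply, Finset.sum_smul, smul_ite, smul_zero,
    Finset.sum_ite_eq', Finset.mem_univ, if_true]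
  rw [Finset.sum_comm]
  refine Eq.trans (Finset.sum_congr rfl fun j _ => Finset.sum_comm) ?_
  rw [Finset.sum_comm]
  refine Finset.sum_congr rfl fun x _ => Finset.sum_congr rfl fun j _ => ?_
  rw [Finset.smul_sum]
  refine Finset.sum_congr rfl fun i _ => ?_
  rw [mul_comm, mul_smul]

theorem opAt_zero_three (X : TensorOp N 2 ℂ) (a b c a' b' c' : Fin N) :
    opAt (n := 2) X 0 ![a, b, c] ![a', b', c'] = if c = c' then X ![a, b] ![a', b'] else 0 := by
  have h : (∀ p, p ∉ Set.range (adj (0 : Fin 2)) →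
      (![a, b, c] : Fin 3 → Fin N) p = (![a', b', c'] : Fin 3 → Fin N) p) ↔ c = c' := by
    constructor
    · intro h
      exact h 2 (by rintro ⟨x, hx⟩; fin_cases x <;> simp [adj, Fin.ext_iff] at hx)
    · rintro rfl p hp
      fin_cases p
      · exact absurd ⟨0, rfl⟩ hp
      · exact absurd ⟨1, rfl⟩ hp
      · rfl
  have h1 : ∀ x y z : Fin N, (![x, y, z] : Fin 3 → Fin N) ∘ adj (0 : Fin 2) = ![x, y] := by
    intro x y z; funext t; fin_cases t <;> rfl
  simp only [opAt, place, Matrix.of_apply, h, h1]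

theorem opAt_one_three (X : TensorOp N 2 ℂ) (a b c a' b' c' : Fin N) :
    opAt (n := 2) X 1 ![a, b, c] ![a', b', c'] = if a = a' then X ![b, c] ![b', c'] else 0 := by
  have h : (∀ p, p ∉ Set.range (adj (1 : Fin 2)) →
      (![a, b, c] : Fin 3 → Fin N) p = (![a', b', c'] : Fin 3 → Fin N) p) ↔ a = a' := by
    constructor
    · intro h
      exact h 0 (by rintro ⟨x, hx⟩; fin_cases x <;> simp [adj, Fin.ext_iff] at hx)
    · rintro rfl p hp
      fin_cases p
      · rfl
      · exact absurd ⟨0, rfl⟩ hp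
      · exact absurd ⟨1, rfl⟩ hp
  have h1 : ∀ x y z : Fin N, (![x, y, z] : Fin 3 → Fin N) ∘ adj (1 : Fin 2) = ![y, z] := by
    intro x y z; funext t; fin_cases t <;> rfl
  simp only [opAt, place, Matrix.of_apply, h, h1]

theorem three_opAt_zero (k l m : ℕ) (X : TensorOp N 2 ℂ) :
    S.three k l m (opAt X 0) = S.two k l X := by
  simp only [three, sum_fin_three, opAt_zero_three, unit₃, Matrix.cons_val_zero,
    Matrix.cons_val_one, Matrix.cons_val, ite_smul, zero_smul, Finset.sum_ite_eq, Finset.mem_univ, if_true,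
    two]
  refine Finset.sum_congr rfl fun a _ => Finset.sum_congr rfl fun b _ => ?_
  rw [Finset.sum_comm]
  refine Finset.sum_congr rfl fun c _ => ?_
  rw [Finset.sum_comm]
  refine Finset.sum_congr rfl fun d _ => ?_
  rw [← Finset.smul_sum, ← Finset.mul_sum, S.sum_e, mul_one]

theorem three_opAt_one (k l m : ℕ) (X : TensorOp N 2 ℂ) :
    S.three k l m (opAt X 1) = S.two l m X := by
  simp only [three, sum_fin_three, opAt_one_three, unit₃, Matrix.cons_val_zero,
    Matrix.cons_val_one, Matrix.cons_val, ite_smul, zero_smul, two]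
  have h : ∀ a b c : Fin N, (∑ a', ∑ b', ∑ c', if a = a' then X ![b, c] ![b', c'] •
      (S.e k a a' * S.e l b b' * S.e m c c') else 0) =
      ∑ b', ∑ c', X ![b, c] ![b', c'] • (S.e k a a * S.e l b b' * S.e m c c') := by
    intro a b c
    rw [Finset.sum_eq_single a (by intro z _ hz; simp [Ne.symm hz]) (by simp)]
    simp
  simp only [h]
  rw [Finset.sum_comm]
  refine Finset.sum_congr rfl fun b _ => ?_
  rw [Finset.sum_comm]
  refine Finset.sum_congr rfl fun c _ => ?_
  rw [Finset.sum_comm]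
  refine Finset.sum_congr rfl fun b' _ => ?_
  rw [Finset.sum_comm]
  refine Finset.sum_congr rfl fun c' _ => ?_
  rw [← Finset.smul_sum, ← Finset.sum_mul, ← Finset.sum_mul, S.sum_e, _root_.one_mul]

theorem three_smul (k l m : ℕ) (c : ℂ) (X : TensorOp N 3 ℂ) :
    S.three k l m (c • X) = c • S.three k l m X := by
  simp only [three, Matrix.smul_apply, smul_assoc, Finset.smul_sum]

theorem trMid_mul_apply (X Y : TensorOp N 2 ℂ) (a b c d : Fin N) :
    trMid (opAt X 0 * opAt Y 1) ![a, b] ![c, d] =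
      ∑ x, ∑ y, X ![a, x] ![c, y] * Y ![y, b] ![x, d] := by
  simp only [trMid, Matrix.of_apply]
  refine Finset.sum_congr rfl fun x _ => ?_
  rw [Matrix.mul_apply]
  refine (sum_fin_three _).trans ?_
  have h1 : ∀ p q r : Fin N, opAt (n := 2) X 0 ![![a, b] 0, x, ![a, b] 1] ![p, q, r] =
      if b = r then X ![a, x] ![p, q] else 0 := opAt_zero_three X a x b
  have h2 : ∀ p q r : Fin N, opAt (n := 2) Y 1 ![p, q, r] ![![c, d] 0, x, ![c, d] 1] =
      if p = c then Y ![q, r] ![x, d] else 0 := fun p q r => opAt_one_three Y p q r c x d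
  simp only [h1, h2, ite_mul, zero_mul, mul_ite, mul_zero]
  rw [Finset.sum_eq_single c (by intro z _ hz; simp [hz]) (by simp)]
  simp

/-- The bridge from `trMid`, in which skew inverses are defined, to partial traces in `E`. Expanding
both operators in the matrix units of the middle strand reduces it to `tr_e`. -/
theorem tr_two_mul_two {k l m : ℕ} (h : k ≠ l) (_ : k ≠ m) (h'' : l ≠ m)
    (X Y : TensorOp N 2 ℂ) :
    S.tr l (S.two k l X * S.two l m Y) = S.two k m (trMid (opAt X 0 * opAt Y 1)) := by
  have hX : S.two k l X =
      ∑ x, ∑ y, (∑ a, ∑ c, X ![a, x] ![c, y] • S.e k a c) * S.e l x y := by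
    simp only [two, Finset.sum_mul, smul_mul_assoc]
    rw [Finset.sum_comm]
    refine Finset.sum_congr rfl fun x _ => ?_
    rw [Finset.sum_congr rfl fun a _ => Finset.sum_comm, Finset.sum_comm]
  have hY : S.two l m Y =
      ∑ y, ∑ x, S.e l y x * (∑ b, ∑ d, Y ![y, b] ![x, d] • S.e m b d) := by
    simp only [two, Finset.mul_sum, mul_smul_comm]
    refine Finset.sum_congr rfl fun x _ => ?_
    rw [Finset.sum_comm]
  have hk : ∀ x y, (∑ a, ∑ c, X ![a, x] ![c, y] • S.e k a c) ∈ S.cen l := fun x y =>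
    Subalgebra.sum_mem _ fun _ _ => Subalgebra.sum_mem _ fun _ _ =>
      Subalgebra.smul_mem _ (S.e_mem_cen h _ _) _
  have hm : ∀ y x, (∑ b, ∑ d, Y ![y, b] ![x, d] • S.e m b d) ∈ S.cen l := fun x y =>
    Subalgebra.sum_mem _ fun _ _ => Subalgebra.sum_mem _ fun _ _ =>
      Subalgebra.smul_mem _ (S.e_mem_cen h''.symm _ _) _
  rw [hX, hY]
  have hxy : ∀ (P Q : E) x y y' x', P ∈ S.cen l → Q ∈ S.cen l →
      S.tr l (P * S.e l x y * (S.e l y' x' * Q)) = if y = y' then if x = x' then P * Q else 0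
        else 0 := by
    intro P Q x y y' x' hP hQ
    rw [show P * S.e l x y * (S.e l y' x' * Q) = P * ((S.e l x y * S.e l y' x') * Q) by
      simp only [mul_assoc], S.tr_mul_left hP, S.tr_mul_right hQ, S.e_mul]
    split_ifs with h1 h2
    · rw [S.tr_e, if_pos h2, _root_.one_mul]
    · rw [S.tr_e, if_neg h2, zero_mul, mul_zero]
    · simp
  simp only [Finset.sum_mul_sum, map_sum, hxy _ _ _ _ _ _ (hk _ _) (hm _ _)]
  simp only [two, trMid_mul_apply, Finset.sum_smul]
  have hite : ∀ (G : Fin N → Fin N → Fin N → Fin N → E),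
      (∑ x, ∑ y', ∑ y, ∑ x', if y = y' then if x = x' then G x y' y x' else 0 else 0) =
        ∑ x, ∑ y, G x y y x := by
    intro G
    refine Finset.sum_congr rfl fun x _ => Finset.sum_congr rfl fun y _ => ?_
    rw [Finset.sum_eq_single y (by intro z _ hz; simp [hz]) (by simp)]
    simp
  refine (hite fun x y' y x' => ∑ a, ∑ b, ∑ c, ∑ d,
    X ![a, x] ![c, y] • S.e k a c * Y ![y', b] ![x', d] • S.e m b d).trans ?_
  rw [Finset.sum_congr rfl fun x _ => Finset.sum_comm, Finset.sum_comm]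
  refine Finset.sum_congr rfl fun a _ => ?_
  rw [Finset.sum_congr rfl fun x _ => Finset.sum_comm, Finset.sum_comm]
  refine Finset.sum_congr rfl fun b _ => ?_
  rw [Finset.sum_congr rfl fun x _ => Finset.sum_comm, Finset.sum_comm]
  refine Finset.sum_congr rfl fun c _ => ?_
  rw [Finset.sum_congr rfl fun x _ => Finset.sum_comm, Finset.sum_comm]
  refine Finset.sum_congr rfl fun d _ => ?_
  simp only [smul_mul_smul_comm]

end StrandSystem

/-! ### Skew inverses, the weight `D` and its trace -/

namespace StrandSystem

variable {N : ℕ} {A E : Type*} [Ring A] [Algebra ℂ A] [Ring E] [Algebra ℂ E]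
  (S : StrandSystem N A E)

theorem tr_two_skewInverse {X Ψ : TensorOp N 2 ℂ} (h : IsSkewInverse X Ψ) {k l m : ℕ}
    (h1 : k ≠ l) (h2 : k ≠ m) (h3 : l ≠ m) :
    S.tr l (S.two k l X * S.two l m Ψ) = S.perm k m := by
  rw [S.tr_two_mul_two h1 h2 h3, h.1, perm_eq_two]

theorem tr_skewInverse_two {X Ψ : TensorOp N 2 ℂ} (h : IsSkewInverse X Ψ) {k l m : ℕ}
    (h1 : k ≠ l) (h2 : k ≠ m) (h3 : l ≠ m) :
    S.tr l (S.two k l Ψ * S.two l m X) = S.perm k m := by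
  rw [S.tr_two_mul_two h1 h2 h3, h.2, perm_eq_two]

/-- The trace weighted by the matrix `D`. -/
def wtr (D : Matrix (Fin N) (Fin N) ℂ) (k : ℕ) : E →ₗ[ℂ] E :=
  S.tr k ∘ₗ LinearMap.mulLeft ℂ (S.one k D)

theorem wtr_apply (D : Matrix (Fin N) (Fin N) ℂ) (k : ℕ) (X : E) :
    S.wtr D k X = S.tr k (S.one k D * X) := rfl

theorem wtr_apply' (D : Matrix (Fin N) (Fin N) ℂ) (k : ℕ) (X : E) :
    S.wtr D k X = S.tr k (X * S.one k D) := S.tr_one_mul _ _ _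

theorem wtr_mul_left (D : Matrix (Fin N) (Fin N) ℂ) {k : ℕ} {Y : E} (hY : Y ∈ S.cen k) (X : E) :
    S.wtr D k (Y * X) = Y * S.wtr D k X := by
  rw [wtr_apply', mul_assoc, S.tr_mul_left hY, ← wtr_apply']

theorem wtr_mul_right (D : Matrix (Fin N) (Fin N) ℂ) {k : ℕ} {Y : E} (hY : Y ∈ S.cen k) (X : E) :
    S.wtr D k (X * Y) = S.wtr D k X * Y := by
  rw [wtr_apply, ← mul_assoc, S.tr_mul_right hY, ← wtr_apply]

theorem wtr_mem_cen_self (D : Matrix (Fin N) (Fin N) ℂ) (k : ℕ) (X : E) : S.wtr D k X ∈ S.cen k :=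
  S.tr_mem_cen_self _ _

theorem wtr_mem_cen (D : Matrix (Fin N) (Fin N) ℂ) {k l : ℕ} {X : E} (hX : X ∈ S.cen l) :
    S.wtr D k X ∈ S.cen l := by
  by_cases h : k = l
  · subst h; exact S.wtr_mem_cen_self _ _ _
  · exact S.tr_mem_cen (mul_mem (S.one_mem_cen h _) hX)

theorem wtr_mem_loc (D : Matrix (Fin N) (Fin N) ℂ) {k : ℕ} {X : E} (hX : X ∈ S.loc (k + 1)) :
    S.wtr D k X ∈ S.loc k := by
  rw [mem_loc] at hX ⊢
  intro l hl
  rcases hl.eq_or_lt with rfl | hl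
  · exact S.wtr_mem_cen_self _ _ _
  · exact S.wtr_mem_cen _ (hX l hl)

section SkewInverse

variable {S}
variable {R Ψ : TensorOp N 2 ℂ}

/-- The `D`-weighted trace of `R` over the second factor is the identity. -/
theorem wtr_two (h : IsSkewInverse R Ψ) {k l : ℕ} (hkl : k ≠ l) :
    S.wtr (ptr₂ Ψ) l (S.two k l R) = 1 := by
  obtain ⟨m, hk, hl⟩ : ∃ m, k ≠ m ∧ l ≠ m := ⟨k + l + 1, by omega, by omega⟩
  rw [wtr_apply', ← S.tr_two_right hl, ← S.tr_mul_left (S.two_mem_cen hk hl _), S.tr_comm hl,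
    S.tr_two_skewInverse h hkl hk hl, S.tr_perm hk]

theorem two_mul_cancel {G G' : TensorOp N 2 ℂ} (hG : G * G' = 1) {k l : ℕ} (hkl : k ≠ l) :
    S.two k l G * S.two k l G' = 1 := by
  rw [← S.two_mul hkl, hG, two_one]

/-- Write $P_{kl}=\mathrm{Tr}_p\Psi_{kp}R_{pl}$ and $D_m=\mathrm{Tr}_t\Psi_{mt}$. The relation
`hrel` moves the conjugation from the strands $l,m$ to $p,l$ and turns $R_{pl}$ into $R_{lm}$, which
contracts with $\Psi_{mt}$ to $P_{lt}$. Its trace over $t$ is $1$, so $G'$ and $G$ cancel and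
$\mathrm{Tr}_p\Psi_{kp}=D_k$ is left. -/
theorem wtr_conj_perm (h : IsSkewInverse R Ψ) {G G' : TensorOp N 2 ℂ} (hG : G' * G = 1)
    (hrel : opAt (n := 2) G' 0 * opAt R 1 * opAt G 0 = opAt G 1 * opAt R 0 * opAt G' 1)
    {k l m : ℕ} (hkl : k ≠ l) (hkm : k ≠ m) (hlm : l ≠ m) :
    S.tr m (S.two l m G * S.perm k l * S.two l m G' * S.one m (ptr₂ Ψ)) =
      S.one k (ptr₂ Ψ) := by
  obtain ⟨p, hpk, hpl, hpm⟩ : ∃ p, p ≠ k ∧ p ≠ l ∧ p ≠ m :=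
    ⟨k + l + m + 1, by omega, by omega, by omega⟩
  obtain ⟨t, htk, htl, htm, htp⟩ : ∃ t, t ≠ k ∧ t ≠ l ∧ t ≠ m ∧ t ≠ p :=
    ⟨k + l + m + p + 1, by omega, by omega, by omega, by omega⟩
  have hr := congrArg (S.three p l m) hrel
  simp only [S.three_mul hpl hpm hlm, three_opAt_zero, three_opAt_one] at hr
  have h1 : S.tr p (S.two k p Ψ * (S.two l m G * S.two p l R * S.two l m G')) =
      S.two l m G * S.perm k l * S.two l m G' := by
    have hc : ∀ Z, S.two l m Z ∈ S.cen p := fun Z => S.two_mem_cen hpl.symm hpm.symm _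
    rw [← mul_assoc, ← mul_assoc, S.two_comm (S.two_mem_cen hkl.symm hkm.symm _) (hc G),
      S.tr_mul_right (hc G'), mul_assoc (S.two l m G), S.tr_mul_left (hc G),
      S.tr_skewInverse_two h hpk.symm hkl hpl]
  have h2 : S.tr m (S.two p l G' * S.two l m R * S.two p l G * S.two m t Ψ) =
      S.two p l G' * S.perm l t * S.two p l G := by
    have hc : ∀ Z, S.two p l Z ∈ S.cen m := fun Z => S.two_mem_cen hpm hlm _
    rw [mul_assoc _ (S.two p l G), S.two_comm (S.two_mem_cen hpm.symm htp _)
      (S.two_mem_cen hlm.symm htl _) G, ← mul_assoc, S.tr_mul_right (hc G), mul_assoc,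
      S.tr_mul_left (hc G'), S.tr_two_skewInverse h hlm htl.symm htm.symm]
  calc S.tr m (S.two l m G * S.perm k l * S.two l m G' * S.one m (ptr₂ Ψ))
      = S.tr t (S.tr m (S.two l m G * S.perm k l * S.two l m G' * S.two m t Ψ)) := by
        rw [S.tr_comm htm, S.tr_mul_left (mul_mem (mul_mem (S.two_mem_cen htl.symm htm.symm _)
          (S.perm_mem_cen htk.symm htl.symm)) (S.two_mem_cen htl.symm htm.symm _)),
          S.tr_two_right htm.symm]
    _ = S.tr t (S.tr m (S.tr p (S.two k p Ψ *
          (S.two p l G' * S.two l m R * S.two p l G * S.two m t Ψ)))) := by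
        rw [hr, ← mul_assoc, S.tr_mul_right (S.two_mem_cen hpm.symm htp _), h1]
    _ = S.tr p (S.two k p Ψ * S.tr t (S.two p l G' * S.perm l t * S.two p l G)) := by
        rw [S.tr_comm hpm.symm, S.tr_mul_left (S.two_mem_cen hkm hpm _), h2, S.tr_comm htp,
          S.tr_mul_left (S.two_mem_cen htk.symm htp.symm _)]
    _ = S.one k (ptr₂ Ψ) := by
        have hc : ∀ Z, S.two p l Z ∈ S.cen t := fun Z => S.two_mem_cen htp.symm htl.symm _
        rw [S.tr_mul_right (hc G), S.tr_mul_left (hc G'), S.tr_perm htl.symm, mul_one,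
          two_mul_cancel hG hpl, mul_one, S.tr_two_right hpk.symm]

/-- Conjugation by `G` turns the `D`-weighted trace over a strand into the one over the next. -/
theorem wtr_conj [Nontrivial E] (h : IsSkewInverse R Ψ) {G G' : TensorOp N 2 ℂ} (hG : G' * G = 1)
    (hrel : opAt (n := 2) G' 0 * opAt R 1 * opAt G 0 = opAt G 1 * opAt R 0 * opAt G' 1)
    {l m : ℕ} (hlm : l ≠ m) {Z : E} (hZ : Z ∈ S.cen m) :
    S.wtr (ptr₂ Ψ) m (S.two l m G * Z * S.two l m G') = S.wtr (ptr₂ Ψ) l Z := by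
  obtain ⟨k, hkl, hkm⟩ : ∃ k, k ≠ l ∧ k ≠ m := ⟨l + m + 1, by omega, by omega⟩
  -- Since $P_{kl}=\sum e_k(a,b)\,e_l(b,a)$, the coefficient of $e_k(a,b)$ in `wtr_conj_perm` is the
  -- claim for one matrix unit in strand $l$. A general `Z` is afterwards expanded by `eq_sum_e`.
  have key : ∀ a b, S.tr m (S.two l m G * S.e l b a * S.two l m G' * S.one m (ptr₂ Ψ)) =
      ptr₂ Ψ a b • 1 := by
    intro a b
    have h0 := S.wtr_conj_perm h hG hrel hkl hkm hlm
    have hc : ∀ x y : Fin N, S.e k x y * S.two l m G = S.two l m G * S.e k x y := fun x y =>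
      S.mem_cen.1 (S.two_mem_cen hkl.symm hkm.symm _) x y
    have h1 : S.tr m (S.two l m G * S.perm k l * S.two l m G' * S.one m (ptr₂ Ψ)) =
        ∑ a, ∑ b, S.e k a b *
          S.tr m (S.two l m G * S.e l b a * S.two l m G' * S.one m (ptr₂ Ψ)) := by
      simp only [perm, Finset.mul_sum, Finset.sum_mul, map_sum]
      refine Finset.sum_congr rfl fun x _ => Finset.sum_congr rfl fun y _ => ?_
      rw [← S.tr_mul_left (S.e_mem_cen hkm x y)]
      simp only [← mul_assoc, hc]
    rw [h1] at h0
    have h2 := congrArg (fun W => S.tr k (S.e k b a * W)) h0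
    have hy : ∀ x y, S.tr m (S.two l m G * S.e l y x * S.two l m G' * S.one m (ptr₂ Ψ)) ∈
        S.cen k := fun x y => S.tr_mem_cen (mul_mem (mul_mem (mul_mem
          (S.two_mem_cen hkl.symm hkm.symm _) (S.e_mem_cen hkl.symm _ _))
          (S.two_mem_cen hkl.symm hkm.symm _)) (S.one_mem_cen hkm.symm _))
    have hdel : ∀ (w : Fin N → Fin N → E), (∀ x y, w x y ∈ S.cen k) →
        S.tr k (S.e k b a * ∑ x, ∑ y, S.e k x y * w x y) = w a b := by
      intro w hw
      simp only [Finset.mul_sum, map_sum, ← mul_assoc, S.tr_mul_right (hw _ _), S.e_mul]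
      rw [Finset.sum_eq_single a (by intro z _ hz; simp [Ne.symm hz]) (by simp),
        Finset.sum_eq_single b (by intro z _ hz; simp [S.tr_e, Ne.symm hz]) (by simp)]
      simp [S.tr_e]
    have h3 : S.one k (ptr₂ Ψ) = ∑ x, ∑ y, S.e k x y * (ptr₂ Ψ x y • 1) := by
      simp only [one, mul_smul_comm, mul_one]
    beta_reduce at h2
    rw [hdel _ hy, h3] at h2
    exact h2.trans (hdel (fun x y => ptr₂ Ψ x y • (1 : E))
      fun x y => Subalgebra.smul_mem _ (one_mem _) _)
  have hz : ∀ a b, S.tr l (S.e l b a * Z) ∈ S.cen m := fun a b =>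
    S.tr_mem_cen (mul_mem (S.e_mem_cen hlm _ _) hZ)
  have hz' : ∀ a b, S.tr l (S.e l b a * Z) ∈ S.cen l := fun a b => S.tr_mem_cen_self _ _
  conv_lhs => rw [S.eq_sum_e l Z]
  simp only [Finset.mul_sum, Finset.sum_mul, map_sum]
  rw [wtr_apply, one]
  simp only [Finset.sum_mul, map_sum, smul_mul_assoc, map_smul]
  rw [Finset.sum_comm]
  refine Finset.sum_congr rfl fun a _ => Finset.sum_congr rfl fun b _ => ?_
  rw [wtr_apply', mul_assoc, mul_assoc, mul_assoc, ← mul_assoc _ (S.two l m G'),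
    ← S.two_comm (hz' _ _) (hz _ _), mul_assoc (S.two l m G'), ← S.one_comm (hz _ _)]
  simp only [← mul_assoc]
  rw [S.tr_mul_right (hz _ _), key, smul_mul_assoc, _root_.one_mul]

theorem perm_conj_mem_cen {p l : ℕ} (hpl : p ≠ l) {Y : E} (hY : Y ∈ S.cen p) :
    S.perm p l * Y * S.perm p l ∈ S.cen l := by
  rw [mem_cen] at hY ⊢
  intro a b
  calc S.e l a b * (S.perm p l * Y * S.perm p l)
      = S.perm p l * (S.e p a b * Y) * S.perm p l := by
        rw [← mul_assoc, ← mul_assoc, ← S.perm_mul_e hpl]; simp only [mul_assoc]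
    _ = S.perm p l * Y * (S.perm l p * S.e l a b) := by
        rw [hY, S.perm_mul_e hpl.symm, S.perm_symm hpl]; simp only [mul_assoc]
    _ = _ := by rw [← S.perm_symm hpl, mul_assoc, mul_assoc, mul_assoc]

/-- An operator is determined by its contraction with a skew invertible operator. -/
theorem two_contract_injective (h : IsSkewInverse R Ψ) {k l p : ℕ} (hkl : k ≠ l) (hpk : p ≠ k)
    (hpl : p ≠ l) {Y Y' : E} (hk : Y ∈ S.cen k) (hk' : Y' ∈ S.cen k) (hp : Y ∈ S.cen p)
    (hp' : Y' ∈ S.cen p) (hY : S.tr l (S.two k l R * Y) = S.tr l (S.two k l R * Y')) :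
    Y = Y' := by
  -- The inverse of the contraction: contracting again with $\Psi_{pk}$ gives $\mathrm{Tr}_l
  -- P_{pl}Y$, which is `Y` transported from strand $l$ to $p$; conjugation by $P_{pl}$ brings it
  -- back.
  have key : ∀ Y, Y ∈ S.cen k → Y ∈ S.cen p →
      S.perm p l * S.tr k (S.two p k Ψ * S.tr l (S.two k l R * Y)) * S.perm p l = Y := by
    intro Y hk hp
    have hpp := S.perm_mul_self hpl
    have h1 : S.perm p l * Y = S.perm p l * Y * S.perm p l * S.perm p l := by
      rw [mul_assoc (S.perm p l * Y), hpp, mul_one]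
    rw [← S.tr_mul_left (S.two_mem_cen hpl hkl _), S.tr_comm hkl, ← mul_assoc,
      S.tr_mul_right hk, S.tr_skewInverse_two h hpk hpl hkl, h1,
      S.tr_mul_left (perm_conj_mem_cen hpl hp), S.tr_perm hpl, mul_one]
    simp only [← mul_assoc, hpp, _root_.one_mul]
    rw [mul_assoc, hpp, mul_one]
  rw [← key Y hk hp, hY, key Y' hk' hp']

end SkewInverse

theorem opAt_mul {n : ℕ} (m : Fin n) (X Y : TensorOp N 2 ℂ) :
    opAt X m * opAt Y m = opAt (X * Y) m := (place_mul (adj_injective m) X Y).symm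

theorem opAt_one {n : ℕ} (m : Fin n) : opAt (1 : TensorOp N 2 ℂ) m = 1 := place_one

/-- The compatibility of `R` with `F` in conjugation form. -/
theorem conj_rel_of_compatible {X G G' : TensorOp N 2 ℂ} (h1 : G * G' = 1) (h2 : G' * G = 1)
    (h : opAt (n := 2) X 1 * opAt G 0 * opAt G 1 = opAt G 0 * opAt G 1 * opAt X 0) :
    opAt (n := 2) G' 0 * opAt X 1 * opAt G 0 = opAt G 1 * opAt X 0 * opAt G' 1 := by
  have e1 : opAt (n := 2) G' 0 * opAt G 0 = 1 := by rw [opAt_mul, h2, opAt_one]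
  have e2 : opAt (n := 2) G 1 * opAt G' 1 = 1 := by rw [opAt_mul, h1, opAt_one]
  calc opAt (n := 2) G' 0 * opAt X 1 * opAt G 0
      = opAt (n := 2) G' 0 * (opAt X 1 * opAt G 0 * opAt G 1) * opAt G' 1 := by
        simp only [mul_assoc, e2, mul_one]
    _ = (opAt (n := 2) G' 0 * opAt G 0) * opAt G 1 * opAt X 0 * opAt G' 1 := by
        rw [h]; simp only [mul_assoc]
    _ = _ := by rw [e1, _root_.one_mul]

/-- The version for conjugation by the inverse operator; it uses the other twist relation. -/
theorem conj_rel_of_compatible' {X G G' : TensorOp N 2 ℂ} (h1 : G * G' = 1) (h2 : G' * G = 1)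
    (h : opAt (n := 2) X 0 * opAt G 1 * opAt G 0 = opAt G 1 * opAt G 0 * opAt X 1) :
    opAt (n := 2) G 0 * opAt X 1 * opAt G' 0 = opAt G' 1 * opAt X 0 * opAt G 1 := by
  have e1 : opAt (n := 2) G' 1 * opAt G 1 = 1 := by rw [opAt_mul, h2, opAt_one]
  have e2 : opAt (n := 2) G 0 * opAt G' 0 = 1 := by rw [opAt_mul, h1, opAt_one]
  calc opAt (n := 2) G 0 * opAt X 1 * opAt G' 0
      = opAt (n := 2) G' 1 * opAt G 1 * opAt G 0 * opAt X 1 * opAt G' 0 := by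
        rw [e1, _root_.one_mul]
    _ = opAt (n := 2) G' 1 * (opAt X 0 * opAt G 1 * opAt G 0) * opAt G' 0 := by
        rw [h]; simp only [mul_assoc]
    _ = _ := by simp only [mul_assoc, e2, mul_one]

section DD

variable {S}
variable {R R' Ψ : TensorOp N 2 ℂ}

/-- The weight `D ⊗ D` commutes with `R`. -/
theorem two_comm_DD (h : IsSkewInverse R Ψ) (h1 : R * R' = 1) (h2 : R' * R = 1)
    (ybe : opAt (n := 2) R 0 * opAt R 1 * opAt R 0 = opAt R 1 * opAt R 0 * opAt R 1)
    {k l : ℕ} (hkl : k ≠ l) :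
    S.two k l R * (S.one k (ptr₂ Ψ) * S.one l (ptr₂ Ψ)) =
      (S.one k (ptr₂ Ψ) * S.one l (ptr₂ Ψ)) * S.two k l R := by
  obtain ⟨m, hmk, hml⟩ : ∃ m, m ≠ k ∧ m ≠ l := ⟨k + l + 1, by omega, by omega⟩
  obtain ⟨p, hpm, hpk, hpl⟩ : ∃ p, p ≠ m ∧ p ≠ k ∧ p ≠ l :=
    ⟨k + l + m + 1, by omega, by omega, by omega⟩
  set D := ptr₂ Ψ with hD
  have dk : ∀ {a b : ℕ}, a ≠ b → ∀ X Y, S.one a X * S.one b Y = S.one b Y * S.one a X :=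
    fun hab X Y => S.one_comm (S.one_mem_cen hab.symm _) _
  -- the first description of the skew inverse
  have f1 : S.two k l R' * S.one l D = S.one k D * S.two l k Ψ := by
    refine two_contract_injective h (k := m) (l := l) (p := p) hml hpm hpl
      (mul_mem (S.two_mem_cen hmk.symm hml.symm _) (S.one_mem_cen hml.symm _))
      (mul_mem (S.one_mem_cen hmk.symm _) (S.two_mem_cen hml.symm hmk.symm _))
      (mul_mem (S.two_mem_cen hpk.symm hpl.symm _) (S.one_mem_cen hpl.symm _))
      (mul_mem (S.one_mem_cen hpk.symm _) (S.two_mem_cen hpl.symm hpk.symm _)) ?_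
    have := S.wtr_conj_perm h h2 (conj_rel_of_compatible h1 h2 ybe.symm) hmk.symm hkl hml
    rw [mul_assoc (S.two m l R), S.perm_symm hmk.symm, S.perm_mul_two hmk hml hkl, ← hD,
      mul_assoc, mul_assoc, ← S.one_comm (S.perm_mem_cen hml hkl)] at this
    simp only [← mul_assoc] at this
    rw [S.tr_mul_right (S.perm_mem_cen hml hkl)] at this
    rw [← mul_assoc, ← mul_one (S.tr l _), ← S.perm_mul_self hmk, ← mul_assoc, this, ← mul_assoc,
      ← S.one_comm (S.two_mem_cen hmk hkl.symm R), mul_assoc,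
      S.tr_mul_left (S.one_mem_cen hkl _), S.tr_two_skewInverse h hml hmk hkl.symm]
  -- The mirror image of `f1`, from conjugation by `R'` instead of `R`.
  have f2 : S.one l D * S.two k l R' = S.two l k Ψ * S.one k D := by
    refine two_contract_injective h (k := m) (l := l) (p := p) hml hpm hpl
      (mul_mem (S.one_mem_cen hml.symm _) (S.two_mem_cen hmk.symm hml.symm _))
      (mul_mem (S.two_mem_cen hml.symm hmk.symm _) (S.one_mem_cen hmk.symm _))
      (mul_mem (S.one_mem_cen hpl.symm _) (S.two_mem_cen hpk.symm hpl.symm _))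
      (mul_mem (S.two_mem_cen hpl.symm hpk.symm _) (S.one_mem_cen hpk.symm _)) ?_
    have := S.wtr_conj_perm h h1 (conj_rel_of_compatible' h1 h2 ybe) (k := m) (l := k) (m := l)
      hmk hml hkl
    rw [mul_assoc (S.two k l R'), S.perm_symm hmk, S.perm_mul_two hmk.symm hkl hml, ← hD,
      mul_assoc, mul_assoc, ← S.one_comm (S.perm_mem_cen hkl hml)] at this
    simp only [← mul_assoc] at this
    rw [S.tr_mul_right (S.perm_mem_cen hkl hml), mul_assoc,
      S.tr_two_mul _ (mul_mem (S.two_mem_cen hmk hkl.symm _) (S.one_mem_cen hkl.symm _)) hkl]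
      at this
    have h3 : S.tr l (S.two m l R * S.one l D * S.two k l R') =
        S.one m D * S.perm k m := by
      rw [← this, mul_assoc (S.tr l _), S.perm_mul_self hmk.symm, mul_one]
    rw [← mul_assoc, h3, ← mul_assoc, S.tr_mul_right (S.one_mem_cen hkl _),
      S.tr_two_skewInverse h hml hmk hkl.symm, S.perm_symm hmk, S.perm_mul_one hmk.symm]
  -- Both sides equal $D_k\Psi_{lk}D_k$.
  have f3 : S.two k l R' * (S.one k D * S.one l D) = (S.one k D * S.one l D) * S.two k l R' := by
    rw [dk hkl, ← mul_assoc, f1, mul_assoc, ← f2, dk hkl.symm, ← mul_assoc]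
  have r1 : S.two k l R * S.two k l R' = 1 := two_mul_cancel h1 hkl
  have r2 : S.two k l R' * S.two k l R = 1 := two_mul_cancel h2 hkl
  calc S.two k l R * (S.one k D * S.one l D)
      = S.two k l R * ((S.one k D * S.one l D) * S.two k l R') * S.two k l R := by
        simp only [mul_assoc, r2, mul_one]
    _ = _ := by rw [← f3, ← mul_assoc, r1, _root_.one_mul]

/-- Cyclicity of the double `D`-weighted trace. -/
theorem wtr_wtr_two (h : IsSkewInverse R Ψ) (h1 : R * R' = 1) (h2 : R' * R = 1)
    (ybe : opAt (n := 2) R 0 * opAt R 1 * opAt R 0 = opAt R 1 * opAt R 0 * opAt R 1)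
    {k l : ℕ} (hkl : k ≠ l) (X : E) :
    S.wtr (ptr₂ Ψ) k (S.wtr (ptr₂ Ψ) l (S.two k l R * X)) =
      S.wtr (ptr₂ Ψ) k (S.wtr (ptr₂ Ψ) l (X * S.two k l R)) := by
  have e1 : ∀ Y : E, S.wtr (ptr₂ Ψ) k (S.wtr (ptr₂ Ψ) l Y) =
      S.tr k (S.tr l (S.one k (ptr₂ Ψ) * S.one l (ptr₂ Ψ) * Y)) := by
    intro Y
    rw [wtr_apply, wtr_apply, ← S.tr_mul_left (S.one_mem_cen hkl _), mul_assoc]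
  have e2 : ∀ Y : E, S.tr k (S.tr l (S.two k l R * Y)) = S.tr k (S.tr l (Y * S.two k l R)) := by
    intro Y
    simp only [two, Finset.sum_mul, Finset.mul_sum, smul_mul_assoc, mul_smul_comm, map_sum,
      map_smul]
    refine Finset.sum_congr rfl fun a _ => Finset.sum_congr rfl fun b _ =>
      Finset.sum_congr rfl fun c _ => Finset.sum_congr rfl fun d _ => ?_
    rw [mul_assoc, S.tr_mul_left (S.e_mem_cen hkl _ _), tr_e_mul, tr_e_mul,
      ← S.tr_mul_right (S.e_mem_cen hkl _ _), mul_assoc,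
      S.e_comm l k hkl.symm]
  rw [e1, e1, ← mul_assoc, ← two_comm_DD h h1 h2 ybe hkl, mul_assoc, e2, mul_assoc]

end DD

end StrandSystem

/-! ### Consequences of the BMW relations for two neighbouring generators -/

/-- The defining relations of a pair of neighbouring generators of the Birman-Murakami-Wenzl
algebra: `s₁`, `s₂` are the inverses of `r₁`, `r₂`. -/
structure BMWPair {H : Type*} [Ring H] [Algebra ℂ H] (l μ : ℂ) (r₁ s₁ k₁ r₂ s₂ k₂ : H) : Prop where
  μ_ne : μ ≠ 0
  rs₁ : r₁ * s₁ = 1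
  sr₁ : s₁ * r₁ = 1
  rs₂ : r₂ * s₂ = 1
  sr₂ : s₂ * r₂ = 1
  braid : r₁ * r₂ * r₁ = r₂ * r₁ * r₂
  skein₁ : s₁ = r₁ - l • 1 + l • k₁
  skein₂ : s₂ = r₂ - l • 1 + l • k₂
  l_ne : l ≠ 0
  rk₁ : r₁ * k₁ = μ • k₁
  kr₁ : k₁ * r₁ = μ • k₁
  rk₂ : r₂ * k₂ = μ • k₂
  kr₂ : k₂ * r₂ = μ • k₂
  kk_r : k₂ * k₁ = r₁ * r₂ * k₁
  kk_s : k₂ * k₁ = s₁ * s₂ * k₁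
  kkk : k₁ * k₂ * k₁ = k₁

namespace BMWPair

variable {H : Type*} [Ring H] [Algebra ℂ H] {l μ : ℂ} {r₁ s₁ k₁ r₂ s₂ k₂ : H}
  (h : BMWPair l μ r₁ s₁ k₁ r₂ s₂ k₂)

include h

theorem map {H' : Type*} [Ring H'] [Algebra ℂ H'] (f : H →ₐ[ℂ] H') :
    BMWPair l μ (f r₁) (f s₁) (f k₁) (f r₂) (f s₂) (f k₂) where
  μ_ne := h.μ_ne
  l_ne := h.l_ne
  rs₁ := by rw [← map_mul, h.rs₁, map_one]
  sr₁ := by rw [← map_mul, h.sr₁, map_one]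
  rs₂ := by rw [← map_mul, h.rs₂, map_one]
  sr₂ := by rw [← map_mul, h.sr₂, map_one]
  braid := by simp only [← map_mul, h.braid]
  skein₁ := by rw [h.skein₁]; simp only [map_add, map_sub, map_smul, map_one]
  skein₂ := by rw [h.skein₂]; simp only [map_add, map_sub, map_smul, map_one]
  rk₁ := by rw [← map_mul, h.rk₁, map_smul]
  kr₁ := by rw [← map_mul, h.kr₁, map_smul]
  rk₂ := by rw [← map_mul, h.rk₂, map_smul]
  kr₂ := by rw [← map_mul, h.kr₂, map_smul]
  kk_r := by simp only [← map_mul, h.kk_r]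
  kk_s := by simp only [← map_mul, h.kk_s]
  kkk := by simp only [← map_mul, h.kkk]

theorem sk₁ : s₁ * k₁ = μ⁻¹ • k₁ := by
  have : s₁ * (r₁ * k₁) = k₁ := by rw [← mul_assoc, h.sr₁, one_mul]
  rw [h.rk₁, mul_smul_comm] at this
  rw [← smul_right_injective H h.μ_ne |>.eq_iff]
  simp only [this, smul_smul, mul_inv_cancel₀ h.μ_ne, one_smul]

theorem ks₁ : k₁ * s₁ = μ⁻¹ • k₁ := by
  have : (k₁ * r₁) * s₁ = k₁ := by rw [mul_assoc, h.rs₁, mul_one]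
  rw [h.kr₁, smul_mul_assoc] at this
  rw [← smul_right_injective H h.μ_ne |>.eq_iff]
  simp only [this, smul_smul, mul_inv_cancel₀ h.μ_ne, one_smul]

/-- As $k$ is a combination of $1$, $r$ and $s$, conjugation identities between braids carry over to
$k$. -/
theorem k₁_eq : k₁ = l⁻¹ • (s₁ - r₁) + 1 := by
  have : l • k₁ = (s₁ - r₁) + l • 1 := by rw [h.skein₁]; abel
  rw [← smul_right_injective H h.l_ne |>.eq_iff]
  simp only [this, smul_add, smul_smul, mul_inv_cancel₀ h.l_ne, one_smul]

theorem k₂_eq : k₂ = l⁻¹ • (s₂ - r₂) + 1 := by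
  have : l • k₂ = (s₂ - r₂) + l • 1 := by rw [h.skein₂]; abel
  rw [← smul_right_injective H h.l_ne |>.eq_iff]
  simp only [this, smul_add, smul_smul, mul_inv_cancel₀ h.l_ne, one_smul]

theorem s_braid : s₁ * s₂ * s₁ = s₂ * s₁ * s₂ := by
  have e1 : (s₁ * s₂ * s₁) * (r₁ * r₂ * r₁) = 1 := by
    simp only [mul_assoc]
    rw [← mul_assoc s₁ r₁, h.sr₁, one_mul, ← mul_assoc s₂ r₂, h.sr₂, one_mul, h.sr₁]
  have e2 : (r₁ * r₂ * r₁) * (s₂ * s₁ * s₂) = 1 := by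
    rw [h.braid]
    simp only [mul_assoc]
    rw [← mul_assoc r₂ s₂, h.rs₂, one_mul, ← mul_assoc r₁ s₁, h.rs₁, one_mul, h.rs₂]
  exact left_inv_eq_right_inv e1 e2

theorem rrs : r₁ * r₂ * s₁ = s₂ * r₁ * r₂ := by
  have : s₂ * (r₂ * r₁ * r₂) * s₁ = s₂ * (r₁ * r₂ * r₁) * s₁ := by rw [h.braid]
  simpa only [mul_assoc, h.rs₁, mul_one, ← mul_assoc s₂ r₂, h.sr₂, one_mul] using this

theorem rrs' : r₂ * r₁ * s₂ = s₁ * r₂ * r₁ := by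
  have : s₁ * (r₁ * r₂ * r₁) * s₂ = s₁ * (r₂ * r₁ * r₂) * s₂ := by rw [h.braid]
  simpa only [mul_assoc, h.rs₂, mul_one, ← mul_assoc s₁ r₁, h.sr₁, one_mul] using this

theorem rrk : r₁ * r₂ * k₁ = k₂ * r₁ * r₂ := by
  rw [h.k₁_eq, h.k₂_eq]
  simp only [mul_add, add_mul, mul_sub, sub_mul, mul_smul_comm, smul_mul_assoc, h.rrs, h.braid, mul_one, one_mul]

theorem rrk' : r₂ * r₁ * k₂ = k₁ * r₂ * r₁ := by
  rw [h.k₁_eq, h.k₂_eq]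
  simp only [mul_add, add_mul, mul_sub, sub_mul, mul_smul_comm, smul_mul_assoc, h.rrs', h.braid, mul_one, one_mul]

theorem ssr : s₁ * s₂ * r₁ = r₂ * s₁ * s₂ := by
  have : r₂ * (s₂ * s₁ * s₂) * r₁ = r₂ * (s₁ * s₂ * s₁) * r₁ := by rw [h.s_braid]
  simpa only [mul_assoc, h.sr₁, mul_one, ← mul_assoc r₂ s₂, h.rs₂, one_mul] using this

theorem ssr' : s₂ * s₁ * r₂ = r₁ * s₂ * s₁ := by
  have : r₁ * (s₁ * s₂ * s₁) * r₂ = r₁ * (s₂ * s₁ * s₂) * r₂ := by rw [h.s_braid]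
  simpa only [mul_assoc, h.sr₂, mul_one, ← mul_assoc r₁ s₁, h.rs₁, one_mul] using this

theorem ssk : s₁ * s₂ * k₁ = k₂ * s₁ * s₂ := by
  rw [h.k₁_eq, h.k₂_eq]
  simp only [mul_add, add_mul, mul_sub, sub_mul, mul_smul_comm, smul_mul_assoc, h.ssr, h.s_braid,
    mul_one, one_mul]

theorem ssk' : s₂ * s₁ * k₂ = k₁ * s₂ * s₁ := by
  rw [h.k₁_eq, h.k₂_eq]
  simp only [mul_add, add_mul, mul_sub, sub_mul, mul_smul_comm, smul_mul_assoc, h.ssr', h.s_braid,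
    mul_one, one_mul]

/-- Insert $k_2k_1=r_1r_2k_1$ into $k_1k_2k_1=k_1$ and let $k_1$ absorb $r_1$. -/
theorem krk₁ : k₁ * r₂ * k₁ = μ⁻¹ • k₁ := by
  have : k₁ * k₂ * k₁ = μ • (k₁ * r₂ * k₁) := by
    rw [mul_assoc, h.kk_r, ← mul_assoc, ← mul_assoc, h.kr₁, smul_mul_assoc, smul_mul_assoc]
  rw [← smul_right_injective H h.μ_ne |>.eq_iff]
  simp only [← this, h.kkk, smul_smul, mul_inv_cancel₀ h.μ_ne, one_smul]

theorem k₂_conj : k₂ = r₁ * r₂ * k₁ * s₂ * s₁ := by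
  rw [h.rrk]
  simp only [mul_assoc]
  rw [← mul_assoc r₂ s₂, h.rs₂, one_mul, h.rs₁, mul_one]

/-- Conjugation by $r_1r_2$ turns $k_2$ into $k_1$ and leaves $k_1(r_1r_2s_1)k_1$ in the middle;
there the factors $\mu$ and $\mu^{-1}$ of $r_1$ and $s_1$ cancel, so `krk₁` applies. -/
theorem krk₂ : k₂ * r₁ * k₂ = μ⁻¹ • k₂ := by
  have e : k₁ * (r₁ * r₂ * s₁) * k₁ = μ⁻¹ • k₁ := by
    calc k₁ * (r₁ * r₂ * s₁) * k₁ = (k₁ * r₁) * r₂ * (s₁ * k₁) := by simp only [mul_assoc]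
      _ = _ := by
        rw [h.kr₁, h.sk₁]
        simp only [smul_mul_assoc, mul_smul_comm, h.krk₁, smul_smul]
        rw [mul_inv_cancel₀ h.μ_ne, mul_one]
  calc k₂ * r₁ * k₂ = (r₁ * r₂ * k₁ * s₂ * s₁) * r₁ * (r₁ * r₂ * k₁ * s₂ * s₁) := by
        rw [← h.k₂_conj]
    _ = r₁ * r₂ * (k₁ * (s₂ * r₁ * r₂) * k₁) * s₂ * s₁ := by
        simp only [mul_assoc]; rw [← mul_assoc s₁ r₁, h.sr₁, one_mul]
    _ = μ⁻¹ • (r₁ * r₂ * k₁ * s₂ * s₁) := by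
        rw [← h.rrs, e]; simp only [smul_mul_assoc, mul_smul_comm]
    _ = _ := by rw [← h.k₂_conj]

theorem kk_r' : k₂ * k₁ = k₂ * r₁ * r₂ := by rw [h.kk_r, h.rrk]

theorem kk_s' : k₂ * k₁ = k₂ * s₁ * s₂ := by rw [h.kk_s, h.ssk]

theorem kkk' : k₂ * k₁ * k₂ = k₂ := by
  rw [h.kk_r', mul_assoc, h.rk₂, mul_smul_comm, h.krk₂, smul_smul, mul_inv_cancel₀ h.μ_ne,
    one_smul]

/-- The hypotheses concern $k_2k_1$ only. Cancelling braids in $k_2k_1=s_1s_2k_1$ gives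
$r_2r_1k_2k_1=k_1$; multiply by $k_2$ and use $k_2k_1k_2=k_2$. -/
theorem kk'_r : k₁ * k₂ = r₂ * r₁ * k₂ := by
  have e : r₂ * r₁ * (k₂ * k₁) = k₁ := by
    rw [h.kk_s]
    simp only [mul_assoc]
    rw [← mul_assoc r₁ s₁, h.rs₁, one_mul, ← mul_assoc r₂ s₂, h.rs₂, one_mul]
  calc k₁ * k₂ = r₂ * r₁ * (k₂ * k₁) * k₂ := by rw [e]
    _ = r₂ * r₁ * (k₂ * k₁ * k₂) := by simp only [mul_assoc]
    _ = _ := by rw [h.kkk']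

theorem kk'_s : k₁ * k₂ = s₂ * s₁ * k₂ := by
  have e : s₂ * s₁ * (k₂ * k₁) = k₁ := by
    rw [h.kk_r]
    simp only [mul_assoc]
    rw [← mul_assoc s₁ r₁, h.sr₁, one_mul, ← mul_assoc s₂ r₂, h.sr₂, one_mul]
  calc k₁ * k₂ = s₂ * s₁ * (k₂ * k₁) * k₂ := by rw [e]
    _ = s₂ * s₁ * (k₂ * k₁ * k₂) := by simp only [mul_assoc]
    _ = _ := by rw [h.kkk']

theorem kk'_r' : k₁ * k₂ = k₁ * r₂ * r₁ := by rw [h.kk'_r, h.rrk']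

theorem kk'_s' : k₁ * k₂ = k₁ * s₂ * s₁ := by rw [h.kk'_s, h.ssk']

/-- The relations are symmetric in the two generators. -/
theorem symm : BMWPair l μ r₂ s₂ k₂ r₁ s₁ k₁ where
  μ_ne := h.μ_ne
  l_ne := h.l_ne
  rs₁ := h.rs₂
  sr₁ := h.sr₂
  rs₂ := h.rs₁
  sr₂ := h.sr₁
  braid := h.braid.symm
  skein₁ := h.skein₂
  skein₂ := h.skein₁
  rk₁ := h.rk₂
  kr₁ := h.kr₂
  rk₂ := h.rk₁
  kr₂ := h.kr₁
  kk_r := h.kk'_r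
  kk_s := h.kk'_s
  kkk := h.kkk'

/-- This and the next three trade a letter at one position for a letter at the other next to a
contraction. They are the moves by which letters are carried around a trace. -/
theorem kks : k₂ * k₁ * s₂ = k₂ * r₁ := by
  rw [h.kk_r', mul_assoc, h.rs₂, mul_one]

theorem kkr : k₂ * k₁ * r₂ = k₂ * s₁ := by
  rw [h.kk_s', mul_assoc, h.sr₂, mul_one]

theorem skk : s₁ * k₂ * k₁ = r₂ * k₁ := by
  rw [mul_assoc, h.kk_r, mul_assoc, ← mul_assoc, h.sr₁, one_mul]

theorem rkk : r₁ * k₂ * k₁ = s₂ * k₁ := by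
  rw [mul_assoc, h.kk_s, mul_assoc, ← mul_assoc, h.rs₁, one_mul]

end BMWPair

/-! ### Towers of BMW generators and their algebras of words -/

/-- A sequence of elements `r i` (with inverses `s i` and idempotent-like elements `k i`) obeying
the relations of the Birman-Murakami-Wenzl algebras, together with the shift `r i ↦ r (i + 1)`. -/
structure BMWTower (l μ : ℂ) (E : Type*) [Ring E] [Algebra ℂ E] where
  sh : E →ₐ[ℂ] E
  r : ℕ → E
  s : ℕ → E
  k : ℕ → E
  sh_r : ∀ i, sh (r i) = r (i + 1)
  sh_s : ∀ i, sh (s i) = s (i + 1)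
  sh_k : ∀ i, sh (k i) = k (i + 1)
  pair : ∀ i, BMWPair l μ (r i) (s i) (k i) (r (i + 1)) (s (i + 1)) (k (i + 1))
  far : ∀ i j, i + 2 ≤ j → r i * r j = r j * r i

namespace BMWTower

variable {l μ : ℂ} {E : Type*} [Ring E] [Algebra ℂ E] (B : BMWTower l μ E)

/-- The `n`-fold shift. -/
def up : ℕ → E →ₐ[ℂ] E
  | 0 => AlgHom.id ℂ E
  | n + 1 => B.sh.comp (up n)

@[simp] theorem up_zero (x : E) : B.up 0 x = x := rfl

theorem up_succ (n : ℕ) (x : E) : B.up (n + 1) x = B.sh (B.up n x) := rfl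

theorem up_one (x : E) : B.up 1 x = B.sh x := rfl

theorem up_add (m n : ℕ) (x : E) : B.up (m + n) x = B.up m (B.up n x) := by
  induction m with
  | zero => simp
  | succ m ih => rw [Nat.succ_add, up_succ, up_succ, ih]

theorem up_succ' (n : ℕ) (x : E) : B.up (n + 1) x = B.up n (B.sh x) := by
  rw [B.up_add, up_one]

theorem up_sh (n : ℕ) (x : E) : B.up n (B.sh x) = B.sh (B.up n x) := by
  rw [← up_succ', up_succ]

theorem up_r (n i : ℕ) : B.up n (B.r i) = B.r (i + n) := by
  induction n with
  | zero => rfl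
  | succ n ih => rw [up_succ, ih, sh_r]; rfl

theorem up_s (n i : ℕ) : B.up n (B.s i) = B.s (i + n) := by
  induction n with
  | zero => rfl
  | succ n ih => rw [up_succ, ih, sh_s]; rfl

theorem up_k (n i : ℕ) : B.up n (B.k i) = B.k (i + n) := by
  induction n with
  | zero => rfl
  | succ n ih => rw [up_succ, ih, sh_k]; rfl

theorem rs (i : ℕ) : B.r i * B.s i = 1 := (B.pair i).rs₁

theorem sr (i : ℕ) : B.s i * B.r i = 1 := (B.pair i).sr₁

theorem rs_mul (i : ℕ) (x : E) : B.r i * (B.s i * x) = x := by rw [← mul_assoc, B.rs, one_mul]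

theorem sr_mul (i : ℕ) (x : E) : B.s i * (B.r i * x) = x := by rw [← mul_assoc, B.sr, one_mul]

theorem braid (i : ℕ) : B.r i * B.r (i + 1) * B.r i = B.r (i + 1) * B.r i * B.r (i + 1) :=
  (B.pair i).braid

/-- The algebra generated by `r i` and `s i` for `a ≤ i < b`. -/
def W (a b : ℕ) : Subalgebra ℂ E :=
  Algebra.adjoin ℂ {x | ∃ i, a ≤ i ∧ i < b ∧ (x = B.r i ∨ x = B.s i)}

theorem r_mem {a b i : ℕ} (h : a ≤ i) (h' : i < b) : B.r i ∈ B.W a b :=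
  Algebra.subset_adjoin ⟨i, h, h', Or.inl rfl⟩

theorem s_mem {a b i : ℕ} (h : a ≤ i) (h' : i < b) : B.s i ∈ B.W a b :=
  Algebra.subset_adjoin ⟨i, h, h', Or.inr rfl⟩

theorem k_mem {a b i : ℕ} (h : a ≤ i) (h' : i < b) : B.k i ∈ B.W a b := by
  rw [(B.pair i).k₁_eq]
  exact add_mem (Subalgebra.smul_mem _ (sub_mem (B.s_mem h h') (B.r_mem h h')) _) (one_mem _)

theorem W_le {a b : ℕ} {U : Subalgebra ℂ E} (h : ∀ i, a ≤ i → i < b → B.r i ∈ U ∧ B.s i ∈ U) :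
    B.W a b ≤ U := by
  refine Algebra.adjoin_le ?_
  rintro x ⟨i, hi, hi', rfl | rfl⟩
  exacts [(h i hi hi').1, (h i hi hi').2]

theorem W_mono {a b a' b' : ℕ} (h : a' ≤ a) (h' : b ≤ b') : B.W a b ≤ B.W a' b' :=
  B.W_le fun _ hi hi' => ⟨B.r_mem (h.trans hi) (hi'.trans_le h'), B.s_mem (h.trans hi) (hi'.trans_le h')⟩

theorem sh_mem {a b : ℕ} {x : E} (hx : x ∈ B.W a b) : B.sh x ∈ B.W (a + 1) (b + 1) := by
  have : B.W a b ≤ (B.W (a + 1) (b + 1)).comap B.sh := B.W_le fun i hi hi' => by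
    simp only [Subalgebra.mem_comap, sh_r, sh_s]
    exact ⟨B.r_mem (by omega) (by omega), B.s_mem (by omega) (by omega)⟩
  exact this hx

theorem up_mem {a b : ℕ} {x : E} (hx : x ∈ B.W a b) (n : ℕ) : B.up n x ∈ B.W (a + n) (b + n) := by
  induction n with
  | zero => exact hx
  | succ n ih => exact B.sh_mem ih

theorem up_mem' {b c d : ℕ} {x : E} (hx : x ∈ B.W 0 b) (n : ℕ) (hc : c ≤ n) (hd : b + n ≤ d) :
    B.up n x ∈ B.W c d :=
  B.W_mono (by omega) hd (B.up_mem hx n)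

theorem exists_sh {a b : ℕ} {x : E} (hx : x ∈ B.W (a + 1) (b + 1)) : ∃ y ∈ B.W a b, B.sh y = x := by
  have : B.W (a + 1) (b + 1) ≤ (B.W a b).map B.sh := B.W_le fun i hi hi' => by
    obtain ⟨i, rfl⟩ : ∃ j, i = j + 1 := ⟨i - 1, by omega⟩
    exact ⟨⟨B.r i, B.r_mem (by omega) (by omega), B.sh_r i⟩,
      ⟨B.s i, B.s_mem (by omega) (by omega), B.sh_s i⟩⟩
  exact this hx

/-- Checking the letters `r i` suffices: an intertwining relation for an invertible element passes
to its inverse `s i`. -/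
theorem intertwine (f : E →ₐ[ℂ] E) {a b : ℕ} {Y : E}
    (h : ∀ i, a ≤ i → i < b → B.r i * Y = Y * f (B.r i)) {x : E} (hx : x ∈ B.W a b) :
    x * Y = Y * f x := by
  induction hx using Algebra.adjoin_induction with
  | mem x hx =>
    obtain ⟨i, hi, hi', rfl | rfl⟩ := hx
    · exact h i hi hi'
    · calc B.s i * Y = B.s i * (Y * f (B.r i)) * f (B.s i) := by
            rw [mul_assoc, mul_assoc, ← map_mul, B.rs, map_one, mul_one]
        _ = _ := by rw [← h i hi hi', B.sr_mul]
  | algebraMap c => rw [AlgHom.commutes, Algebra.commutes]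
  | add x y _ _ hx hy => rw [map_add, add_mul, mul_add, hx, hy]
  | mul x y _ _ hx hy => rw [map_mul, mul_assoc, hy, ← mul_assoc, hx, mul_assoc]

theorem intertwine' (f : E →ₐ[ℂ] E) {a b : ℕ} {Y : E}
    (h : ∀ i, a ≤ i → i < b → f (B.r i) * Y = Y * B.r i) {x : E} (hx : x ∈ B.W a b) :
    f x * Y = Y * x := by
  induction hx using Algebra.adjoin_induction with
  | mem x hx =>
    obtain ⟨i, hi, hi', rfl | rfl⟩ := hx
    · exact h i hi hi'
    · calc f (B.s i) * Y = f (B.s i) * (Y * B.r i) * B.s i := by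
            rw [mul_assoc, mul_assoc, B.rs, mul_one]
        _ = _ := by rw [← h i hi hi', ← mul_assoc (f _), ← map_mul, B.sr, map_one, one_mul]
  | algebraMap c => rw [AlgHom.commutes, Algebra.commutes]
  | add x y _ _ hx hy => rw [map_add, add_mul, mul_add, hx, hy]
  | mul x y _ _ hx hy => rw [map_mul, mul_assoc, hy, ← mul_assoc, hx, mul_assoc]

theorem comm_of_gen {a b : ℕ} {Y : E} (h : ∀ i, a ≤ i → i < b → B.r i * Y = Y * B.r i) {x : E}
    (hx : x ∈ B.W a b) : x * Y = Y * x :=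
  B.intertwine (AlgHom.id ℂ E) h hx

theorem W_comm {a b c d : ℕ} (h : b + 1 ≤ c) {x y : E} (hx : x ∈ B.W a b) (hy : y ∈ B.W c d) :
    x * y = y * x :=
  B.comm_of_gen (fun i _ hi => (B.comm_of_gen (fun j hj _ => (B.far i j (by omega)).symm) hy).symm) hx

theorem rr_eq (i : ℕ) : B.r i * B.r i = 1 + l • B.r i - (l * μ) • B.k i := by
  have h := B.pair i
  have := congrArg (fun x => B.r i * x) h.skein₁
  simp only [mul_add, mul_sub, h.rs₁, mul_smul_comm, mul_one, h.rk₁, smul_smul] at this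
  rw [this]; abel

theorem kk_eq (i : ℕ) : B.k i * B.k i = (l⁻¹ * (μ⁻¹ - μ + l)) • B.k i := by
  have h := B.pair i
  have := congrArg (fun x => x * B.k i) h.skein₁
  simp only [add_mul, sub_mul, h.sk₁, h.rk₁, smul_mul_assoc, _root_.one_mul] at this
  rw [mul_smul, add_smul, sub_smul, this]
  rw [show μ • B.k i - l • B.k i + l • (B.k i * B.k i) - μ • B.k i + l • B.k i =
    l • (B.k i * B.k i) by abel, smul_smul, inv_mul_cancel₀ h.l_ne, one_smul]

theorem s_eq (i : ℕ) : B.s i = B.r i - l • 1 + l • B.k i := (B.pair i).skein₁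

/-! ### Words with at most one letter at position zero -/

/-- `W' + W' r₀ W' + W' k₀ W'` for `W' = W 1 (n + 1)`. -/
def dec (n : ℕ) : Submodule ℂ E :=
  Submodule.span ℂ {x | ∃ a ∈ B.W 1 (n + 1), ∃ b ∈ B.W 1 (n + 1),
    x = a * b ∨ x = a * B.r 0 * b ∨ x = a * B.k 0 * b}

theorem dec_one {n : ℕ} {a b : E} (ha : a ∈ B.W 1 (n + 1)) (hb : b ∈ B.W 1 (n + 1)) :
    a * b ∈ B.dec n := Submodule.subset_span ⟨a, ha, b, hb, Or.inl rfl⟩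

theorem dec_r {n : ℕ} {a b : E} (ha : a ∈ B.W 1 (n + 1)) (hb : b ∈ B.W 1 (n + 1)) :
    a * B.r 0 * b ∈ B.dec n := Submodule.subset_span ⟨a, ha, b, hb, Or.inr (Or.inl rfl)⟩

theorem dec_k {n : ℕ} {a b : E} (ha : a ∈ B.W 1 (n + 1)) (hb : b ∈ B.W 1 (n + 1)) :
    a * B.k 0 * b ∈ B.dec n := Submodule.subset_span ⟨a, ha, b, hb, Or.inr (Or.inr rfl)⟩

theorem dec_induction {n : ℕ} {U : Submodule ℂ E} (h1 : ∀ a ∈ B.W 1 (n + 1), a ∈ U)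
    (hr : ∀ a ∈ B.W 1 (n + 1), ∀ b ∈ B.W 1 (n + 1), a * B.r 0 * b ∈ U)
    (hk : ∀ a ∈ B.W 1 (n + 1), ∀ b ∈ B.W 1 (n + 1), a * B.k 0 * b ∈ U) : B.dec n ≤ U := by
  refine Submodule.span_le.2 ?_
  rintro x ⟨a, ha, b, hb, rfl | rfl | rfl⟩
  exacts [h1 _ (mul_mem ha hb), hr a ha b hb, hk a ha b hb]

theorem dec_mul_left {n : ℕ} {a x : E} (ha : a ∈ B.W 1 (n + 1)) (hx : x ∈ B.dec n) :
    a * x ∈ B.dec n := by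
  have : B.dec n ≤ (B.dec n).comap (LinearMap.mulLeft ℂ a) := by
    refine B.dec_induction ?_ ?_ ?_
    · intro b hb; exact B.dec_one ha hb
    · intro b hb c hc
      simp only [Submodule.mem_comap, LinearMap.mulLeft_apply, ← mul_assoc]
      exact B.dec_r (mul_mem ha hb) hc
    · intro b hb c hc
      simp only [Submodule.mem_comap, LinearMap.mulLeft_apply, ← mul_assoc]
      exact B.dec_k (mul_mem ha hb) hc
  exact this hx

theorem dec_mul_right {n : ℕ} {a x : E} (ha : a ∈ B.W 1 (n + 1)) (hx : x ∈ B.dec n) :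
    x * a ∈ B.dec n := by
  have : B.dec n ≤ (B.dec n).comap (LinearMap.mulRight ℂ a) := by
    refine B.dec_induction ?_ ?_ ?_
    · intro b hb; exact B.dec_one hb ha
    · intro b hb c hc
      simp only [Submodule.mem_comap, LinearMap.mulRight_apply, mul_assoc]
      rw [← mul_assoc]
      exact B.dec_r hb (mul_mem hc ha)
    · intro b hb c hc
      simp only [Submodule.mem_comap, LinearMap.mulRight_apply, mul_assoc]
      rw [← mul_assoc]
      exact B.dec_k hb (mul_mem hc ha)
  exact this hx

theorem W_self (a : ℕ) {x : E} (hx : x ∈ B.W a a) : ∃ c : ℂ, x = c • 1 := by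
  have : B.W a a ≤ ⊥ := B.W_le fun i hi hi' => absurd hi' (by omega)
  obtain ⟨c, rfl⟩ := Algebra.mem_bot.1 (this hx)
  exact ⟨c, Algebra.algebraMap_eq_smul_one c⟩

/-- One-sided multiples of `r₀`, `k₀` in `dec n`. -/
theorem dec_r_left {n : ℕ} {b : E} (hb : b ∈ B.W 1 (n + 1)) : B.r 0 * b ∈ B.dec n := by
  simpa using B.dec_r (one_mem _) hb

theorem dec_k_left {n : ℕ} {b : E} (hb : b ∈ B.W 1 (n + 1)) : B.k 0 * b ∈ B.dec n := by
  simpa using B.dec_k (one_mem _) hb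

/-- Closure of `dec n` under left multiplication by $r_0$ and $k_0$ is all that is missing, since
$s_0$ is a combination of $1$, $r_0$, $k_0$. The hypothesis is the case of two letters at position
zero. -/
theorem W_le_dec_of {n : ℕ} (key : ∀ g h : E, (g = B.r 0 ∨ g = B.k 0) → (h = B.r 0 ∨ h = B.k 0) →
    ∀ a ∈ B.W 1 (n + 1), g * a * h ∈ B.dec n) : ∀ w ∈ B.W 0 (n + 1), w ∈ B.dec n := by
  have key' : ∀ g : E, (g = B.r 0 ∨ g = B.k 0) → ∀ x ∈ B.dec n, g * x ∈ B.dec n := by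
    intro g hg x hx
    have : B.dec n ≤ (B.dec n).comap (LinearMap.mulLeft ℂ g) := by
      refine B.dec_induction ?_ ?_ ?_
      · intro a ha
        rcases hg with rfl | rfl
        exacts [B.dec_r_left ha, B.dec_k_left ha]
      · intro a ha b hb
        simp only [Submodule.mem_comap, LinearMap.mulLeft_apply]
        rw [← mul_assoc, ← mul_assoc]
        exact B.dec_mul_right hb (key g _ hg (Or.inl rfl) a ha)
      · intro a ha b hb
        simp only [Submodule.mem_comap, LinearMap.mulLeft_apply]
        rw [← mul_assoc, ← mul_assoc]
        exact B.dec_mul_right hb (key g _ hg (Or.inr rfl) a ha)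
    exact this hx
  have main : ∀ w ∈ B.W 0 (n + 1), ∀ x ∈ B.dec n, w * x ∈ B.dec n := by
    intro w hw
    induction hw using Algebra.adjoin_induction with
    | mem w hw =>
      intro x hx
      obtain ⟨i, _, hi', hw⟩ := hw
      rcases Nat.eq_zero_or_pos i with rfl | hi
      · have h1 := key' _ (Or.inl rfl) x hx
        have h2 := key' _ (Or.inr rfl) x hx
        rcases hw with rfl | rfl
        · exact h1
        · rw [B.s_eq, add_mul, sub_mul, smul_mul_assoc, smul_mul_assoc, _root_.one_mul]
          exact add_mem (sub_mem h1 (Submodule.smul_mem _ _ hx)) (Submodule.smul_mem _ _ h2)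
      · refine B.dec_mul_left ?_ hx
        rcases hw with rfl | rfl
        exacts [B.r_mem hi hi', B.s_mem hi hi']
    | algebraMap c =>
      intro x hx
      rw [← Algebra.smul_def]; exact Submodule.smul_mem _ _ hx
    | add a b _ _ ha hb => intro x hx; rw [add_mul]; exact add_mem (ha x hx) (hb x hx)
    | mul a b _ _ ha hb => intro x hx; rw [mul_assoc]; exact ha _ (hb x hx)
  intro w hw
  have h1 : (1 : E) ∈ B.dec n := by simpa using B.dec_one (n := n) (one_mem _) (one_mem _)
  simpa using main w hw 1 h1

theorem double_mem_dec (n : ℕ) (g h : E) (hg : g = B.r 0 ∨ g = B.k 0) (hh : h = B.r 0 ∨ h = B.k 0) :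
    g * h ∈ B.dec n := by
  have hr : B.r 0 ∈ B.dec n := by simpa using B.dec_r (n := n) (one_mem _) (one_mem _)
  have hk : B.k 0 ∈ B.dec n := by simpa using B.dec_k (n := n) (one_mem _) (one_mem _)
  have h1 : (1 : E) ∈ B.dec n := by simpa using B.dec_one (n := n) (one_mem _) (one_mem _)
  rcases hg with rfl | rfl <;> rcases hh with rfl | rfl
  · rw [B.rr_eq]
    exact sub_mem (add_mem h1 (Submodule.smul_mem _ _ hr)) (Submodule.smul_mem _ _ hk)
  · rw [(B.pair 0).rk₁]; exact Submodule.smul_mem _ _ hk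
  · rw [(B.pair 0).kr₁]; exact Submodule.smul_mem _ _ hk
  · rw [B.kk_eq]; exact Submodule.smul_mem _ _ hk

/-- Products of the form `g₀ h₁ g₀'` with each factor of type `r` or `k`. -/
theorem triple_mem_dec (n : ℕ) (g h : E) (hg : g = B.r 0 ∨ g = B.k 0) (hh : h = B.r 0 ∨ h = B.k 0) :
    g * B.r 1 * h ∈ B.dec (n + 1) ∧ g * B.k 1 * h ∈ B.dec (n + 1) := by
  have P : BMWPair l μ (B.r 0) (B.s 0) (B.k 0) (B.r 1) (B.s 1) (B.k 1) := B.pair 0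
  have r1 : B.r 1 ∈ B.W 1 (n + 1 + 1) := B.r_mem le_rfl (by omega)
  have s1 : B.s 1 ∈ B.W 1 (n + 1 + 1) := B.s_mem le_rfl (by omega)
  have k1 : B.k 1 ∈ B.W 1 (n + 1 + 1) := B.k_mem le_rfl (by omega)
  have hk : B.k 0 ∈ B.dec (n + 1) := by simpa using B.dec_k (n := n + 1) (one_mem _) (one_mem _)
  rcases hg with rfl | rfl <;> rcases hh with rfl | rfl
  · refine ⟨by rw [B.braid]; exact B.dec_r r1 r1, ?_⟩
    -- This product has two letters $r_0$. Writing $k_1=k_1k_0k_1$ replaces both by letters $s_1$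
    -- and leaves a single $k_0$.
    have : B.r 0 * B.k 1 * B.r 0 = B.s 1 * B.k 0 * B.s 1 := by
      have e1 : B.r 0 * B.k 1 = B.s 1 * B.k 0 * B.k 1 := by
        conv_lhs => rw [← P.symm.kkk, ← mul_assoc, ← mul_assoc, P.rkk]
      rw [e1, mul_assoc, mul_assoc, ← mul_assoc (B.k 0), P.symm.kkr, mul_assoc]
    rw [this]; exact B.dec_k s1 s1
  · refine ⟨by rw [← P.kk_r]; exact B.dec_mul_left k1 hk, ?_⟩
    rw [P.rkk]; exact B.dec_mul_left s1 hk
  · refine ⟨by rw [← P.kk'_r']; exact B.dec_k_left k1, ?_⟩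
    rw [P.symm.kkr]; exact B.dec_k_left s1
  · refine ⟨by rw [P.krk₁]; exact Submodule.smul_mem _ _ hk, ?_⟩
    rw [P.kkk]; exact hk

/-- Between two letters at position zero stands a word without such letters. By induction it
contains at most one letter at position one, so a product of two or three letters remains, and these
are settled by `double_mem_dec` and `triple_mem_dec`. -/
theorem W_le_dec (n : ℕ) : ∀ w ∈ B.W 0 (n + 1), w ∈ B.dec n := by
  induction n with
  | zero =>
    refine B.W_le_dec_of fun g h hg hh a ha => ?_
    obtain ⟨c, rfl⟩ := B.W_self 1 ha
    rw [mul_smul_comm, mul_one, smul_mul_assoc]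
    exact Submodule.smul_mem _ _ (B.double_mem_dec 0 g h hg hh)
  | succ n ih =>
    refine B.W_le_dec_of fun g h hg hh a ha => ?_
    obtain ⟨y, hy, rfl⟩ := B.exists_sh ha
    have comm : ∀ f : E, (f = B.r 0 ∨ f = B.k 0) → ∀ b ∈ B.W 1 (n + 1), f * B.sh b = B.sh b * f := by
      intro f hf b hb
      refine B.W_comm (a := 0) (b := 1) (by omega) ?_ (B.sh_mem hb)
      rcases hf with rfl | rfl
      exacts [B.r_mem le_rfl (by omega), B.k_mem le_rfl (by omega)]
    have up1 : ∀ b ∈ B.W 1 (n + 1), B.sh b ∈ B.W 1 (n + 1 + 1) := fun b hb =>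
      B.W_mono (by omega) (by omega) (B.sh_mem hb)
    have T := B.triple_mem_dec n g h hg hh
    have : B.dec n ≤ (B.dec (n + 1)).comap
        ((LinearMap.mulRight ℂ h).comp ((LinearMap.mulLeft ℂ g).comp B.sh.toLinearMap)) := by
      -- The words $b$ and $c$, shifted, have letters from position two on, hence commute with $g$
      -- and $h$ and can be moved to the outside.
      have conv : ∀ b c x : E, b ∈ B.W 1 (n + 1) → c ∈ B.W 1 (n + 1) → g * x * h ∈ B.dec (n + 1) →
          g * (B.sh b * x * B.sh c) * h ∈ B.dec (n + 1) := by
        intro b c x hb hc hx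
        have : g * (B.sh b * x * B.sh c) * h = B.sh b * (g * x * h) * B.sh c := by
          rw [mul_assoc (B.sh b), ← mul_assoc g, comm g hg b hb]
          simp only [mul_assoc]
          rw [comm h hh c hc]
        rw [this]
        exact B.dec_mul_right (up1 c hc) (B.dec_mul_left (up1 b hb) hx)
      refine B.dec_induction ?_ ?_ ?_
      · intro b hb
        simp only [Submodule.mem_comap, LinearMap.comp_apply, LinearMap.mulLeft_apply,
          LinearMap.mulRight_apply, AlgHom.toLinearMap_apply]
        rw [comm g hg b hb, mul_assoc]
        refine B.dec_mul_left (up1 b hb) ?_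
        exact B.double_mem_dec (n + 1) g h hg hh
      · intro b hb c hc
        simp only [Submodule.mem_comap, LinearMap.comp_apply, LinearMap.mulLeft_apply,
          LinearMap.mulRight_apply, AlgHom.toLinearMap_apply, map_mul, B.sh_r]
        exact conv b c _ hb hc T.1
      · intro b hb c hc
        simp only [Submodule.mem_comap, LinearMap.comp_apply, LinearMap.mulLeft_apply,
          LinearMap.mulRight_apply, AlgHom.toLinearMap_apply, map_mul, B.sh_k]
        exact conv b c _ hb hc T.2
    exact this (ih y hy)

/-! ### Braids that exchange strands and blocks of strands -/

/-- The braid `σ_{n+1} ⋯ σ_2 σ_1 σ_2⁻¹ ⋯ σ_{n+1}⁻¹` (generators numbered from one). -/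
def S : ℕ → E
  | 0 => B.r 0
  | n + 1 => B.r (n + 1) * S n * B.s (n + 1)

theorem S_succ (n : ℕ) : B.S (n + 1) = B.r (n + 1) * B.S n * B.s (n + 1) := rfl

theorem S_mem (n : ℕ) : B.S n ∈ B.W 0 (n + 1) := by
  induction n with
  | zero => exact B.r_mem le_rfl (by omega)
  | succ n ih =>
    exact mul_mem (mul_mem (B.r_mem (by omega) (by omega)) (B.W_mono le_rfl (by omega) ih))
      (B.s_mem (by omega) (by omega))

theorem r_comm {i a b : ℕ} (h : b + 1 ≤ i) {x : E} (hx : x ∈ B.W a b) : x * B.r i = B.r i * x :=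
  B.W_comm h hx (B.r_mem (b := i + 1) le_rfl (by omega))

theorem s_comm {i a b : ℕ} (h : b + 1 ≤ i) {x : E} (hx : x ∈ B.W a b) : x * B.s i = B.s i * x :=
  B.W_comm h hx (B.s_mem (b := i + 1) le_rfl (by omega))

/-- The same braid peeled from the other end: the defining recursion conjugates by the last letter,
this one by the letter at position zero. -/
theorem S_succ' (n : ℕ) : B.S (n + 1) = B.s 0 * B.sh (B.S n) * B.r 0 := by
  induction n with
  | zero => simp only [S, sh_r]; exact (B.pair 0).rrs'
  | succ n ih =>
    have e := congrArg B.sh (B.S_succ n)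
    rw [map_mul, map_mul, sh_r, sh_s] at e
    rw [S_succ, e, ih]
    have e1 := B.r_comm (i := n + 2) (by omega) (B.s_mem (a := 0) (b := 1) (i := 0) le_rfl (by omega))
    have e2 := B.s_comm (i := n + 2) (by omega) (B.r_mem (a := 0) (b := 1) (i := 0) le_rfl (by omega))
    simp only [mul_assoc]
    rw [e2, ← mul_assoc, ← e1, mul_assoc]

theorem S_braid (n : ℕ) : B.S n * B.r (n + 1) * B.S n = B.r (n + 1) * B.S n * B.r (n + 1) := by
  induction n with
  | zero => exact B.braid 0
  | succ n ih =>
    have ih' := congrArg B.sh ih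
    simp only [map_mul, sh_r] at ih'
    have e1 := B.r_comm (i := n + 2) (by omega) (B.s_mem (a := 0) (b := 1) (i := 0) le_rfl (by omega))
    have e2 := B.r_comm (i := n + 2) (by omega) (B.r_mem (a := 0) (b := 1) (i := 0) le_rfl (by omega))
    rw [S_succ']
    calc B.s 0 * B.sh (B.S n) * B.r 0 * B.r (n + 1 + 1) * (B.s 0 * B.sh (B.S n) * B.r 0)
        = B.s 0 * (B.sh (B.S n) * B.r (n + 2) * (B.r 0 * B.s 0) * B.sh (B.S n)) * B.r 0 := by
          simp only [mul_assoc]; rw [← mul_assoc (B.r 0) (B.r (n + 2)), e2]; simp only [mul_assoc]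
      _ = B.s 0 * B.r (n + 2) * B.sh (B.S n) * (B.r (n + 2) * B.r 0) := by
          rw [B.rs, mul_one, ih']; simp only [mul_assoc]
      _ = _ := by
          rw [e1, ← e2]; simp only [mul_assoc]

/-- The braid identity behind associativity of $\star$. The case $m=0$ is the braid relation
`S_braid`, and larger $m$ only adds letters that commute with `S n`. -/
theorem S_mul_S (n m : ℕ) : B.S n * B.S (n + m + 1) = B.up (n + 1) (B.S m) * B.S n := by
  induction m with
  | zero =>
    rw [add_zero, S_succ, ← mul_assoc, ← mul_assoc, S_braid, mul_assoc, B.rs, mul_one]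
    simp only [S, up_r, zero_add]
  | succ m ih =>
    have e1 := B.r_comm (i := n + m + 2) (by omega) (B.S_mem n)
    have e2 := B.s_comm (i := n + m + 2) (by omega) (B.S_mem n)
    rw [← add_assoc n, S_succ _ (n + m + 1), S_succ _ m, map_mul, map_mul, up_r, up_s,
      show m + 1 + (n + 1) = n + m + 2 by omega, ← mul_assoc, ← mul_assoc,
      show n + m + 1 + 1 = n + m + 2 by omega, e1, mul_assoc (B.r _), ih]
    simp only [mul_assoc]
    rw [e2]

/-- The crossing of the strand at position `n + 1` over `n + 1` strands. -/
def Y : ℕ → E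
  | 0 => B.r 0
  | n + 1 => B.r (n + 1) * Y n

/-- The inverse of the crossing, without its last letter. -/
def Z : ℕ → E
  | 0 => 1
  | n + 1 => Z n * B.s (n + 1)

theorem Y_succ (n : ℕ) : B.Y (n + 1) = B.r (n + 1) * B.Y n := rfl

theorem Z_succ (n : ℕ) : B.Z (n + 1) = B.Z n * B.s (n + 1) := rfl

theorem Y_mem (n : ℕ) : B.Y n ∈ B.W 0 (n + 1) := by
  induction n with
  | zero => exact B.r_mem le_rfl (by omega)
  | succ n ih => exact mul_mem (B.r_mem (by omega) (by omega)) (B.W_mono le_rfl (by omega) ih)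

theorem Z_mem (n : ℕ) : B.Z n ∈ B.W 1 (n + 1) := by
  induction n with
  | zero => exact one_mem _
  | succ n ih => exact mul_mem (B.W_mono le_rfl (by omega) ih) (B.s_mem (by omega) (by omega))

/-- Together with `Y_mul_Z` it says that $S_n$ and $r_0$ are $YZ$ and $ZY$ with $Z$ free of position
zero. A trace over the tail can therefore exchange the two. -/
theorem Z_mul_Y (n : ℕ) : B.Z n * B.Y n = B.r 0 := by
  induction n with
  | zero => exact one_mul _
  | succ n ih => rw [Z_succ, Y_succ, mul_assoc, B.sr_mul, ih]

theorem Y_mul_Z (n : ℕ) : B.Y n * B.Z n = B.S n := by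
  induction n with
  | zero => exact mul_one _
  | succ n ih => rw [Z_succ, Y_succ, S_succ, ← ih]; simp only [mul_assoc]

theorem Y_succ' (n : ℕ) : B.Y (n + 1) = B.sh (B.Y n) * B.r 0 := by
  induction n with
  | zero => simp only [Y, sh_r]
  | succ n ih =>
    have e := congrArg B.sh (B.Y_succ n)
    rw [map_mul, sh_r] at e
    rw [Y_succ, e, ih, mul_assoc]

/-- A word slides through the strand that crosses it and comes out shifted by one. -/
theorem mul_Y {n : ℕ} {v : E} (hv : v ∈ B.W 0 n) : v * B.Y n = B.Y n * B.sh v := by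
  refine B.intertwine B.sh (fun i _ hi => ?_) hv
  rw [sh_r]
  clear hv
  induction n with
  | zero => omega
  | succ n ih =>
    rcases Nat.lt_succ_iff_lt_or_eq.1 hi with hi | rfl
    · have e : B.r i * B.r (n + 1) = B.r (n + 1) * B.r i := B.far _ _ (by omega)
      rw [Y_succ, ← mul_assoc, e, mul_assoc, ih hi, mul_assoc]
    · rcases i with _ | i
      · simp only [Y, ← mul_assoc]; exact B.braid 0
      · have e := B.r_comm (i := i + 2) (by omega) (B.Y_mem i)
        rw [Y_succ, Y_succ, mul_assoc (B.r (i + 1 + 1)), mul_assoc (B.r (i + 1)), e]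
        simp only [← mul_assoc]
        rw [B.braid]

/-- The braid exchanges the strands $0$ and $n+1$, and the strands between them pass straight
through, so words in those strands commute with it. -/
theorem S_comm {n : ℕ} {p : E} (hp : p ∈ B.W 1 n) : p * B.S n = B.S n * p := by
  rcases n with _ | n
  · obtain ⟨c, rfl⟩ : ∃ c : ℂ, p = c • 1 := B.W_self 0 (B.W_mono (Nat.zero_le 1) le_rfl hp)
    simp
  refine B.comm_of_gen (fun i hi hi' => ?_) hp
  clear hp
  induction n with
  | zero => omega
  | succ n ih =>
    rcases Nat.lt_succ_iff_lt_or_eq.1 hi' with hi' | rfl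
    · have e1 : B.r i * B.r (n + 2) = B.r (n + 2) * B.r i := B.far _ _ (by omega)
      have e2 := B.s_comm (i := n + 2) (by omega) (B.r_mem (a := 0) (b := i + 1) (i := i) (by omega) (by omega))
      rw [S_succ, ← mul_assoc, ← mul_assoc, e1, mul_assoc _ (B.s _), ← e2, mul_assoc (B.r _) (B.r i),
        ih hi']
      simp only [mul_assoc]
    · have e := B.r_comm (i := n + 2) (by omega) (B.S_mem n)
      rw [S_succ, S_succ]
      calc B.r (n + 1) * (B.r (n + 2) * (B.r (n + 1) * B.S n * B.s (n + 1)) * B.s (n + 2))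
          = B.r (n + 1) * B.r (n + 2) * B.r (n + 1) * B.S n * B.s (n + 1) * B.s (n + 2) := by
            simp only [mul_assoc]
        _ = B.r (n + 2) * B.r (n + 1) * (B.S n * B.r (n + 2)) * B.s (n + 1) * B.s (n + 2) := by
            rw [B.braid, e]; simp only [mul_assoc]
        _ = B.r (n + 2) * B.r (n + 1) * B.S n * (B.r (n + 2) * B.s (n + 1) * B.s (n + 2)) := by
            simp only [mul_assoc]
        _ = _ := by rw [← (B.pair (n + 1)).ssr]; simp only [mul_assoc]

/-- The crossing of a block of `p + 1` strands over a block of `m + 1` strands. -/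
def block (m : ℕ) : ℕ → E
  | 0 => B.Y m
  | p + 1 => block m p * B.up (p + 1) (B.Y m)

theorem block_succ (m p : ℕ) : B.block m (p + 1) = B.block m p * B.up (p + 1) (B.Y m) := rfl

theorem block_mem (m p : ℕ) : B.block m p ∈ B.W 0 (m + p + 1) := by
  induction p with
  | zero => exact B.Y_mem m
  | succ p ih =>
    exact mul_mem (B.W_mono le_rfl (by omega) ih) (B.up_mem' (B.Y_mem m) _ (by omega) (by omega))

theorem block_succ' (m p : ℕ) : B.block m (p + 1) = B.Y m * B.sh (B.block m p) := by
  induction p with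
  | zero => rfl
  | succ p ih =>
    have e := congrArg B.sh (B.block_succ m p)
    rw [map_mul] at e
    rw [block_succ _ m (p + 1), e, ih, ← mul_assoc]; rfl

/-- With `up_mul_block` this is naturality of the block crossing: words on either block pass through
it and exchange places. -/
theorem mul_block {m p : ℕ} {y : E} (hy : y ∈ B.W 0 m) :
    y * B.block m p = B.block m p * B.up (p + 1) y := by
  induction p with
  | zero => exact B.mul_Y hy
  | succ p ih =>
    rw [block_succ, ← mul_assoc, ih, mul_assoc, ← map_mul, B.mul_Y hy, map_mul, up_sh, mul_assoc]
    rfl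

theorem up_mul_block {m p : ℕ} {v : E} (hv : v ∈ B.W 0 p) :
    B.up (m + 1) v * B.block m p = B.block m p * v := by
  refine B.intertwine' (B.up (m + 1)) (fun i _ hi => ?_) hv
  rw [up_r]
  clear hv
  induction p generalizing i with
  | zero => omega
  | succ p ih =>
    rcases i with _ | i
    · have e : B.r (0 + (m + 1)) * B.Y m * B.sh (B.Y m) = B.Y m * B.sh (B.Y m) * B.r 0 := by
        rw [zero_add, ← Y_succ, mul_assoc, ← Y_succ', B.mul_Y (B.Y_mem m)]
      rcases p with _ | p
      · rw [block_succ', ← mul_assoc]; exact e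
      · rw [block_succ', block_succ', map_mul]
        have c : B.sh (B.sh (B.block m p)) * B.r 0 = B.r 0 * B.sh (B.sh (B.block m p)) :=
          (B.W_comm (a := 0) (b := 1) (by omega) (B.r_mem le_rfl (by omega))
            (B.sh_mem (B.sh_mem (B.block_mem m p)))).symm
        simp only [← mul_assoc]
        rw [e]
        simp only [mul_assoc]
        rw [c]
    · have h := congrArg B.sh (ih i (Nat.zero_le _) (by omega))
      simp only [map_mul, sh_r] at h
      rw [block_succ', ← mul_assoc]
      have c : B.Y m * B.r (i + 1 + (m + 1)) = B.r (i + 1 + (m + 1)) * B.Y m :=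
        B.r_comm (by omega) (B.Y_mem m)
      rw [← c, mul_assoc, show i + 1 + (m + 1) = i + (m + 1) + 1 by omega, h, mul_assoc]

/-- A two-sided inverse of the block crossing. -/
theorem exists_block_inv (m p : ℕ) : ∃ b ∈ B.W 0 (m + p + 1), b * B.block m p = 1 ∧
    B.block m p * b = 1 := by
  have hY : ∀ n, ∃ b ∈ B.W 0 (n + 1), b * B.Y n = 1 ∧ B.Y n * b = 1 := by
    intro n
    induction n with
    | zero => exact ⟨B.s 0, B.s_mem le_rfl (by omega), B.sr 0, B.rs 0⟩
    | succ n ih =>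
      obtain ⟨b, hb, h1, h2⟩ := ih
      refine ⟨b * B.s (n + 1), mul_mem (B.W_mono le_rfl (by omega) hb) (B.s_mem (by omega) (by omega)), ?_, ?_⟩
      · rw [Y_succ, mul_assoc, B.sr_mul, h1]
      · rw [Y_succ, mul_assoc, ← mul_assoc (B.Y n), h2, one_mul, B.rs]
  obtain ⟨y, hy, y1, y2⟩ := hY m
  induction p with
  | zero => exact ⟨y, hy, y1, y2⟩
  | succ p ih =>
    obtain ⟨b, hb, h1, h2⟩ := ih
    refine ⟨B.up (p + 1) y * b, mul_mem (B.up_mem' hy _ (by omega) (by omega))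
      (B.W_mono le_rfl (by omega) hb), ?_, ?_⟩
    · rw [block_succ, mul_assoc, ← mul_assoc b, h1, one_mul, ← map_mul, y1, map_one]
    · rw [block_succ, mul_assoc, ← mul_assoc (B.up _ _), ← map_mul, y2, map_one, one_mul, h2]

end BMWTower

/-! ### Chains, and induction on words modulo cyclicity of the tail -/

namespace BMWTower

variable {l μ : ℂ} {E : Type*} [Ring E] [Algebra ℂ E] (B : BMWTower l μ E)

/-- The chain `s₀ s₁ ⋯ s_{n-1}`. -/
def c : ℕ → E
  | 0 => 1
  | n + 1 => c n * B.s n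

theorem c_succ (n : ℕ) : B.c (n + 1) = B.c n * B.s n := rfl

theorem c_mem (n : ℕ) : B.c n ∈ B.W 0 n := by
  induction n with
  | zero => exact one_mem _
  | succ n ih => exact mul_mem (B.W_mono le_rfl (by omega) ih) (B.s_mem (by omega) (by omega))

theorem c_succ' (n : ℕ) : B.c (n + 1) = B.s 0 * B.sh (B.c n) := by
  induction n with
  | zero => simp [c]
  | succ n ih =>
    have e := congrArg B.sh (B.c_succ n)
    rw [map_mul, sh_s] at e
    rw [c_succ, e, ih, mul_assoc]

/-- The chain `k₀ s₁ ⋯ s_n`. -/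
def b (n : ℕ) : E := B.k 0 * B.sh (B.c n)

theorem b_mem (n : ℕ) : B.b n ∈ B.W 0 (n + 1) :=
  mul_mem (B.k_mem le_rfl (by omega)) (B.W_mono (by omega) le_rfl (B.sh_mem (B.c_mem n)))

theorem b_mul_s (n : ℕ) : B.b n * B.s (n + 1) = B.b (n + 1) := by
  rw [b, b, c_succ, map_mul, sh_s, mul_assoc]

/-- `s_i k_{i+1} = r_{i+1} k_i k_{i+1}`. -/
theorem s_mul_k (i : ℕ) : B.s i * B.k (i + 1) = B.r (i + 1) * B.k i * B.k (i + 1) := by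
  have P := B.pair i
  conv_lhs => rw [← P.kkk', ← mul_assoc, ← mul_assoc, P.skk]

theorem r_mul_k (i : ℕ) : B.r i * B.k (i + 1) = B.s (i + 1) * B.k i * B.k (i + 1) := by
  have P := B.pair i
  conv_lhs => rw [← P.kkk', ← mul_assoc, ← mul_assoc, P.rkk]

/-- An induction principle for trace-like conditions on the words of the tower. -/
theorem trace_induction (P : ℕ → Submodule ℂ E) (one : 1 ∈ P 0)
    (conj : ∀ n, ∀ p ∈ B.W 1 n, ∀ w ∈ B.W 0 n, p * w - w * p ∈ P n)
    (mul : ∀ n m, ∀ w ∈ B.W 0 n, ∀ y ∈ B.W 0 m, w ∈ P n → w * B.up (n + 1) y ∈ P (n + m + 1))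
    (r : ∀ n, ∀ w ∈ B.W 0 n, w ∈ P n → B.r 0 * B.sh w ∈ P (n + 1))
    (kk : ∀ n, ∀ w ∈ B.W 0 n, w ∈ P n → B.k 0 * B.k 1 * B.sh (B.sh w) ∈ P (n + 2))
    (b : ∀ n, B.b n ∈ P (n + 1)) (n : ℕ) : ∀ w ∈ B.W 0 n, w ∈ P n := by
  have conj' : ∀ {n p w}, p ∈ B.W 1 n → w ∈ B.W 0 n → p * w ∈ P n → w * p ∈ P n := by
    intro n p w hp hw h
    have := sub_mem h (conj n p hp w hw)
    rwa [sub_sub_cancel] at this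
  have conj'' : ∀ {n p w}, p ∈ B.W 1 n → w ∈ B.W 0 n → w * p ∈ P n → p * w ∈ P n := by
    intro n p w hp hw h
    have := add_mem h (conj n p hp w hw)
    rwa [add_sub_cancel] at this
  have W10 : ∀ {n x}, x ∈ B.W 1 n → x ∈ B.W 0 n := fun h => B.W_mono (Nat.zero_le _) le_rfl h
  induction n using Nat.strong_induction_on with
  | _ N IH =>
    rcases N with _ | N
    · intro w hw
      obtain ⟨c, rfl⟩ := B.W_self 0 hw
      exact Submodule.smul_mem _ _ one
    -- the chains `k₀ s₁ ⋯ s_j k_{j+1}`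
    have chain_k : ∀ j n, j + n + 1 = N → ∀ y ∈ B.W 0 n,
        B.b j * B.k (j + 1) * B.up (j + 2) y ∈ P (N + 1) := by
      intro j
      induction j with
      | zero =>
        intro n hn y hy
        have := kk n y hy (IH n (by omega) y hy)
        rw [show n + 2 = N + 1 by omega] at this
        simpa [BMWTower.b, c, up_succ] using this
      | succ j ih =>
        intro n hn y hy
        -- The last letter $s_{j+1}$ of the chain meets $k_{j+2}$ and becomes $r_{j+2}k_{j+1}$.
        -- Cyclicity then brings $r_{j+2}$ to the far right, where it joins the tail, and the chain
        -- has become shorter.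
        have e : B.b (j + 1) * B.k (j + 1 + 1) * B.up (j + 1 + 2) y =
            B.r (j + 2) * (B.b j * B.k (j + 1) * B.up (j + 2) (B.k 0 * B.sh y)) := by
          have e1 := B.r_comm (i := j + 2) (by omega) (B.b_mem j)
          rw [← b_mul_s, mul_assoc (B.b j), s_mul_k, map_mul, up_k, zero_add, up_sh, ← up_succ]
          simp only [← mul_assoc]
          rw [e1]
        rw [e]
        have hr : B.r (j + 2) ∈ B.W 1 (N + 1) := B.r_mem (by omega) (by omega)
        have hb : B.b j * B.k (j + 1) ∈ B.W 0 (N + 1) :=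
          mul_mem (B.W_mono le_rfl (by omega) (B.b_mem j)) (B.k_mem (by omega) (by omega))
        have hy' : ∀ x ∈ B.W 0 (n + 1), B.up (j + 2) x ∈ B.W 0 (N + 1) := fun x hx =>
          B.up_mem' hx _ (by omega) (by omega)
        have hks : B.k 0 * B.sh y ∈ B.W 0 (n + 1) := mul_mem (B.k_mem le_rfl (by omega))
          (B.W_mono (by omega) le_rfl (B.sh_mem hy))
        refine conj'' hr (mul_mem hb (hy' _ hks)) ?_
        have := ih (n + 1) (by omega) (B.k 0 * B.sh y * B.r 0)
          (mul_mem hks (B.r_mem le_rfl (by omega)))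
        rwa [map_mul, up_r, zero_add, ← mul_assoc] at this
    -- Induction on the length of the tail. A tail without a letter at its first position splits off
    -- by `mul`, a letter $s$ lengthens the chain, and a letter $k$ is the case `chain_k`; $r$ is a
    -- combination of these.
    have chain : ∀ n j, j + n = N → ∀ y ∈ B.W 0 n, B.b j * B.up (j + 1) y ∈ P (N + 1) := by
      intro n
      induction n with
      | zero =>
        intro j hj y hy
        obtain ⟨c, rfl⟩ := B.W_self 0 hy
        obtain rfl : j = N := by omega
        rw [map_smul, map_one, mul_smul_comm, mul_one]
        exact Submodule.smul_mem _ _ (b j)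
      | succ n ih =>
        intro j hj y hy
        have hbj := B.W_mono (Nat.zero_le _) (show j + 1 ≤ N + 1 by omega) (B.b_mem j)
        have upW : ∀ {x}, x ∈ B.W 0 (n + 1) → B.up (j + 1) x ∈ B.W 0 (N + 1) := fun hx =>
          B.up_mem' hx _ (by omega) (by omega)
        have upW' : ∀ {x}, x ∈ B.W 1 (n + 1) → B.up (j + 1) x ∈ B.W 1 (N + 1) := fun hx =>
          B.W_mono (by omega) (by omega) (B.up_mem hx (j + 1))
        have comm : ∀ {x}, x ∈ B.W 1 (n + 1) → B.b j * B.up (j + 1) x = B.up (j + 1) x * B.b j :=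
          fun hx => B.W_comm (by omega) (B.b_mem j) (B.up_mem hx (j + 1))
        -- the letter in the middle
        have red : ∀ g ∈ B.W 0 1, (∀ z ∈ B.W 0 n, B.b j * B.up (j + 1) (g * B.sh z) ∈ P (N + 1)) →
            ∀ a ∈ B.W 1 (n + 1), ∀ d ∈ B.W 1 (n + 1),
              B.b j * B.up (j + 1) (a * g * d) ∈ P (N + 1) := by
          intro g hg h a ha d hd
          obtain ⟨z, hz, hz'⟩ := B.exists_sh (mul_mem hd ha)
          have hgd : B.up (j + 1) (g * d) ∈ B.W 0 (N + 1) :=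
            upW (mul_mem (B.W_mono le_rfl (by omega) hg) (W10 hd))
          have := h z hz
          rw [hz', ← mul_assoc, map_mul, ← mul_assoc] at this
          have := conj'' (p := B.up (j + 1) a) (upW' ha)
            (w := B.b j * B.up (j + 1) (g * d)) (mul_mem hbj hgd) (by simpa only [mul_assoc] using this)
          rw [← mul_assoc, ← comm ha] at this
          simpa only [map_mul, mul_assoc] using this
        have h1 : ∀ z ∈ B.W 0 n, B.b j * B.up (j + 1) (B.sh z) ∈ P (N + 1) := by
          intro z hz
          have := mul (j + 1) n _ (B.b_mem j) z hz (b j)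
          rw [show j + 1 + n + 1 = N + 1 by omega] at this
          rwa [← up_succ']
        have hs : ∀ z ∈ B.W 0 n, B.b j * B.up (j + 1) (B.s 0 * B.sh z) ∈ P (N + 1) := by
          intro z hz
          have := ih (j + 1) (by omega) z hz
          rw [← b_mul_s, up_succ', mul_assoc] at this
          rwa [map_mul, up_s, zero_add]
        have hk : ∀ z ∈ B.W 0 n, B.b j * B.up (j + 1) (B.k 0 * B.sh z) ∈ P (N + 1) := by
          intro z hz
          have := chain_k j n (by omega) z hz
          rw [up_succ', mul_assoc] at this
          rwa [map_mul, up_k, zero_add]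
        have hr : ∀ z ∈ B.W 0 n, B.b j * B.up (j + 1) (B.r 0 * B.sh z) ∈ P (N + 1) := by
          intro z hz
          have e : B.r 0 = B.s 0 + l • 1 - l • B.k 0 := by rw [B.s_eq]; abel
          rw [e, sub_mul, add_mul, smul_mul_assoc, smul_mul_assoc, _root_.one_mul, map_sub, map_add,
            map_smul, map_smul, mul_sub, mul_add, mul_smul_comm, mul_smul_comm]
          exact sub_mem (add_mem (hs z hz) (Submodule.smul_mem _ _ (h1 z hz)))
            (Submodule.smul_mem _ _ (hk z hz))
        have : B.dec n ≤ (P (N + 1)).comap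
            ((LinearMap.mulLeft ℂ (B.b j)).comp (B.up (j + 1)).toLinearMap) := by
          refine B.dec_induction ?_ ?_ ?_
          · intro a ha
            obtain ⟨z, hz, rfl⟩ := B.exists_sh ha
            exact h1 z hz
          · exact red _ (B.r_mem le_rfl (by omega)) hr
          · exact red _ (B.k_mem le_rfl (by omega)) hk
        exact this (B.W_le_dec n y hy)
    have red : ∀ g ∈ B.W 0 1, (∀ z ∈ B.W 0 N, g * B.sh z ∈ P (N + 1)) →
        ∀ a ∈ B.W 1 (N + 1), ∀ d ∈ B.W 1 (N + 1), a * g * d ∈ P (N + 1) := by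
      intro g hg h a ha d hd
      obtain ⟨z, hz, hz'⟩ := B.exists_sh (mul_mem hd ha)
      have := h z hz
      rw [hz', ← mul_assoc] at this
      rw [mul_assoc]
      exact conj'' ha (mul_mem (B.W_mono le_rfl (by omega) hg) (W10 hd)) this
    intro w hw
    refine (B.dec_induction (U := P (N + 1)) ?_ ?_ ?_) (B.W_le_dec N w hw)
    · intro a ha
      obtain ⟨z, hz, rfl⟩ := B.exists_sh ha
      have := mul 0 N 1 (one_mem _) z hz one
      rwa [one_mul, show 0 + N + 1 = N + 1 by omega] at this
    · exact red _ (B.r_mem le_rfl (by omega)) fun z hz => r N z hz (IH N (by omega) z hz)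
    · refine red _ (B.k_mem le_rfl (by omega)) fun z hz => ?_
      have := chain N 0 (by omega) z hz
      simpa [BMWTower.b, c, up_succ] using this

end BMWTower

/-! ### The ⋆-product of words -/

namespace BMWTower

variable {l μ : ℂ} {E : Type*} [Ring E] [Algebra ℂ E] (B : BMWTower l μ E)

/-- The crossing removes a block of $m+1$ strands from between the two strands exchanged by `S`. It
is what allows a factor to be split off from the left argument of $\star$. -/
theorem S_mul_block (n m p : ℕ) : B.S (n + m + 1) * B.up (n + 1) (B.block m p) =
    B.up (n + 1) (B.block m p) * B.S n := by
  induction p with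
  | zero =>
    induction m with
    | zero =>
      show B.S (n + 1) * B.up (n + 1) (B.r 0) = B.up (n + 1) (B.r 0) * B.S n
      rw [up_r, zero_add, S_succ, mul_assoc, B.sr, mul_one]
    | succ m ih =>
      have ih' : B.S (n + m + 1) * B.up (n + 1) (B.Y m) = B.up (n + 1) (B.Y m) * B.S n := ih
      show B.S (n + (m + 1) + 1) * B.up (n + 1) (B.Y (m + 1)) = B.up (n + 1) (B.Y (m + 1)) * B.S n
      rw [Y_succ, map_mul, up_r, show m + 1 + (n + 1) = n + m + 1 + 1 by omega,
        show n + (m + 1) + 1 = n + m + 1 + 1 by omega, S_succ, mul_assoc _ (B.s _), B.sr_mul,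
        mul_assoc, ih', mul_assoc]
  | succ p ih =>
    rw [block_succ, map_mul, ← mul_assoc, ih, mul_assoc, mul_assoc, ← up_add]
    rw [B.W_comm (by omega) (B.S_mem n) (B.up_mem (B.Y_mem m) (n + 1 + (p + 1)))]

/-- The `⋆`-product of words: `w` on `n + 1` strands. -/
def star (n : ℕ) (w v : E) : E := w * B.up (n + 1) v * B.S n

theorem star_mem {n m : ℕ} {w v : E} (hw : w ∈ B.W 0 n) (hv : v ∈ B.W 0 m) :
    B.star n w v ∈ B.W 0 (n + m + 1) :=
  mul_mem (mul_mem (B.W_mono le_rfl (by omega) hw) (B.up_mem' hv _ (by omega) (by omega)))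
    (B.W_mono le_rfl (by omega) (B.S_mem n))

/-- Associativity holds already for words, before taking traces: `u` lies to the right of all
strands of `S n`, so only `S_mul_S` is needed. -/
theorem star_assoc (n m : ℕ) {v u : E} (w : E) (hu : ∃ p, u ∈ B.W 0 p) :
    B.star (n + m + 1) (B.star n w v) u = B.star n w (B.star m v u) := by
  obtain ⟨p, hu⟩ := hu
  have e : B.S n * B.up (n + m + 1 + 1) u = B.up (n + m + 1 + 1) u * B.S n :=
    B.W_comm (c := n + m + 2) (d := p + n + m + 2) (by omega) (B.S_mem n)
      (B.up_mem' hu _ (by omega) (by omega))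
  unfold star
  rw [mul_assoc _ (B.S n), e]
  simp only [map_mul, mul_assoc]
  rw [S_mul_S, ← up_add, show n + 1 + (m + 1) = n + m + 1 + 1 by omega]

end BMWTower

/-! ### Descendants and characteristic elements, axiomatically -/

/-- The maps sending a word to the matrix descendant and to the characteristic element
it defines, axiomatized by their behaviour with respect to the braid structure. -/
structure DescentSystem {l μ : ℂ} {E : Type*} [Ring E] [Algebra ℂ E] (B : BMWTower l μ E)
    (A : Type*) [Ring A] [Algebra ℂ A] where
  ι : A →ₐ[ℂ] E
  D : ℕ → E →ₗ[ℂ] E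
  ch : ℕ → E →ₗ[ℂ] A
  L : ℕ → E → E → E →ₗ[ℂ] E
  D_conj : ∀ {n p w}, p ∈ B.W 1 n → w ∈ B.W 0 n → D n (p * w) = D n (w * p)
  D_mul : ∀ {n m w y}, w ∈ B.W 0 n → y ∈ B.W 0 m →
    D (n + m + 1) (w * B.up (n + 1) y) = D n w * ι (ch m y)
  ch_conj : ∀ {n p w}, p ∈ B.W 0 n → w ∈ B.W 0 n → ch n (p * w) = ch n (w * p)
  ch_mul : ∀ {n m w y}, w ∈ B.W 0 n → y ∈ B.W 0 m →
    ch (n + m + 1) (w * B.up (n + 1) y) = ch n w * ch m y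
  D_L : ∀ {n m w y s}, w ∈ B.W 0 n → y ∈ B.W 0 m → s ∈ B.W 0 (n + 1) →
    D (n + m + 1) (w * B.up (n + 1) y * s) = L n w s (D m y)
  L_ι : ∀ {n w s}, w ∈ B.W 0 n → s ∈ B.W 0 (n + 1) → ∀ X x, L n w s (X * ι x) = L n w s X * ι x
  L_one : ∀ {n w}, w ∈ B.W 0 n → L n w (B.S n) 1 = D n w
  g : A
  D_k : D 1 (B.k 0) = ι g
  g_ch : ∃ t : ℂ, g = t • ch 1 (B.k 0)
  L_k_one : L 0 1 (B.k 0) 1 = μ • D 0 1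

namespace DescentSystem

variable {l μ : ℂ} {E : Type*} [Ring E] [Algebra ℂ E] {B : BMWTower l μ E}
  {A : Type*} [Ring A] [Algebra ℂ A] (Δ : DescentSystem B A)

/-- The two words placed side by side in either order are conjugate by a block crossing, and the
full trace is cyclic. -/
theorem ch_comm {n m : ℕ} {w y : E} (hw : w ∈ B.W 0 n) (hy : y ∈ B.W 0 m) :
    Δ.ch n w * Δ.ch m y = Δ.ch m y * Δ.ch n w := by
  obtain ⟨b, hb, h1, h2⟩ := B.exists_block_inv n m
  have hup := B.up_mem' (c := 0) (d := n + m + 1) hy (n + 1) (by omega) (by omega)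
  have hup' := B.up_mem' (c := 0) (d := n + m + 1) hw (m + 1) (by omega) (by omega)
  have hw' := B.W_mono le_rfl (show n ≤ n + m + 1 by omega) hw
  have hy' := B.W_mono le_rfl (show m ≤ n + m + 1 by omega) hy
  have e : w * B.up (n + 1) y * B.block n m = B.block n m * (y * B.up (m + 1) w) := by
    rw [mul_assoc, B.up_mul_block hy, ← mul_assoc, B.mul_block hw, mul_assoc,
      ← B.W_comm (by omega) hy (B.up_mem hw (m + 1))]
  rw [← Δ.ch_mul hw hy, ← Δ.ch_mul hy hw, show m + n + 1 = n + m + 1 by omega]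
  calc Δ.ch (n + m + 1) (w * B.up (n + 1) y)
      = Δ.ch (n + m + 1) ((w * B.up (n + 1) y * B.block n m) * b) := by
        rw [mul_assoc _ _ b, h2, mul_one]
    _ = Δ.ch (n + m + 1) (b * (w * B.up (n + 1) y * B.block n m)) :=
        Δ.ch_conj (mul_mem (mul_mem hw' hup) (B.block_mem n m)) hb
    _ = _ := by rw [e, ← mul_assoc, h1, one_mul]

/-- `⋆`-multiplication by `M` from the left. -/
def opA : E →ₗ[ℂ] E := Δ.L 0 1 (B.r 0)

/-- The transposition-type multiplication by `M`. -/
def opT : E →ₗ[ℂ] E := Δ.L 0 1 (B.k 0)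

theorem D_sh_mul {n : ℕ} {y s : E} (hy : y ∈ B.W 0 n) (hs : s ∈ B.W 0 1) :
    Δ.D (n + 1) (B.sh y * s) = Δ.L 0 1 s (Δ.D n y) := by
  have := Δ.D_L (n := 0) (w := 1) (one_mem _) hy hs
  rwa [one_mul, show 0 + n + 1 = n + 1 by omega] at this

theorem D_mul_sh {n : ℕ} {y s : E} (hy : y ∈ B.W 0 n) (hs : s ∈ B.W 0 1) :
    Δ.D (n + 1) (s * B.sh y) = Δ.L 0 1 s (Δ.D n y) := by
  rw [← Δ.D_conj (B.sh_mem hy) (B.W_mono le_rfl (by omega) hs), Δ.D_sh_mul hy hs]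

theorem opA_D {n : ℕ} {y : E} (hy : y ∈ B.W 0 n) : Δ.opA (Δ.D n y) = Δ.D (n + 1) (B.r 0 * B.sh y) :=
  (Δ.D_mul_sh hy (B.r_mem le_rfl (by omega))).symm

theorem opT_D {n : ℕ} {y : E} (hy : y ∈ B.W 0 n) : Δ.opT (Δ.D n y) = Δ.D (n + 1) (B.k 0 * B.sh y) :=
  (Δ.D_mul_sh hy (B.k_mem le_rfl (by omega))).symm

theorem opA_one : Δ.opA 1 = Δ.D 0 1 := Δ.L_one (one_mem _)

theorem opA_ι (X : E) (x : A) : Δ.opA (X * Δ.ι x) = Δ.opA X * Δ.ι x :=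
  Δ.L_ι (one_mem _) (B.r_mem le_rfl (by omega)) _ _

theorem opT_ι (X : E) (x : A) : Δ.opT (X * Δ.ι x) = Δ.opT X * Δ.ι x :=
  Δ.L_ι (one_mem _) (B.k_mem le_rfl (by omega)) _ _

theorem opT_one : Δ.opT 1 = μ • Δ.D 0 1 := Δ.L_k_one

theorem D_sh {n : ℕ} {y : E} (hy : y ∈ B.W 0 n) : Δ.D (n + 1) (B.sh y) = Δ.D 0 1 * Δ.ι (Δ.ch n y) := by
  have := Δ.D_mul (n := 0) (w := 1) (one_mem _) hy
  rwa [one_mul, show 0 + n + 1 = n + 1 by omega] at this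

theorem opT_M : Δ.opT (Δ.D 0 1) = Δ.ι Δ.g := by
  rw [Δ.opT_D (one_mem _), map_one, mul_one, ← Δ.D_k]

theorem g_comm {n : ℕ} {w : E} (hw : w ∈ B.W 0 n) : Δ.g * Δ.ch n w = Δ.ch n w * Δ.g := by
  obtain ⟨t, ht⟩ := Δ.g_ch
  rw [ht, smul_mul_assoc, mul_smul_comm, Δ.ch_comm (B.k_mem le_rfl (by omega)) hw]

theorem mem_sh {n : ℕ} {y : E} (hy : y ∈ B.W 0 n) : B.sh y ∈ B.W 0 (n + 1) :=
  B.W_mono (by omega) le_rfl (B.sh_mem hy)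

/-- Induction on the words modulo cyclic permutations of the tail. -/
theorem D_induction {n : ℕ} {U : Submodule ℂ E}
    (h1 : ∀ y ∈ B.W 0 n, Δ.D 0 1 * Δ.ι (Δ.ch n y) ∈ U)
    (hA : ∀ y ∈ B.W 0 n, Δ.opA (Δ.D n y) ∈ U)
    (hT : ∀ y ∈ B.W 0 n, Δ.opT (Δ.D n y) ∈ U) : ∀ w ∈ B.W 0 (n + 1), Δ.D (n + 1) w ∈ U := by
  have red : ∀ s ∈ B.W 0 1, (∀ y ∈ B.W 0 n, Δ.L 0 1 s (Δ.D n y) ∈ U) →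
      ∀ a ∈ B.W 1 (n + 1), ∀ b ∈ B.W 1 (n + 1), Δ.D (n + 1) (a * s * b) ∈ U := by
    intro s hs h a ha b hb
    obtain ⟨y, hy, hy'⟩ := B.exists_sh (mul_mem hb ha)
    have hs' := B.W_mono le_rfl (show 1 ≤ n + 1 by omega) hs
    rw [mul_assoc, Δ.D_conj ha (mul_mem hs' (B.W_mono (by omega) le_rfl hb)), mul_assoc, ← hy',
      Δ.D_mul_sh hy hs]
    exact h y hy
  intro w hw
  refine (B.dec_induction (U := U.comap (Δ.D (n + 1))) ?_ ?_ ?_) (B.W_le_dec n w hw)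
  · intro a ha
    obtain ⟨y, hy, rfl⟩ := B.exists_sh ha
    rw [Submodule.mem_comap, Δ.D_sh hy]
    exact h1 y hy
  · exact red _ (B.r_mem le_rfl (by omega)) hA
  · exact red _ (B.k_mem le_rfl (by omega)) hT

/-- In words the two sides are $k_0k_1r_2$ and $r_0k_1k_2$ followed by the shifted $y$. The latter
is $s_1k_0k_1k_2$; moving $s_1$ around the trace gives $k_0k_1k_2s_1=k_0k_1r_2$. -/
theorem opT_opT_opA {n : ℕ} {y : E} (hy : y ∈ B.W 0 n) :
    Δ.opT (Δ.opT (Δ.opA (Δ.D n y))) = Δ.opA (Δ.opT (Δ.opT (Δ.D n y))) := by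
  have P := B.pair 0
  have P' := B.pair 1
  have hr : ∀ {i N}, i < N → B.r i ∈ B.W 0 N := fun h => B.r_mem (by omega) h
  have hk : ∀ {i N}, i < N → B.k i ∈ B.W 0 N := fun h => B.k_mem (by omega) h
  have m1 : B.sh (B.sh (B.sh y)) ∈ B.W 0 (n + 3) := mem_sh (mem_sh (mem_sh hy))
  have m1' : B.sh (B.sh (B.sh y)) ∈ B.W 3 (n + 3) := B.sh_mem (B.sh_mem (B.sh_mem hy))
  rw [Δ.opA_D hy, Δ.opT_D (mul_mem (hr (by omega)) (mem_sh hy)),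
    Δ.opT_D (mul_mem (hk (by omega)) (mem_sh (mul_mem (hr (by omega)) (mem_sh hy)))), Δ.opT_D hy,
    Δ.opT_D (mul_mem (hk (by omega)) (mem_sh hy)),
    Δ.opA_D (mul_mem (hk (by omega)) (mem_sh (mul_mem (hk (by omega)) (mem_sh hy))))]
  simp only [map_mul, B.sh_r, B.sh_k, zero_add, one_add_one_eq_two]
  have e : B.r 0 * (B.k 1 * (B.k 2 * B.sh (B.sh (B.sh y)))) =
      B.s 1 * (B.k 0 * B.k 1 * B.k 2 * B.sh (B.sh (B.sh y))) := by
    simp only [← mul_assoc]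
    have := B.r_mul_k 0
    rw [zero_add] at this
    rw [this]
  have hcomm : B.sh (B.sh (B.sh y)) * B.s 1 = B.s 1 * B.sh (B.sh (B.sh y)) :=
    (B.W_comm (a := 0) (b := 2) (by omega) (B.s_mem (by omega) (by omega)) m1').symm
  rw [e, Δ.D_conj (B.s_mem le_rfl (by omega))
    (mul_mem (mul_mem (mul_mem (hk (by omega)) (hk (by omega))) (hk (by omega))) m1), mul_assoc,
    hcomm]
  have P'' : B.k 1 * B.k 2 * B.s 1 = B.k 1 * B.r 2 := P'.symm.kks
  congr 1
  simp only [← mul_assoc]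
  rw [mul_assoc (B.k 0) (B.k 1) (B.k 2), mul_assoc (B.k 0) (B.k 1 * B.k 2), P'']
  simp only [mul_assoc]

/-- On $M$ one has $T(T(M))=T(Ig)=\mu M g$. The general case follows by `D_induction`, as $T^2$
commutes with $A$ and $T$ and both maps are linear over coefficients. -/
theorem opT_opT_D (n : ℕ) : ∀ w ∈ B.W 0 n, Δ.opT (Δ.opT (Δ.D n w)) = Δ.D n w * Δ.ι (μ • Δ.g) := by
  have hM : Δ.opT (Δ.opT (Δ.D 0 1)) = Δ.D 0 1 * Δ.ι (μ • Δ.g) := by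
    rw [opT_M, ← one_mul (Δ.ι Δ.g), opT_ι, opT_one, map_smul, smul_mul_assoc, mul_smul_comm]
  induction n with
  | zero =>
    intro w hw
    obtain ⟨c, rfl⟩ := B.W_self 0 hw
    simp only [map_smul, hM, smul_mul_assoc]
  | succ n ih =>
    let U : Submodule ℂ E := LinearMap.eqLocus (Δ.opT.comp Δ.opT) (LinearMap.mulRight ℂ (Δ.ι (μ • Δ.g)))
    have hU : ∀ x, x ∈ U ↔ Δ.opT (Δ.opT x) = x * Δ.ι (μ • Δ.g) := fun x => Iff.rfl
    intro w hw
    refine (hU _).1 (Δ.D_induction ?_ ?_ ?_ w hw)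
    · intro y hy
      rw [hU, opT_ι, opT_ι, hM, mul_assoc, mul_assoc, ← map_mul, ← map_mul, smul_mul_assoc,
        mul_smul_comm, Δ.g_comm hy]
    · intro y hy
      rw [hU, Δ.opT_opT_opA hy, ih y hy, opA_ι]
    · intro y hy
      rw [hU, ih y hy, opT_ι]

/-- The map `A₋` attached to `s₀`. -/
theorem D_s_mul {n : ℕ} {y : E} (hy : y ∈ B.W 0 n) : Δ.D (n + 1) (B.s 0 * B.sh y) =
    Δ.opA (Δ.D n y) - l • (Δ.D 0 1 * Δ.ι (Δ.ch n y)) + l • Δ.opT (Δ.D n y) := by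
  rw [B.s_eq, add_mul, sub_mul, smul_mul_assoc, smul_mul_assoc, one_mul, map_add, map_sub, map_smul,
    map_smul, Δ.D_sh hy, Δ.opA_D hy, Δ.opT_D hy]

/-- Let $A_-$ be the map attached to $s_0$. Then $A T A_-=T^3$ on descendants, because
$r_0k_1=s_1k_0k_1$ and, after moving $s_1$ around the trace, $k_1s_2s_1=k_1k_2$. Expanding $A_-$ by
the skein relation and using $T^2=\mu g$ and $A(T(M))=Mg$ gives the formula. -/
theorem opA_opT_opA {n : ℕ} {y : E} (hy : y ∈ B.W 0 n) :
    Δ.opA (Δ.opT (Δ.opA (Δ.D n y))) = Δ.opT (Δ.D n y) * Δ.ι (μ • Δ.g)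
      + l • (Δ.D 0 1 * Δ.ι (Δ.g * Δ.ch n y)) - l • (Δ.opA (Δ.D n y) * Δ.ι (μ • Δ.g)) := by
  have hr : ∀ {i N}, i < N → B.r i ∈ B.W 0 N := fun h => B.r_mem (by omega) h
  have hs : ∀ {i N}, i < N → B.s i ∈ B.W 0 N := fun h => B.s_mem (by omega) h
  have hk : ∀ {i N}, i < N → B.k i ∈ B.W 0 N := fun h => B.k_mem (by omega) h
  have m1 : B.sh (B.sh (B.sh y)) ∈ B.W 0 (n + 3) := mem_sh (mem_sh (mem_sh hy))
  have m1' : B.sh (B.sh (B.sh y)) ∈ B.W 3 (n + 3) := B.sh_mem (B.sh_mem (B.sh_mem hy))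
  have main : Δ.opA (Δ.opT (Δ.D (n + 1) (B.s 0 * B.sh y))) = Δ.opT (Δ.D n y) * Δ.ι (μ • Δ.g) := by
    rw [← Δ.opT_ι, ← Δ.opT_opT_D n y hy, Δ.opT_D hy,
      Δ.opT_D (mul_mem (hk (by omega)) (mem_sh hy)),
      Δ.opT_D (mul_mem (hk (by omega)) (mem_sh (mul_mem (hk (by omega)) (mem_sh hy)))),
      Δ.opT_D (mul_mem (hs (by omega)) (mem_sh hy)),
      Δ.opA_D (mul_mem (hk (by omega)) (mem_sh (mul_mem (hs (by omega)) (mem_sh hy))))]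
    simp only [map_mul, B.sh_s, B.sh_k, zero_add, one_add_one_eq_two]
    have e : B.r 0 * (B.k 1 * (B.s 2 * B.sh (B.sh (B.sh y)))) =
        B.s 1 * (B.k 0 * B.k 1 * B.s 2 * B.sh (B.sh (B.sh y))) := by
      simp only [← mul_assoc]
      have := B.r_mul_k 0
      rw [zero_add] at this
      rw [this]
    have hcomm : B.sh (B.sh (B.sh y)) * B.s 1 = B.s 1 * B.sh (B.sh (B.sh y)) :=
      (B.W_comm (a := 0) (b := 2) (by omega) (B.s_mem (by omega) (by omega)) m1').symm
    rw [e, Δ.D_conj (B.s_mem le_rfl (by omega))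
      (mul_mem (mul_mem (mul_mem (hk (by omega)) (hk (by omega))) (hs (by omega))) m1), mul_assoc,
      hcomm]
    have P : B.k 1 * B.k 2 = B.k 1 * B.s 2 * B.s 1 := (B.pair 1).kk'_s'
    congr 1
    simp only [mul_assoc]
    rw [← mul_assoc (B.k 1) (B.k 2), P]
    simp only [mul_assoc]
  rw [Δ.D_s_mul hy, map_add, map_sub, map_smul, map_smul, map_add, map_sub, map_smul, map_smul,
    opT_ι, opT_M, ← map_mul, ← one_mul (Δ.ι _), opA_ι, opA_one, Δ.opT_opT_D n y hy, opA_ι] at main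
  rw [← main]
  abel

end DescentSystem

/-! ### Conjugates of the contraction -/

namespace BMWTower

variable {l μ : ℂ} {E : Type*} [Ring E] [Algebra ℂ E] (B : BMWTower l μ E)

/-- The conjugates `r_n ⋯ r_1 k₀ s_1 ⋯ s_n`. -/
def κ : ℕ → E
  | 0 => B.k 0
  | n + 1 => B.r (n + 1) * κ n * B.s (n + 1)

theorem κ_succ (n : ℕ) : B.κ (n + 1) = B.r (n + 1) * B.κ n * B.s (n + 1) := rfl

theorem κ_mem (n : ℕ) : B.κ n ∈ B.W 0 (n + 1) := by
  induction n with
  | zero => exact B.k_mem le_rfl (by omega)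
  | succ n ih =>
    exact mul_mem (mul_mem (B.r_mem (by omega) (by omega)) (B.W_mono le_rfl (by omega) ih))
      (B.s_mem (by omega) (by omega))

/-- Moving the outer letters of a conjugate past letters at position zero. -/
theorem conj_past {n : ℕ} {x y z : E} (hx : x ∈ B.W 0 1) (hz : z ∈ B.W 0 1) :
    x * (B.r (n + 2) * y * B.s (n + 2)) * z = B.r (n + 2) * (x * y * z) * B.s (n + 2) := by
  have e1 := B.r_comm (i := n + 2) (by omega) hx
  have e2 := B.s_comm (i := n + 2) (by omega) hz
  simp only [mul_assoc]
  rw [← e2]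
  simp only [← mul_assoc]
  rw [e1]

theorem sh_κ_succ (n : ℕ) : B.sh (B.κ (n + 1)) = B.r (n + 2) * B.sh (B.κ n) * B.s (n + 2) := by
  rw [κ_succ, map_mul, map_mul, sh_r, sh_s]

theorem sh_S_succ (n : ℕ) : B.sh (B.S (n + 1)) = B.r (n + 2) * B.sh (B.S n) * B.s (n + 2) := by
  rw [S_succ, map_mul, map_mul, sh_r, sh_s]

theorem pair_zero : BMWPair l μ (B.r 0) (B.s 0) (B.k 0) (B.r 1) (B.s 1) (B.k 1) := B.pair 0

theorem κ_succ' (n : ℕ) : B.κ (n + 1) = B.s 0 * B.sh (B.κ n) * B.r 0 := by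
  induction n with
  | zero =>
    show B.r 1 * B.k 0 * B.s 1 = B.s 0 * B.sh (B.k 0) * B.r 0
    have P := B.pair_zero
    have e : B.k 1 * B.r 0 = B.r 0 * B.r 1 * B.k 0 * B.s 1 := by
      rw [P.rrk, mul_assoc, P.rs₂, mul_one]
    rw [B.sh_k, zero_add, mul_assoc (B.s 0), e]
    simp only [mul_assoc]
    rw [B.sr_mul]
  | succ n ih =>
    rw [sh_κ_succ, B.conj_past (B.s_mem le_rfl (by omega)) (B.r_mem le_rfl (by omega)), ← ih]
    rfl

/-- For $n=0$ this is $k_0r_1r_0=k_0k_1$. The letters added later are at positions two and higher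
and commute with position zero. -/
theorem k_sh_S_r (n : ℕ) : B.k 0 * B.sh (B.S n) * B.r 0 = B.k 0 * B.sh (B.κ n) := by
  induction n with
  | zero =>
    show B.k 0 * B.sh (B.r 0) * B.r 0 = B.k 0 * B.sh (B.k 0)
    rw [sh_r, sh_k, zero_add, ← B.pair_zero.kk'_r']
  | succ n ih =>
    have := B.conj_past (n := n) (y := B.sh (B.κ n)) (x := B.k 0) (z := 1)
      (B.k_mem le_rfl (by omega)) (one_mem _)
    rw [mul_one, mul_one] at this
    rw [sh_S_succ, sh_κ_succ, B.conj_past (B.k_mem le_rfl (by omega)) (B.r_mem le_rfl (by omega)), ih,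
      this]

/-- The case $n=0$ is $s_0k_1k_0=r_1k_0$; the outer conjugations again commute with position zero.
-/
theorem s_sh_κ_k (n : ℕ) : B.s 0 * B.sh (B.κ n) * B.k 0 = B.sh (B.S n) * B.k 0 := by
  induction n with
  | zero =>
    show B.s 0 * B.sh (B.k 0) * B.k 0 = B.sh (B.r 0) * B.k 0
    rw [sh_r, sh_k, zero_add, B.pair_zero.skk]
  | succ n ih =>
    have := B.conj_past (n := n) (y := B.sh (B.S n)) (x := 1) (z := B.k 0)
      (one_mem _) (B.k_mem le_rfl (by omega))
    rw [_root_.one_mul, _root_.one_mul] at this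
    rw [sh_S_succ, sh_κ_succ, B.conj_past (B.s_mem le_rfl (by omega)) (B.k_mem le_rfl (by omega)), ih,
      this]

theorem κ_mul_c (n : ℕ) : B.κ n * B.c n = B.c n * B.k n := by
  induction n with
  | zero => simp [κ, c]
  | succ n ih =>
    rw [κ_succ', c_succ', mul_assoc _ (B.r 0), B.rs_mul, mul_assoc, ← map_mul, ih, map_mul, sh_k,
      mul_assoc]

end BMWTower

/-! ### Commutativity of the ⋆-product after descent -/

namespace DescentSystem

variable {l μ : ℂ} {E : Type*} [Ring E] [Algebra ℂ E] {B : BMWTower l μ E}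
  {A : Type*} [Ring A] [Algebra ℂ A] (Δ : DescentSystem B A)

open BMWTower

/-- A word `p` in the tail of the left factor commutes with `S n` and with the shifted right factor,
so it can be moved around the whole product. -/
theorem D_star_conj {n m : ℕ} {p w v : E} (hp : p ∈ B.W 1 n) (hw : w ∈ B.W 0 n) (hv : v ∈ B.W 0 m) :
    Δ.D (n + m + 1) (B.star n (p * w) v) = Δ.D (n + m + 1) (B.star n (w * p) v) := by
  have e : B.star n (w * p) v = B.star n w v * p := by
    unfold BMWTower.star
    rw [mul_assoc w, B.W_comm (by omega) hp (B.up_mem hv (n + 1)), mul_assoc _ (B.S n),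
      ← B.S_comm hp]
    simp only [mul_assoc]
  rw [e, ← Δ.D_conj (B.W_mono le_rfl (by omega) hp) (B.star_mem hw hv)]
  simp only [BMWTower.star, mul_assoc]

theorem D_star_eq {n m : ℕ} {w v : E} (hw : w ∈ B.W 0 n) (hv : v ∈ B.W 0 m) :
    Δ.D (n + m + 1) (B.star n w v) = Δ.L n w (B.S n) (Δ.D m v) :=
  Δ.D_L hw hv (B.S_mem n)

/-- Conjugation by the crossing of the blocks of `y` and `v`, allowed under the trace, puts `y` last
and replaces $S_{n+m+1}$ by $S_n$; then `D_mul` splits `y` off. For the right factor the analogous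
rule is immediate from `L_ι`. -/
theorem D_star_mul_left {n m p : ℕ} {w y v : E} (hw : w ∈ B.W 0 n) (hy : y ∈ B.W 0 m)
    (hv : v ∈ B.W 0 p) : Δ.D (n + m + 1 + p + 1) (B.star (n + m + 1) (w * B.up (n + 1) y) v) =
      Δ.D (n + p + 1) (B.star n w v) * Δ.ι (Δ.ch m y) := by
  obtain ⟨b, hb, h1, h2⟩ := B.exists_block_inv m p
  have hb' : B.up (n + 1) b ∈ B.W (n + 1) (n + m + 1 + p + 1) := B.up_mem' hb _ le_rfl (by omega)
  have hB : B.up (n + 1) (B.block m p) ∈ B.W (n + 1) (n + m + 1 + p + 1) :=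
    B.up_mem' (B.block_mem m p) _ le_rfl (by omega)
  have hS : B.S (n + m + 1) = B.up (n + 1) (B.block m p) * B.S n * B.up (n + 1) b := by
    rw [← B.S_mul_block, mul_assoc, ← map_mul, h2, map_one, mul_one]
  have W0 : ∀ {x}, x ∈ B.W (n + 1) (n + m + 1 + p + 1) → x ∈ B.W 0 (n + m + 1 + p + 1) := fun h =>
    B.W_mono (Nat.zero_le _) le_rfl h
  have hw' : w ∈ B.W 0 (n + m + 1 + p + 1) := B.W_mono le_rfl (by omega) hw
  have hup : B.up (n + 1) (y * B.up (m + 1) v) ∈ B.W 0 (n + m + 1 + p + 1) := by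
    refine B.up_mem' (b := m + p + 1) (mul_mem (B.W_mono le_rfl (by omega) hy)
      (B.up_mem' hv _ (by omega) (by omega))) _ (by omega) (by omega)
  have e1 : B.star (n + m + 1) (w * B.up (n + 1) y) v =
      w * B.up (n + 1) (y * B.up (m + 1) v) * (B.up (n + 1) (B.block m p) * B.S n)
        * B.up (n + 1) b := by
    unfold BMWTower.star
    rw [hS, map_mul, ← up_add, show n + 1 + (m + 1) = n + m + 1 + 1 by omega]
    simp only [mul_assoc]
  have e2 : y * B.up (m + 1) v * B.block m p = B.block m p * (v * B.up (p + 1) y) := by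
    rw [mul_assoc, B.up_mul_block hv, ← mul_assoc, B.mul_block hy, mul_assoc,
      ← B.W_comm (by omega) hv (B.up_mem hy (p + 1))]
  have e3 : B.S n * B.up (n + p + 1 + 1) y = B.up (n + p + 1 + 1) y * B.S n :=
    B.W_comm (by omega) (B.S_mem n) (B.up_mem hy (n + p + 1 + 1))
  have e4 : B.up (n + 1) b * w = w * B.up (n + 1) b := (B.W_comm le_rfl hw hb').symm
  rw [e1, ← Δ.D_conj (B.W_mono (by omega) le_rfl hb')
    (mul_mem (mul_mem hw' hup) (mul_mem (W0 hB) (B.W_mono le_rfl (by omega) (B.S_mem n)))),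
    ← Δ.D_mul (B.star_mem hw hv) hy, show n + p + 1 + m + 1 = n + m + 1 + p + 1 by omega]
  congr 1
  calc B.up (n + 1) b * (w * B.up (n + 1) (y * B.up (m + 1) v) * (B.up (n + 1) (B.block m p) * B.S n))
      = w * (B.up (n + 1) b * B.up (n + 1) (y * B.up (m + 1) v * B.block m p)) * B.S n := by
        simp only [map_mul, mul_assoc]
        rw [← mul_assoc (B.up (n + 1) b), e4, mul_assoc]
    _ = w * B.up (n + 1) (v * B.up (p + 1) y) * B.S n := by
        rw [e2, ← map_mul, ← mul_assoc b, h1, one_mul]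
    _ = _ := by
        unfold BMWTower.star
        rw [mul_assoc _ (B.S n), e3, map_mul, ← up_add, show n + 1 + (p + 1) = n + p + 1 + 1 by omega]
        simp only [mul_assoc]

theorem D_star_mul_right {n m p : ℕ} {w y v : E} (hw : w ∈ B.W 0 n) (hy : y ∈ B.W 0 m)
    (hv : v ∈ B.W 0 p) : Δ.D (p + (n + m + 1) + 1) (B.star p v (w * B.up (n + 1) y)) =
      Δ.D (p + n + 1) (B.star p v w) * Δ.ι (Δ.ch m y) := by
  have hwy : w * B.up (n + 1) y ∈ B.W 0 (n + m + 1) :=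
    mul_mem (B.W_mono le_rfl (by omega) hw) (B.up_mem' hy _ (by omega) (by omega))
  rw [Δ.D_star_eq hv hwy, Δ.D_star_eq hv hw, Δ.D_mul hw hy, Δ.L_ι hv (B.S_mem p)]

theorem star_zero_one (w : E) : B.star 0 1 w = B.sh w * B.r 0 := by
  show 1 * B.sh w * B.r 0 = _
  rw [one_mul]

theorem D_star_zero_one {n : ℕ} {w : E} (hw : w ∈ B.W 0 n) :
    Δ.D (n + 1) (B.star 0 1 w) = Δ.opA (Δ.D n w) := by
  rw [star_zero_one, Δ.D_sh_mul hw (B.r_mem le_rfl (by omega))]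
  rfl

/-- `(1 ⋆ w) ⋆ v` and `(r₀ w^{↑1}) ⋆ v`. -/
theorem D_star_r_sh {n m : ℕ} {w v : E} (hw : w ∈ B.W 0 n) (hv : v ∈ B.W 0 m) :
    Δ.D (n + 1 + m + 1) (B.star (n + 1) (B.r 0 * B.sh w) v) = Δ.opA (Δ.D (n + m + 1) (B.star n w v)) := by
  rw [← Δ.D_star_conj (B.sh_mem hw) (B.r_mem (by omega) (by omega)) hv, ← star_zero_one]
  have := B.star_assoc 0 n (v := w) 1 ⟨m, hv⟩
  rw [show 0 + n + 1 = n + 1 by omega] at this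
  rw [this, ← Δ.D_star_zero_one (B.star_mem hw hv), show n + m + 1 + 1 = n + 1 + m + 1 by omega]

/-- The word $w\star1$ equals $Y\,w^{\uparrow1}Z$; moving $Z$ around the trace makes it
$r_0w^{\uparrow1}$, the word of $A$ applied to `w`. -/
theorem D_star_one_star {n m : ℕ} {w v : E} (hw : w ∈ B.W 0 n) (hv : v ∈ B.W 0 m) :
    Δ.D (n + 1 + m + 1) (B.star (n + 1) (B.star n w 1) v) =
      Δ.opA (Δ.D (n + m + 1) (B.star n w v)) := by
  have e : B.star n w 1 = B.Y n * B.sh w * B.Z n := by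
    unfold BMWTower.star
    rw [map_one, mul_one, ← B.Y_mul_Z, ← mul_assoc, B.mul_Y hw]
  have hY : B.Y n * B.sh w ∈ B.W 0 (n + 1) := mul_mem (B.Y_mem n) (mem_sh hw)
  rw [e, ← Δ.D_star_conj (B.Z_mem n) hY hv, ← mul_assoc, B.Z_mul_Y, Δ.D_star_r_sh hw hv]

/-- The contraction $k_0$ meets $S_{n+1}=s_0\,\mathrm{sh}(S_n)\,r_0$: it absorbs $s_0$ with the
factor $\mu^{-1}$, and by `k_sh_S_r` the rest becomes the shifted conjugate `κ n`. What remains is a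
word of the form seen by $T$. -/
theorem D_sh_k_star {n p : ℕ} {x y : E} (hx : x ∈ B.W 0 n) (hy : y ∈ B.W 0 p) :
    Δ.D (n + 1 + p + 1) (B.star (n + 1) (B.sh x * B.k 0) y) =
      μ⁻¹ • Δ.opT (Δ.D (n + p + 1) (B.κ n * x * B.up (n + 1) y)) := by
  have hxy : x * B.up (n + 1) y ∈ B.W 0 (n + p + 1) :=
    mul_mem (B.W_mono le_rfl (by omega) hx) (B.up_mem' hy _ (by omega) (by omega))
  have hκ : B.κ n ∈ B.W 0 (n + p + 1) := B.W_mono le_rfl (by omega) (B.κ_mem n)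
  have c1 : B.k 0 * B.up (n + 1 + 1) y = B.up (n + 1 + 1) y * B.k 0 :=
    B.W_comm (a := 0) (b := 1) (by omega) (B.k_mem le_rfl (by omega)) (B.up_mem hy _)
  have e : B.star (n + 1) (B.sh x * B.k 0) y =
      μ⁻¹ • (B.sh (x * B.up (n + 1) y) * (B.k 0 * B.sh (B.κ n))) := by
    unfold BMWTower.star
    rw [B.S_succ', mul_assoc (B.sh x), c1, ← B.k_sh_S_r]
    simp only [map_mul, up_succ, mul_assoc]
    rw [← mul_assoc (B.k 0) (B.s 0), B.pair_zero.ks₁]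
    simp only [smul_mul_assoc, mul_smul_comm]
  rw [e, map_smul, show n + 1 + p + 1 = n + p + 1 + 1 by omega,
    Δ.D_conj (B.sh_mem hxy) (mul_mem (B.k_mem le_rfl (by omega)) (mem_sh hκ)), mul_assoc, ← map_mul,
    mul_assoc, ← Δ.opT_D (mul_mem hκ hxy)]

/-- Left $\star$-factors inherit the operator $T^2$. Apply `D_sh_k_star` to $k_0w^{\uparrow1}$ in
place of $x$; the inner contraction turns the conjugate back into `S n` by `s_sh_κ_k`, with a factor
$\mu$ that cancels $\mu^{-1}$. -/
theorem D_kk_star {n m : ℕ} {w v : E} (hw : w ∈ B.W 0 n) (hv : v ∈ B.W 0 m) :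
    Δ.D (n + 2 + m + 1) (B.star (n + 2) (B.k 0 * B.k 1 * B.sh (B.sh w)) v) =
      Δ.opT (Δ.opT (Δ.D (n + m + 1) (B.star n w v))) := by
  have hx : B.k 0 * B.sh w ∈ B.W 0 (n + 1) := mul_mem (B.k_mem le_rfl (by omega)) (mem_sh hw)
  have hwv : w * B.up (n + 1) v ∈ B.W 0 (n + m + 1) :=
    mul_mem (B.W_mono le_rfl (by omega) hw) (B.up_mem' hv _ (by omega) (by omega))
  have e1 : B.k 0 * B.k 1 * B.sh (B.sh w) = B.k 0 * B.sh (B.k 0 * B.sh w) := by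
    rw [map_mul, sh_k, mul_assoc]
  have e2 : B.κ (n + 1) * (B.k 0 * B.sh w) * B.up (n + 1 + 1) v =
      μ • (B.sh (B.S n) * (B.k 0 * B.sh (w * B.up (n + 1) v))) := by
    rw [B.κ_succ']
    simp only [mul_assoc]
    rw [← mul_assoc (B.r 0), B.pair_zero.rk₁]
    simp only [smul_mul_assoc, mul_smul_comm]
    simp only [← mul_assoc]
    rw [B.s_sh_κ_k, map_mul, up_succ]
    simp only [mul_assoc]
  rw [e1, ← Δ.D_star_conj (n := n + 2) (B.sh_mem hx) (B.k_mem le_rfl (by omega)) hv,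
    Δ.D_sh_k_star hx hv, e2, map_smul, map_smul, smul_smul, inv_mul_cancel₀ (B.pair 0).μ_ne, one_smul,
    show n + 1 + m + 1 = n + m + 1 + 1 by omega,
    Δ.D_conj (B.sh_mem (B.W_mono le_rfl (by omega) (B.S_mem n)))
      (mul_mem (B.k_mem le_rfl (by omega)) (mem_sh hwv)), mul_assoc, ← map_mul, ← Δ.opT_D
      (mul_mem hwv (B.W_mono le_rfl (by omega) (B.S_mem n)))]
  rfl

/-- Letters $s$ travel from the left chain to the right one: $s_kk_{k+1}=r_{k+1}k_kk_{k+1}$, the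
letter $r_{k+1}$ goes around the trace, and $k_{k+1}k_{k+2}r_{k+1}=k_{k+1}s_{k+2}$. -/
theorem D_chain (k l : ℕ) : Δ.D (k + l + 2) (B.c k * B.k k * B.k (k + 1) * B.up (k + 2) (B.c l)) =
    Δ.D (k + l + 2) (B.k 0 * B.k 1 * B.up 2 (B.c (k + l))) := by
  induction k generalizing l with
  | zero => simp [c]
  | succ k ih =>
    rw [show k + 1 + l = k + (l + 1) by omega, ← ih (l + 1), B.c_succ' l, map_mul (B.up _), up_s, zero_add, up_sh,
      ← up_succ]
    have hu : B.up (k + 2 + 1) (B.c l) ∈ B.W (k + 3) (k + l + 3) :=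
      B.up_mem' (B.c_mem l) _ le_rfl (by omega)
    have c1 := B.r_comm (i := k + 1) le_rfl (B.c_mem k)
    have c2 : B.r (k + 1) * B.up (k + 2 + 1) (B.c l) = B.up (k + 2 + 1) (B.c l) * B.r (k + 1) :=
      B.W_comm (a := 0) (b := k + 2) (by omega) (B.r_mem (by omega) (by omega)) hu
    have m1 : B.c k * B.k k * B.k (k + 1) * B.k (k + 2) * B.up (k + 2 + 1) (B.c l) ∈
        B.W 0 (k + (l + 1) + 2) := by
      refine mul_mem (mul_mem (mul_mem (mul_mem (B.W_mono le_rfl (by omega) (B.c_mem k)) ?_) ?_) ?_)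
        (B.W_mono (by omega) (by omega) hu) <;> exact B.k_mem (by omega) (by omega)
    have e1 : B.c (k + 1) * B.k (k + 1) * B.k (k + 1 + 1) * B.up (k + 1 + 2) (B.c l) =
        B.r (k + 1) * (B.c k * B.k k * B.k (k + 1) * B.k (k + 2) * B.up (k + 2 + 1) (B.c l)) := by
      rw [c_succ, mul_assoc (B.c k), s_mul_k]
      simp only [← mul_assoc]
      rw [c1]
    have P : B.k (k + 1) * B.k (k + 2) * B.r (k + 1) = B.k (k + 1) * B.s (k + 2) :=
      (B.pair (k + 1)).symm.kkr
    rw [e1, Δ.D_conj (B.r_mem (by omega) (by omega)) m1, mul_assoc, ← c2]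
    congr 1
    simp only [mul_assoc]
    rw [← mul_assoc (B.k (k + 2)), ← mul_assoc (B.k (k + 1)), ← mul_assoc (B.k (k + 1)), P]
    simp only [mul_assoc]

/-- The point is that the right side depends on `k` and `l` only through their sum, so two chains
commute under $\star$. -/
theorem D_b_star_b (k l : ℕ) : Δ.D (k + 1 + (l + 1) + 1) (B.star (k + 1) (B.b k) (B.b l)) =
    μ⁻¹ • Δ.opT (Δ.D (k + l + 2) (B.k 0 * B.k 1 * B.up 2 (B.c (k + l)))) := by
  have hc := B.c_mem k
  rw [b, ← Δ.D_star_conj (B.sh_mem hc) (B.k_mem le_rfl (by omega)) (B.b_mem l),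
    Δ.D_sh_k_star hc (B.b_mem l), ← Δ.D_chain, B.κ_mul_c, b, map_mul (B.up _), up_k, zero_add, up_sh, ← up_succ,
    ← mul_assoc]
  rfl

/-- The words that `⋆`-commute with `v` after descent. -/
def starComm (m : ℕ) (v : E) (n : ℕ) : Submodule ℂ E where
  carrier := {w | Δ.D (n + m + 1) (B.star n w v) = Δ.D (n + m + 1) (B.star m v w)}
  zero_mem' := by simp [BMWTower.star]
  add_mem' {a b} ha hb := by
    simp only [Set.mem_ofPred_eq, BMWTower.star] at ha hb ⊢
    simp only [map_add, mul_add, add_mul, ha, hb]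
  smul_mem' c x hx := by
    simp only [Set.mem_ofPred_eq, BMWTower.star] at hx ⊢
    simp only [map_smul, smul_mul_assoc, mul_smul_comm, hx]

theorem mem_starComm {m n : ℕ} {v w : E} : w ∈ Δ.starComm m v n ↔
    Δ.D (n + m + 1) (B.star n w v) = Δ.D (n + m + 1) (B.star m v w) := Iff.rfl

/-- Each operation of `trace_induction` acts in the same way on both orders of the product: tails
split off characteristic elements, $r_0$ acts as $A$, $k_0k_1$ as multiplication by $\mu g$. Only
the chains remain to be checked. -/
theorem starComm_of_chain {m : ℕ} {v : E} (hv : v ∈ B.W 0 m) (h : ∀ n, B.b n ∈ Δ.starComm m v (n + 1))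
    (n : ℕ) : ∀ w ∈ B.W 0 n, w ∈ Δ.starComm m v n := by
  have W10 : ∀ {n x}, x ∈ B.W 1 n → x ∈ B.W 0 n := fun h => B.W_mono (Nat.zero_le _) le_rfl h
  -- A right factor enters only through its descendant, by `D_star_eq`. For left factors nothing of
  -- this kind is available yet.
  have right : ∀ {n x y}, x ∈ B.W 0 n → y ∈ B.W 0 n → Δ.D n x = Δ.D n y →
      Δ.D (n + m + 1) (B.star m v x) = Δ.D (n + m + 1) (B.star m v y) := by
    intro n x y hx hy hxy
    rw [show n + m + 1 = m + n + 1 by omega, Δ.D_star_eq hv hx, Δ.D_star_eq hv hy, hxy]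
  refine B.trace_induction (Δ.starComm m v) ?_ ?_ ?_ ?_ ?_ h n
  · rw [mem_starComm, show 0 + m + 1 = m + 0 + 1 by omega]
    have := Δ.D_star_one_star hv (one_mem (B.W 0 0))
    rw [show m + 0 + 1 = m + 1 by omega, Δ.D_star_zero_one hv]
    have e : B.star m v 1 = B.Y m * B.sh v * B.Z m := by
      unfold BMWTower.star
      rw [map_one, mul_one, ← B.Y_mul_Z, ← mul_assoc, B.mul_Y hv]
    rw [e, ← Δ.D_conj (B.Z_mem m) (mul_mem (B.Y_mem m) (mem_sh hv)), ← mul_assoc, B.Z_mul_Y,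
      Δ.opA_D hv]
  · intro n p hp w hw
    have h1 := Δ.D_star_conj hp hw hv
    have h2 := right (mul_mem (W10 hp) hw) (mul_mem hw (W10 hp)) (Δ.D_conj hp hw)
    rw [mem_starComm]
    simp only [BMWTower.star, mul_sub, sub_mul, map_sub] at h1 h2 ⊢
    rw [h1, h2, sub_self, sub_self]
  · intro n p w hw y hy hwv
    rw [mem_starComm] at hwv ⊢
    rw [Δ.D_star_mul_left hw hy hv, hwv, show n + p + 1 + m + 1 = m + (n + p + 1) + 1 by omega,
      Δ.D_star_mul_right hw hy hv, show n + m + 1 = m + n + 1 by omega]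
  · intro n w hw hwv
    rw [mem_starComm] at hwv ⊢
    rw [Δ.D_star_r_sh hw hv, hwv, show n + m + 1 = m + n + 1 by omega, ← Δ.D_star_one_star hv hw]
    have e := B.star_assoc m 0 (v := 1) v ⟨n, hw⟩
    rw [add_zero] at e
    rw [e, show m + 1 + n + 1 = n + 1 + m + 1 by omega]
    refine (right (mul_mem (B.r_mem (by omega) (by omega)) (mem_sh hw)) ?_ ?_).symm
    · rw [star_zero_one]; exact mul_mem (mem_sh hw) (B.r_mem (by omega) (by omega))
    · rw [Δ.D_star_zero_one hw, Δ.opA_D hw]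
  · intro n w hw hwv
    have hkk : B.k 0 * B.k 1 * B.sh (B.sh w) ∈ B.W 0 (n + 2) :=
      mul_mem (mul_mem (B.k_mem (by omega) (by omega)) (B.k_mem (by omega) (by omega)))
        (mem_sh (mem_sh hw))
    have e : Δ.D (n + 2) (B.k 0 * B.k 1 * B.sh (B.sh w)) = Δ.D n w * Δ.ι (μ • Δ.g) := by
      rw [← Δ.opT_opT_D n w hw, Δ.opT_D hw, Δ.opT_D (mul_mem (B.k_mem (by omega) (by omega))
        (mem_sh hw)), map_mul B.sh, sh_k, mul_assoc]
    rw [mem_starComm] at hwv ⊢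
    rw [Δ.D_kk_star hw hv, Δ.opT_opT_D _ _ (B.star_mem hw hv), hwv,
      show n + 2 + m + 1 = m + (n + 2) + 1 by omega, Δ.D_star_eq hv hkk, e, Δ.L_ι hv (B.S_mem m), ← Δ.D_star_eq hv hw,
      show n + m + 1 = m + n + 1 by omega]

/-- Matrix descendants commute under the `⋆`-product. -/
theorem D_star_comm {n m : ℕ} {w v : E} (hw : w ∈ B.W 0 n) (hv : v ∈ B.W 0 m) :
    Δ.D (n + m + 1) (B.star n w v) = Δ.D (n + m + 1) (B.star m v w) := by
  have hbb : ∀ k l, B.b k ∈ Δ.starComm (l + 1) (B.b l) (k + 1) := by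
    intro k l
    rw [mem_starComm, Δ.D_b_star_b, show k + 1 + (l + 1) + 1 = l + 1 + (k + 1) + 1 by omega,
      Δ.D_b_star_b, add_comm k l]
  -- The reduction is used twice: first with a chain as fixed factor, which makes chains commute
  -- with all words, then with an arbitrary fixed factor.
  refine Δ.starComm_of_chain hv (fun k => ?_) n w hw
  have := Δ.starComm_of_chain (B.b_mem k) (fun l => hbb l k) m v hv
  rw [mem_starComm] at this ⊢
  rw [show k + 1 + m + 1 = m + (k + 1) + 1 by omega]
  exact this.symm

end DescentSystem

/-! ### Bilinear maps prescribed on a spanning set -/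

/-- Two bilinear maps on a span agree when they agree on the spanning set. -/
theorem bilinear_ext_span {V W : Type*} [AddCommGroup V] [Module ℂ V] [AddCommGroup W] [Module ℂ W]
    {X : Set V} {P : Submodule ℂ V} (hP : P = Submodule.span ℂ X) {s t : P →ₗ[ℂ] P →ₗ[ℂ] W}
    (h : ∀ x y : P, x.val ∈ X → y.val ∈ X → s x y = t x y) : s = t := by
  subst hP
  refine LinearMap.ext_on (s := ((↑) : Submodule.span ℂ X → V) ⁻¹' X)
    (Submodule.span_span_coe_preimage (R := ℂ)) fun x hx => ?_
  exact LinearMap.ext_on (s := ((↑) : Submodule.span ℂ X → V) ⁻¹' X)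
    (Submodule.span_span_coe_preimage (R := ℂ)) fun y hy => h x y hx hy

/-- A symmetric family of operators extends to a bilinear product. -/
theorem exists_bilinear_of_symm {V I : Type*} [AddCommGroup V] [Module ℂ V] (v : I → V)
    (hv : Submodule.span ℂ (Set.range v) = ⊤) (f : I → V →ₗ[ℂ] V) (hf : ∀ i j, f i (v j) = f j (v i)) :
    ∃ s : V →ₗ[ℂ] V →ₗ[ℂ] V, ∀ i, s (v i) = f i := by
  let p : (I →₀ ℂ) →ₗ[ℂ] V := Finsupp.linearCombination ℂ v
  let q : (I →₀ ℂ) →ₗ[ℂ] (V →ₗ[ℂ] V) := Finsupp.linearCombination ℂ f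
  have hp : Function.Surjective p := by
    rw [← LinearMap.range_eq_top, Finsupp.range_linearCombination, hv]
  have hqp : ∀ a j, q a (v j) = f j (p a) := by
    intro a j
    simp only [q, p, Finsupp.linearCombination_apply, Finsupp.sum, LinearMap.sum_apply,
      LinearMap.smul_apply, map_sum, map_smul, hf _ j]
  -- A linear relation among the `v i` also holds among the operators `f i`, because symmetry lets
  -- each `v j` be tested as `q a (v j) = f j (p a)`.
  have hker : LinearMap.ker p ≤ LinearMap.ker q := by
    intro a ha
    rw [LinearMap.mem_ker] at ha ⊢
    refine LinearMap.ext_on_range hv fun j => ?_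
    rw [hqp, ha, map_zero, LinearMap.zero_apply]
  obtain ⟨g, hg⟩ := p.exists_rightInverse_of_surjective (LinearMap.range_eq_top.2 hp)
  refine ⟨q.comp g, fun i => ?_⟩
  have h1 : g (v i) - Finsupp.single i 1 ∈ LinearMap.ker p := by
    rw [LinearMap.mem_ker, map_sub, sub_eq_zero]
    have := LinearMap.congr_fun hg (v i)
    simp only [LinearMap.comp_apply, LinearMap.id_apply] at this
    rw [this]
    simp [p]
  have h2 := hker h1
  rw [LinearMap.mem_ker, map_sub, sub_eq_zero] at h2
  rw [LinearMap.comp_apply, h2]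
  simp [q]

/-! ### The space of descendants and its ⋆-product -/

namespace DescentSystem

variable {l μ : ℂ} {E : Type*} [Ring E] [Algebra ℂ E] {B : BMWTower l μ E}
  {A : Type*} [Ring A] [Algebra ℂ A] (Δ : DescentSystem B A)

open BMWTower

/-- The characteristic subalgebra, as a linear span. -/
def charSub : Submodule ℂ A :=
  Submodule.span ℂ ({1} ∪ {x | ∃ n, ∃ w ∈ B.W 0 n, x = Δ.ch n w})

theorem one_mem_charSub : (1 : A) ∈ Δ.charSub := Submodule.subset_span (Or.inl rfl)

theorem ch_mem_charSub {n : ℕ} {w : E} (hw : w ∈ B.W 0 n) : Δ.ch n w ∈ Δ.charSub :=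
  Submodule.subset_span (Or.inr ⟨n, w, hw, rfl⟩)

theorem g_mem_charSub : Δ.g ∈ Δ.charSub := by
  obtain ⟨t, ht⟩ := Δ.g_ch
  rw [ht]
  exact Submodule.smul_mem _ _ (Δ.ch_mem_charSub (B.k_mem le_rfl (by omega)))

theorem mul_mem_charSub {a b : A} (ha : a ∈ Δ.charSub) (hb : b ∈ Δ.charSub) : a * b ∈ Δ.charSub := by
  induction ha, hb using Submodule.span_induction₂ with
  | mem_mem x y hx hy =>
    rcases hx with rfl | ⟨n, w, hw, rfl⟩
    · rw [one_mul]; exact Submodule.subset_span hy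
    rcases hy with rfl | ⟨m, v, hv, rfl⟩
    · rw [mul_one]; exact Δ.ch_mem_charSub hw
    rw [← Δ.ch_mul hw hv]
    exact Δ.ch_mem_charSub (mul_mem (B.W_mono le_rfl (by omega) hw)
      (B.up_mem' hv _ (by omega) (by omega)))
  | zero_left => rw [zero_mul]; exact zero_mem _
  | zero_right => rw [mul_zero]; exact zero_mem _
  | add_left _ _ _ _ _ _ h h' => rw [add_mul]; exact add_mem h h'
  | add_right _ _ _ _ _ _ h h' => rw [mul_add]; exact add_mem h h'
  | smul_left _ _ _ _ _ h => rw [smul_mul_assoc]; exact Submodule.smul_mem _ _ h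
  | smul_right _ _ _ _ _ h => rw [mul_smul_comm]; exact Submodule.smul_mem _ _ h

/-- Needed below because the product of two scalar matrices has to be symmetric before the family of
operators can be extended. -/
theorem charSub_comm {a b : A} (ha : a ∈ Δ.charSub) (hb : b ∈ Δ.charSub) : a * b = b * a := by
  induction ha, hb using Submodule.span_induction₂ with
  | mem_mem x y hx hy =>
    rcases hx with rfl | ⟨n, w, hw, rfl⟩
    · rw [one_mul, mul_one]
    rcases hy with rfl | ⟨m, v, hv, rfl⟩
    · rw [one_mul, mul_one]
    exact Δ.ch_comm hw hv
  | zero_left => rw [zero_mul, mul_zero]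
  | zero_right => rw [zero_mul, mul_zero]
  | add_left _ _ _ _ _ _ h h' => rw [add_mul, mul_add, h, h']
  | add_right _ _ _ _ _ _ h h' => rw [add_mul, mul_add, h, h']
  | smul_left _ _ _ _ _ h => rw [smul_mul_assoc, mul_smul_comm, h]
  | smul_right _ _ _ _ _ h => rw [smul_mul_assoc, mul_smul_comm, h]

/-- The spanning set of the space of descendants. -/
def descSet : Set E := {X | ∃ c ∈ Δ.charSub, X = Δ.ι c} ∪ {X | ∃ n, ∃ w ∈ B.W 0 n, X = Δ.D n w}

/-- The space of descendants. -/
def desc : Submodule ℂ E := Submodule.span ℂ Δ.descSet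

theorem ι_mem {c : A} (hc : c ∈ Δ.charSub) : Δ.ι c ∈ Δ.desc := Submodule.subset_span (Or.inl ⟨c, hc, rfl⟩)

theorem D_mem {n : ℕ} {w : E} (hw : w ∈ B.W 0 n) : Δ.D n w ∈ Δ.desc :=
  Submodule.subset_span (Or.inr ⟨n, w, hw, rfl⟩)

theorem one_mem_desc : (1 : E) ∈ Δ.desc := by simpa using Δ.ι_mem Δ.one_mem_charSub

theorem D_mul_ι_mem {n : ℕ} {w : E} (hw : w ∈ B.W 0 n) {c : A} (hc : c ∈ Δ.charSub) :
    Δ.D n w * Δ.ι c ∈ Δ.desc := by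
  have : Δ.charSub ≤ Δ.desc.comap ((LinearMap.mulLeft ℂ (Δ.D n w)).comp Δ.ι.toLinearMap) := by
    refine Submodule.span_le.2 ?_
    rintro x (rfl | ⟨m, y, hy, rfl⟩)
    · simpa using Δ.D_mem hw
    · simp only [SetLike.mem_coe, Submodule.mem_comap, LinearMap.comp_apply, LinearMap.mulLeft_apply,
        AlgHom.toLinearMap_apply]
      rw [← Δ.D_mul hw hy]
      exact Δ.D_mem (mul_mem (B.W_mono le_rfl (by omega) hw) (B.up_mem' hy _ (by omega) (by omega)))
  exact this hc

theorem mul_ι_mem {x : E} (hx : x ∈ Δ.desc) {c : A} (hc : c ∈ Δ.charSub) : x * Δ.ι c ∈ Δ.desc := by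
  have : Δ.desc ≤ Δ.desc.comap (LinearMap.mulRight ℂ (Δ.ι c)) := by
    refine Submodule.span_le.2 ?_
    rintro x (⟨d, hd, rfl⟩ | ⟨n, w, hw, rfl⟩)
    · simp only [SetLike.mem_coe, Submodule.mem_comap, LinearMap.mulRight_apply, ← map_mul]
      exact Δ.ι_mem (Δ.mul_mem_charSub hd hc)
    · exact Δ.D_mul_ι_mem hw hc
  exact this hx

theorem L_S_ι {n : ℕ} {w : E} (hw : w ∈ B.W 0 n) (c : A) :
    Δ.L n w (B.S n) (Δ.ι c) = Δ.D n w * Δ.ι c := by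
  rw [← one_mul (Δ.ι c), Δ.L_ι hw (B.S_mem n), Δ.L_one hw, one_mul]

theorem L_S_mem {n : ℕ} {w x : E} (hw : w ∈ B.W 0 n) (hx : x ∈ Δ.desc) :
    Δ.L n w (B.S n) x ∈ Δ.desc := by
  have : Δ.desc ≤ Δ.desc.comap (Δ.L n w (B.S n)) := by
    refine Submodule.span_le.2 ?_
    rintro x (⟨d, hd, rfl⟩ | ⟨m, v, hv, rfl⟩)
    · rw [SetLike.mem_coe, Submodule.mem_comap, Δ.L_S_ι hw]
      exact Δ.D_mul_ι_mem hw hd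
    · rw [SetLike.mem_coe, Submodule.mem_comap, ← Δ.D_star_eq hw hv]
      exact Δ.D_mem (B.star_mem hw hv)
  exact this hx

/-- Existence of the `⋆`-product, with its operators of multiplication. -/
theorem exists_star : ∃ s : Δ.desc →ₗ[ℂ] Δ.desc →ₗ[ℂ] Δ.desc,
    (∀ n, ∀ w ∈ B.W 0 n, ∀ x y : Δ.desc, x.val = Δ.D n w → (s x y).val = Δ.L n w (B.S n) y.val) ∧
    (∀ c ∈ Δ.charSub, ∀ x y : Δ.desc, x.val = Δ.ι c → (s x y).val = y.val * Δ.ι c) := by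
  let I := Δ.charSub ⊕ (Σ n, B.W 0 n)
  let v : I → Δ.desc := Sum.elim (fun c => ⟨Δ.ι c, Δ.ι_mem c.2⟩)
    (fun w => ⟨Δ.D w.1 w.2, Δ.D_mem w.2.2⟩)
  let f : I → Δ.desc →ₗ[ℂ] Δ.desc := Sum.elim
    (fun c => (LinearMap.mulRight ℂ (Δ.ι c)).restrict fun x hx => Δ.mul_ι_mem hx c.2)
    (fun w => (Δ.L w.1 w.2 (B.S w.1)).restrict fun x hx => Δ.L_S_mem w.2.2 hx)
  have hv : Submodule.span ℂ (Set.range v) = ⊤ := by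
    have h : Submodule.span ℂ (((↑) : Δ.desc → E) ⁻¹' Δ.descSet) = ⊤ :=
      Submodule.span_span_coe_preimage
    rw [← h]
    congr 1
    ext ⟨x, hx⟩
    constructor
    · rintro ⟨c | ⟨n, w⟩, h⟩
      · exact Or.inl ⟨c, c.2, congrArg Subtype.val h.symm⟩
      · exact Or.inr ⟨n, w, w.2, congrArg Subtype.val h.symm⟩
    · rintro (⟨c, hc, h⟩ | ⟨n, w, hw, h⟩)
      · exact ⟨Sum.inl ⟨c, hc⟩, Subtype.ext h.symm⟩
      · exact ⟨Sum.inr ⟨n, w, hw⟩, Subtype.ext h.symm⟩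
  -- The mixed cases are `L_S_ι`; the case of two words is `D_star_comm`.
  have hf : ∀ i j, f i (v j) = f j (v i) := by
    rintro (⟨c, hc⟩ | ⟨n, w, hw⟩) (⟨d, hd⟩ | ⟨m, u, hu⟩) <;> apply Subtype.ext
    · show Δ.ι d * Δ.ι c = Δ.ι c * Δ.ι d
      rw [← map_mul, ← map_mul, Δ.charSub_comm hc hd]
    · exact (Δ.L_S_ι hu c).symm
    · exact Δ.L_S_ι hw d
    · show Δ.L n w (B.S n) (Δ.D m u) = Δ.L m u (B.S m) (Δ.D n w)
      rw [← Δ.D_star_eq hw hu, ← Δ.D_star_eq hu hw, Δ.D_star_comm hw hu,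
        show n + m + 1 = m + n + 1 by omega]
  obtain ⟨s, hs⟩ := exists_bilinear_of_symm v hv f hf
  refine ⟨s, fun n w hw x y hx => ?_, fun c hc x y hx => ?_⟩
  · obtain rfl : x = v (Sum.inr ⟨n, w, hw⟩) := Subtype.ext hx
    rw [hs]; rfl
  · obtain rfl : x = v (Sum.inl ⟨c, hc⟩) := Subtype.ext hx
    rw [hs]; rfl

section Star

variable {Δ} {s : Δ.desc →ₗ[ℂ] Δ.desc →ₗ[ℂ] Δ.desc}
  (hD : ∀ n, ∀ w ∈ B.W 0 n, ∀ x y : Δ.desc, x.val = Δ.D n w → (s x y).val = Δ.L n w (B.S n) y.val)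
  (hι : ∀ c ∈ Δ.charSub, ∀ x y : Δ.desc, x.val = Δ.ι c → (s x y).val = y.val * Δ.ι c)

include hD hι

theorem star_comm_of : ∀ x y, s x y = s y x := by
  have : s = s.flip := by
    refine bilinear_ext_span (P := Δ.desc) (X := Δ.descSet) rfl ?_
    rintro x y (⟨c, hc, hx⟩ | ⟨n, w, hw, hx⟩) (⟨d, hd, hy⟩ | ⟨m, u, hu, hy⟩) <;>
      rw [LinearMap.flip_apply] <;> apply Subtype.ext
    · rw [hι c hc _ _ hx, hι d hd _ _ hy, hx, hy, ← map_mul, ← map_mul, Δ.charSub_comm hc hd]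
    · rw [hι c hc _ _ hx, hD m u hu _ _ hy, hx, hy, Δ.L_S_ι hu]
    · rw [hι d hd _ _ hy, hD n w hw _ _ hx, hx, hy, Δ.L_S_ι hw]
    · rw [hD n w hw _ _ hx, hD m u hu _ _ hy, hx, hy, ← Δ.D_star_eq hw hu, ← Δ.D_star_eq hu hw,
        Δ.D_star_comm hw hu, show n + m + 1 = m + n + 1 by omega]
  intro x y
  exact LinearMap.congr_fun (LinearMap.congr_fun this x) y

/-- For a fixed last factor the claim is symmetry of a bilinear map in the first two, so these may
be taken in the spanning set, where multiplication is given by explicit operators. -/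
theorem star_left_comm_of (z : Δ.desc) : ∀ x y, s x (s y z) = s y (s x z) := by
  obtain ⟨z, hz⟩ := z
  have : (s.compl₁₂ LinearMap.id (s.flip ⟨z, hz⟩)) = (s.compl₁₂ LinearMap.id (s.flip ⟨z, hz⟩)).flip := by
    refine bilinear_ext_span (P := Δ.desc) (X := Δ.descSet) rfl ?_
    have hDι : ∀ {n w} (_ : w ∈ B.W 0 n) (c : A),
        Δ.L n w (B.S n) (z * Δ.ι c) = Δ.L n w (B.S n) z * Δ.ι c :=
      fun hw c => Δ.L_ι hw (B.S_mem _) _ _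
    rintro x y (⟨c, hc, hx⟩ | ⟨n, w, hw, hx⟩) (⟨d, hd, hy⟩ | ⟨m, u, hu, hy⟩) <;>
      rw [LinearMap.flip_apply, LinearMap.compl₁₂_apply, LinearMap.compl₁₂_apply, LinearMap.id_apply,
        LinearMap.id_apply, LinearMap.flip_apply, LinearMap.flip_apply] <;> apply Subtype.ext
    · rw [hι c hc _ _ hx, hι d hd _ _ hy, hι d hd _ _ hy, hι c hc _ _ hx, mul_assoc, mul_assoc,
        ← map_mul, ← map_mul, Δ.charSub_comm hc hd]
    · rw [hι c hc _ _ hx, hD m u hu _ _ hy, hD m u hu _ _ hy, hι c hc _ _ hx, hDι hu]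
    · rw [hι d hd _ _ hy, hD n w hw _ _ hx, hD n w hw _ _ hx, hι d hd _ _ hy, hDι hw]
    · rw [hD n w hw _ _ hx, hD m u hu _ _ hy, hD m u hu _ _ hy, hD n w hw _ _ hx]
      simp only
      -- On a third descendant $v$ the two compositions are $(w\star u)\star v$ and $(u\star w)\star
      -- v$. Commuting $v$ to the left makes each depend only on the descendant of $w\star u$ or
      -- $u\star w$, and these agree.
      have : Δ.desc ≤ LinearMap.eqLocus ((Δ.L n w (B.S n)).comp (Δ.L m u (B.S m)))
          ((Δ.L m u (B.S m)).comp (Δ.L n w (B.S n))) := by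
        refine Submodule.span_le.2 ?_
        have e : Δ.D (n + m + 1) (B.star n w u) = Δ.D (m + n + 1) (B.star m u w) := by
          rw [Δ.D_star_comm hw hu, show n + m + 1 = m + n + 1 by omega]
        rintro x (⟨d, hd, rfl⟩ | ⟨p, v, hv, rfl⟩)
        · show Δ.L n w (B.S n) (Δ.L m u (B.S m) (Δ.ι d)) = Δ.L m u (B.S m) (Δ.L n w (B.S n) (Δ.ι d))
          rw [Δ.L_S_ι hw, Δ.L_S_ι hu, Δ.L_ι hw (B.S_mem n), Δ.L_ι hu (B.S_mem m), ← Δ.D_star_eq hw hu, ← Δ.D_star_eq hu hw, e]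
        · show Δ.L n w (B.S n) (Δ.L m u (B.S m) (Δ.D p v)) = Δ.L m u (B.S m) (Δ.L n w (B.S n) (Δ.D p v))
          rw [← Δ.D_star_eq hw hv, ← Δ.D_star_eq hu hv, ← Δ.D_star_eq hw (B.star_mem hu hv),
            ← Δ.D_star_eq hu (B.star_mem hw hv), ← B.star_assoc _ _ _ ⟨p, hv⟩,
            ← B.star_assoc _ _ _ ⟨p, hv⟩, show n + (m + p + 1) + 1 = (n + m + 1) + p + 1 by omega,
            show m + (n + p + 1) + 1 = (m + n + 1) + p + 1 by omega, 
            Δ.D_star_comm (B.star_mem hw hu) hv, Δ.D_star_comm (B.star_mem hu hw) hv,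
            show n + m + 1 + p + 1 = p + (n + m + 1) + 1 by omega,
            show m + n + 1 + p + 1 = p + (m + n + 1) + 1 by omega,
            Δ.D_star_eq hv (B.star_mem hw hu), Δ.D_star_eq hv (B.star_mem hu hw), e]
      exact this hz
  intro x y
  exact LinearMap.congr_fun (LinearMap.congr_fun this x) y

/-- Commutativity turns associativity into the statement that left multiplications commute. -/
theorem star_assoc_of (x y z : Δ.desc) : s (s x y) z = s x (s y z) := by
  rw [star_comm_of hD hι _ z, star_left_comm_of hD hι, star_comm_of hD hι z y]

end Star

/-! ### Spanning by ⋆-powers and their transposed images -/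

/-- The words whose descendants are the `⋆`-powers of `M`. -/
def powWord (B : BMWTower l μ E) : ℕ → E
  | 0 => 1
  | n + 1 => B.r 0 * B.sh (powWord B n)

theorem powWord_mem (n : ℕ) : powWord B n ∈ B.W 0 n := by
  induction n with
  | zero => exact one_mem _
  | succ n ih => exact mul_mem (B.r_mem (by omega) (by omega)) (mem_sh ih)

/-- The `⋆`-powers of `M`. -/
def pow : ℕ → E
  | 0 => 1
  | n + 1 => Δ.opA (pow n)

theorem pow_succ_eq (n : ℕ) : Δ.pow (n + 1) = Δ.D n (powWord B n) := by
  induction n with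
  | zero => exact Δ.opA_one
  | succ n ih =>
    show Δ.opA (Δ.pow (n + 1)) = _
    rw [ih, Δ.opA_D (powWord_mem n)]; rfl

/-- The module spanned by the `⋆`-powers and their transposition-type images. -/
def powSpan : Submodule ℂ E := Submodule.span ℂ {X | ∃ n, ∃ c ∈ Δ.charSub,
  X = Δ.pow n * Δ.ι c ∨ X = Δ.opT (Δ.pow (n + 2)) * Δ.ι c}

theorem pow_mul_mem (n : ℕ) {c : A} (hc : c ∈ Δ.charSub) : Δ.pow n * Δ.ι c ∈ Δ.powSpan :=
  Submodule.subset_span ⟨n, c, hc, Or.inl rfl⟩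

/-- The exponents zero and one give nothing new: $T(I)=\mu M$ and $T(M)=Ig$. -/
theorem opT_pow_mul_mem (n : ℕ) {c : A} (hc : c ∈ Δ.charSub) :
    Δ.opT (Δ.pow n) * Δ.ι c ∈ Δ.powSpan := by
  rcases n with _ | _ | n
  · show Δ.opT 1 * _ ∈ _
    rw [Δ.opT_one, ← Δ.opA_one, smul_mul_assoc]
    exact Submodule.smul_mem _ _ (Δ.pow_mul_mem 1 hc)
  · show Δ.opT (Δ.opA 1) * _ ∈ _
    rw [Δ.opA_one, Δ.opT_M, ← map_mul]
    simpa [pow] using Δ.pow_mul_mem 0 (Δ.mul_mem_charSub Δ.g_mem_charSub hc)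
  · exact Submodule.subset_span ⟨n, c, hc, Or.inr rfl⟩

/-- On powers this raises the exponent. On $T A^{n+2}I$ the formula `opA_opT_opA` gives $T
A^{n+1}I$, $M$ and $A^{n+2}I$ with characteristic coefficients. -/
theorem opA_mem_powSpan {x : E} (hx : x ∈ Δ.powSpan) : Δ.opA x ∈ Δ.powSpan := by
  have : Δ.powSpan ≤ Δ.powSpan.comap Δ.opA := by
    refine Submodule.span_le.2 ?_
    rintro x ⟨n, c, hc, rfl | rfl⟩
    · rw [SetLike.mem_coe, Submodule.mem_comap, Δ.opA_ι]
      exact Δ.pow_mul_mem (n + 1) hc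
    · rw [SetLike.mem_coe, Submodule.mem_comap, Δ.opA_ι]
      have hy := powWord_mem (B := B) n
      have hg := Submodule.smul_mem _ μ Δ.g_mem_charSub
      have e : Δ.opA (Δ.opT (Δ.pow (n + 2))) = Δ.opT (Δ.pow (n + 1)) * Δ.ι (μ • Δ.g)
          + l • (Δ.pow 1 * Δ.ι (Δ.g * Δ.ch n (powWord B n))) - l • (Δ.pow (n + 2) * Δ.ι (μ • Δ.g)) := by
        have := Δ.opA_opT_opA hy
        rw [← Δ.pow_succ_eq, ← Δ.opA_one] at this
        exact this
      rw [e, sub_mul, add_mul, smul_mul_assoc, smul_mul_assoc, mul_assoc, mul_assoc, mul_assoc, ← map_mul,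
        ← map_mul]
      refine sub_mem (add_mem (Δ.opT_pow_mul_mem _ (Δ.mul_mem_charSub hg hc)) (Submodule.smul_mem _ _ ?_))
        (Submodule.smul_mem _ _ (Δ.pow_mul_mem _ (Δ.mul_mem_charSub hg hc)))
      exact Δ.pow_mul_mem _ (Δ.mul_mem_charSub (Δ.mul_mem_charSub Δ.g_mem_charSub (Δ.ch_mem_charSub hy)) hc)
  exact this hx

theorem opT_mem_powSpan {x : E} (hx : x ∈ Δ.powSpan) : Δ.opT x ∈ Δ.powSpan := by
  have : Δ.powSpan ≤ Δ.powSpan.comap Δ.opT := by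
    refine Submodule.span_le.2 ?_
    rintro x ⟨n, c, hc, rfl | rfl⟩
    · rw [SetLike.mem_coe, Submodule.mem_comap, Δ.opT_ι]
      exact Δ.opT_pow_mul_mem n hc
    · rw [SetLike.mem_coe, Submodule.mem_comap, Δ.opT_ι, Δ.pow_succ_eq, Δ.opT_opT_D _ _ (powWord_mem _),
        ← Δ.pow_succ_eq, mul_assoc, ← map_mul]
      exact Δ.pow_mul_mem _ (Δ.mul_mem_charSub (Submodule.smul_mem _ μ Δ.g_mem_charSub) hc)
  exact this hx

/-- The three cases of `D_induction` are $M$ times a coefficient, $A$ and $T$, and the span is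
stable under the two maps. -/
theorem D_mem_powSpan (n : ℕ) : ∀ w ∈ B.W 0 n, Δ.D n w ∈ Δ.powSpan := by
  have hM : ∀ {c}, c ∈ Δ.charSub → Δ.D 0 1 * Δ.ι c ∈ Δ.powSpan := by
    intro c hc
    rw [← Δ.opA_one]
    exact Δ.pow_mul_mem 1 hc
  induction n with
  | zero =>
    intro w hw
    obtain ⟨c, rfl⟩ := B.W_self 0 hw
    rw [map_smul]
    refine Submodule.smul_mem _ _ ?_
    simpa using hM Δ.one_mem_charSub
  | succ n ih =>
    exact Δ.D_induction (fun y hy => hM (Δ.ch_mem_charSub hy))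
      (fun y hy => Δ.opA_mem_powSpan (ih y hy)) (fun y hy => Δ.opT_mem_powSpan (ih y hy))

theorem pow_mem (n : ℕ) : Δ.pow n ∈ Δ.desc := by
  rcases n with _ | n
  · exact Δ.one_mem_desc
  · rw [Δ.pow_succ_eq]
    exact Δ.D_mem (powWord_mem n)

theorem desc_eq_powSpan : Δ.desc = Δ.powSpan := by
  apply le_antisymm
  · refine Submodule.span_le.2 ?_
    rintro x (⟨c, hc, rfl⟩ | ⟨n, w, hw, rfl⟩)
    · simpa [pow] using Δ.pow_mul_mem 0 hc
    · exact Δ.D_mem_powSpan n w hw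
  · refine Submodule.span_le.2 ?_
    rintro x ⟨n, c, hc, rfl | rfl⟩
    · exact Δ.mul_ι_mem (Δ.pow_mem n) hc
    · refine Δ.mul_ι_mem ?_ hc
      rw [Δ.pow_succ_eq, Δ.opT_D (powWord_mem _)]
      exact Δ.D_mem (mul_mem (B.k_mem (by omega) (by omega)) (mem_sh (powWord_mem _)))

end DescentSystem

/-! ### R-matrices of BMW type satisfy the BMW relations -/

theorem opAt_add {N n : ℕ} (X Y : TensorOp N 2 ℂ) (m : Fin n) : opAt (X + Y) m = opAt X m + opAt Y m := by
  ext i j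
  simp only [opAt, place, Matrix.of_apply, Matrix.add_apply]
  split_ifs <;> simp

theorem opAt_smul {N n : ℕ} (c : ℂ) (X : TensorOp N 2 ℂ) (m : Fin n) : opAt (c • X) m = c • opAt X m := by
  ext i j
  simp only [opAt, place, Matrix.of_apply, Matrix.smul_apply]
  split_ifs <;> simp

theorem opAt_sub {N n : ℕ} (X Y : TensorOp N 2 ℂ) (m : Fin n) : opAt (X - Y) m = opAt X m - opAt Y m := by
  ext i j
  simp only [opAt, place, Matrix.of_apply, Matrix.sub_apply]
  split_ifs <;> simp

theorem RMatrix.op_mul_inv {N : ℕ} (R : RMatrix N) : R.op * R.inv = 1 := R.toUnits.mul_inv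

theorem RMatrix.inv_mul_op {N : ℕ} (R : RMatrix N) : R.inv * R.op = 1 := R.toUnits.inv_mul

namespace IsBMWType

variable {N : ℕ} {R : RMatrix N} {q μ : ℂ} (h : IsBMWType R q μ)

include h

theorem l_ne : q - q⁻¹ ≠ 0 := by
  have h0 := h.q_ne_zero
  intro e
  have e2 : q * q = 1 := by
    have := congrArg (fun x => q * x) e
    simp only [mul_sub, mul_inv_cancel₀ h0, mul_zero] at this
    exact sub_eq_zero.1 this
  rcases mul_self_eq_one_iff.1 e2 with e3 | e3
  exacts [h.q_ne_one e3, h.q_ne_neg_one e3]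

theorem cubic : (q • 1 - R.op) * (q⁻¹ • 1 + R.op) * (R.op - μ • 1) = 0 := by
  have e := minpoly.aeval ℂ R.op
  rw [h.minpoly_eq] at e
  simp only [map_mul, map_sub, map_add, Polynomial.aeval_X, Polynomial.aeval_C,
    Algebra.algebraMap_eq_smul_one] at e
  have : (q • 1 - R.op) * (q⁻¹ • 1 + R.op) * (R.op - μ • 1) =
      -((R.op - q • 1) * (R.op + q⁻¹ • 1) * (R.op - μ • 1)) := by
    rw [← neg_sub (R.op) (q • 1), add_comm (q⁻¹ • 1) R.op, neg_mul, neg_mul]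
  rw [this, e, neg_zero]

theorem K_mul_R : bmwK R q μ * R.op = μ • bmwK R q μ := by
  have e := h.cubic
  rw [mul_sub, sub_eq_zero, mul_smul_comm, mul_one] at e
  rw [bmwK, smul_mul_assoc, e, smul_comm]

theorem R_mul_K : R.op * bmwK R q μ = μ • bmwK R q μ := by
  rw [← h.K_mul_R, bmwK, mul_smul_comm, smul_mul_assoc]
  congr 1
  simp only [sub_mul, mul_add, mul_sub, add_mul, smul_mul_assoc, mul_smul_comm, one_mul, mul_one, mul_assoc]

/-- Multiply the right side by $R$: since $RK=\mu K$, the last term becomes the quadratic expression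
that defines $K$, and everything cancels except $1$. -/
theorem skein : R.inv = R.op - (q - q⁻¹) • 1 + (q - q⁻¹) • bmwK R q μ := by
  have hK : (q - q⁻¹) • (μ • bmwK R q μ) = (q • 1 - R.op) * (q⁻¹ • 1 + R.op) := by
    rw [bmwK, smul_smul, smul_smul]
    rw [show (q - q⁻¹) * μ * (μ⁻¹ * (q - q⁻¹)⁻¹) = 1 by
      rw [mul_assoc, mul_inv_cancel_left₀ h.μ_ne_zero, mul_inv_cancel₀ h.l_ne]]
    exact one_smul _ _
  have e : R.op * (R.op - (q - q⁻¹) • 1 + (q - q⁻¹) • bmwK R q μ) = 1 := by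
    rw [mul_add, mul_smul_comm, h.R_mul_K, hK]
    simp only [sub_mul, mul_add, mul_sub, smul_mul_assoc, mul_smul_comm, one_mul, mul_one, sub_smul,
      smul_sub]
    rw [smul_smul q⁻¹ q, inv_mul_cancel₀ h.q_ne_zero, one_smul]
    abel
  calc R.inv = R.inv * (R.op * (R.op - (q - q⁻¹) • 1 + (q - q⁻¹) • bmwK R q μ)) := by rw [e, mul_one]
    _ = _ := by rw [← mul_assoc, R.inv_mul_op, one_mul]

/-- If $K$ vanished, $R$ would satisfy a quadratic equation, against the degree of its minimal
polynomial. -/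
theorem K_ne_zero : bmwK R q μ ≠ 0 := by
  intro e
  have e1 : (q • 1 - R.op) * (q⁻¹ • 1 + R.op) = 0 := by
    rw [bmwK, smul_eq_zero] at e
    exact e.resolve_left (mul_ne_zero (inv_ne_zero h.μ_ne_zero) (inv_ne_zero h.l_ne))
  let p : Polynomial ℂ := (Polynomial.X - Polynomial.C q) * (Polynomial.X + Polynomial.C q⁻¹)
  have hp : p ≠ 0 := mul_ne_zero (Polynomial.X_sub_C_ne_zero _) (Polynomial.X_add_C_ne_zero _)
  have hroot : Polynomial.aeval R.op p = 0 := by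
    simp only [p, map_mul, map_sub, map_add, Polynomial.aeval_X, Polynomial.aeval_C,
      Algebra.algebraMap_eq_smul_one]
    rw [← neg_sub (q • 1) R.op, add_comm R.op, neg_mul, e1, neg_zero]
  have hd := minpoly.degree_le_of_ne_zero ℂ R.op hp hroot
  have hm : minpoly ℂ R.op = p * (Polynomial.X - Polynomial.C μ) := h.minpoly_eq
  rw [hm, Polynomial.degree_mul, Polynomial.degree_X_sub_C] at hd
  have : p.degree = (p.natDegree : WithBot ℕ) := Polynomial.degree_eq_natDegree hp
  rw [this] at hd
  have hd' : p.natDegree + 1 ≤ p.natDegree := by exact_mod_cast hd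
  omega

/-- The relations of the Birman-Murakami-Wenzl algebra on three factors. -/
theorem pair : BMWPair (q - q⁻¹) μ (opAt (n := 2) R.op 0) (opAt R.inv 0) (opAt (bmwK R q μ) 0)
    (opAt R.op 1) (opAt R.inv 1) (opAt (bmwK R q μ) 1) where
  μ_ne := h.μ_ne_zero
  l_ne := h.l_ne
  rs₁ := by rw [StrandSystem.opAt_mul, R.op_mul_inv, StrandSystem.opAt_one]
  sr₁ := by rw [StrandSystem.opAt_mul, R.inv_mul_op, StrandSystem.opAt_one]
  rs₂ := by rw [StrandSystem.opAt_mul, R.op_mul_inv, StrandSystem.opAt_one]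
  sr₂ := by rw [StrandSystem.opAt_mul, R.inv_mul_op, StrandSystem.opAt_one]
  braid := R.ybe
  skein₁ := by
    rw [h.skein, opAt_add, opAt_sub, opAt_smul, opAt_smul, StrandSystem.opAt_one]
  skein₂ := by
    rw [h.skein, opAt_add, opAt_sub, opAt_smul, opAt_smul, StrandSystem.opAt_one]
  rk₁ := by rw [StrandSystem.opAt_mul, h.R_mul_K, opAt_smul]
  kr₁ := by rw [StrandSystem.opAt_mul, h.K_mul_R, opAt_smul]
  rk₂ := by rw [StrandSystem.opAt_mul, h.R_mul_K, opAt_smul]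
  kr₂ := by rw [StrandSystem.opAt_mul, h.K_mul_R, opAt_smul]
  kk_r := h.K_R
  kk_s := h.K_R_inv
  kkk := h.K_K_K

end IsBMWType

/-! ### Rank one of the contraction -/

section RankOne

variable {N : ℕ} {K R Ψ : TensorOp N 2 ℂ} {κ : ℂ}

/-- The matrix of a row of `K`. -/
def rowMat (K : TensorOp N 2 ℂ) (s : Fin 2 → Fin N) : Matrix (Fin N) (Fin N) ℂ :=
  Matrix.of fun c d => K s ![c, d]

/-- The matrix of a column of `K`. -/
def colMat (K : TensorOp N 2 ℂ) (t : Fin 2 → Fin N) : Matrix (Fin N) (Fin N) ℂ :=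
  Matrix.of fun c d => K ![c, d] t

theorem fin_two_eta (s : Fin 2 → Fin N) : ![s 0, s 1] = s := by
  ext i; fin_cases i <;> rfl

theorem permOp_apply (a b c d : Fin N) :
    permOp N ![a, b] ![c, d] = if a = d ∧ b = c then 1 else 0 := rfl

theorem opAt_zero_one_apply (X Y : TensorOp N 2 ℂ) (a b x c d y : Fin N) :
    (opAt (n := 2) X 0 * opAt Y 1 : TensorOp N 3 ℂ) ![a, b, x] ![c, d, y] =
      ∑ e, X ![a, b] ![c, e] * Y ![e, x] ![d, y] := by
  rw [Matrix.mul_apply, StrandSystem.sum_fin_three]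
  simp only [StrandSystem.opAt_zero_three, StrandSystem.opAt_one_three, mul_ite, ite_mul, mul_zero,
    zero_mul]
  rw [Finset.sum_eq_single c (fun z _ hz => by simp [hz]) (by simp)]
  simp

theorem opAt_one_zero_apply (X Y : TensorOp N 2 ℂ) (x a b y c d : Fin N) :
    (opAt (n := 2) X 1 * opAt Y 0 : TensorOp N 3 ℂ) ![x, a, b] ![y, c, d] =
      ∑ e, X ![a, b] ![e, d] * Y ![x, e] ![y, c] := by
  rw [Matrix.mul_apply, StrandSystem.sum_fin_three]
  simp only [StrandSystem.opAt_zero_three, StrandSystem.opAt_one_three, mul_ite, ite_mul, mul_zero,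
    zero_mul, Finset.sum_ite_eq', Finset.mem_univ, if_true]
  rw [Finset.sum_eq_single x (fun z _ hz => by simp [Ne.symm hz]) (by simp)]
  simp

theorem opAt_010_apply (X Y Z : TensorOp N 2 ℂ) (a b x a' b' y : Fin N) :
    (opAt (n := 2) X 0 * opAt Y 1 * opAt Z 0 : TensorOp N 3 ℂ) ![a, b, x] ![a', b', y] =
      ∑ c, ∑ d, ∑ e, X ![a, b] ![c, e] * Y ![e, x] ![d, y] * Z ![c, d] ![a', b'] := by
  rw [Matrix.mul_apply, StrandSystem.sum_fin_three]
  simp only [StrandSystem.opAt_zero_three, mul_ite, mul_zero, Finset.sum_ite_eq', Finset.mem_univ,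
    if_true]
  refine Finset.sum_congr rfl fun c _ => Finset.sum_congr rfl fun d _ => ?_
  refine (congrArg (· * _) (opAt_zero_one_apply X Y a b x c d y)).trans ?_
  exact Finset.sum_mul _ _ _

theorem opAt_101_apply (X Y Z : TensorOp N 2 ℂ) (a b x a' b' y : Fin N) :
    (opAt (n := 2) X 1 * opAt Y 0 * opAt Z 1 : TensorOp N 3 ℂ) ![x, a, b] ![y, a', b'] =
      ∑ d, ∑ c, ∑ e, X ![a, b] ![e, c] * Y ![x, e] ![y, d] * Z ![d, c] ![a', b'] := by
  rw [Matrix.mul_apply, StrandSystem.sum_fin_three]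
  simp only [StrandSystem.opAt_one_three, mul_ite, mul_zero]
  rw [Finset.sum_eq_single y (fun z _ hz => by simp [hz]) (by simp)]
  simp only [if_true]
  refine Finset.sum_congr rfl fun d _ => Finset.sum_congr rfl fun c _ => ?_
  refine (congrArg (· * _) (opAt_one_zero_apply X Y x a b y d c)).trans ?_
  exact Finset.sum_mul _ _ _

/-- In coordinates $K_1R_2K_1=\kappa K_1$ is a sum over rows and columns of $K$ with one entry of
$R$ between them. Contraction with $\Psi$ removes $R$ on the left and leaves the partial trace of
$\Psi$ on the right. -/
theorem rowMat_transpose_mul (h : IsSkewInverse R Ψ)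
    (h1 : opAt (n := 2) K 0 * opAt R 1 * opAt K 0 = κ • opAt K 0) (s t : Fin 2 → Fin N) :
    (rowMat K s)ᵀ * colMat K t = (κ * K s t) • (StrandSystem.ptr₁ Ψ)ᵀ := by
  have entry : ∀ x y, ∑ c, ∑ d, ∑ e, K s ![c, e] * R ![e, x] ![d, y] * K ![c, d] t =
      if x = y then κ * K s t else 0 := by
    intro x y
    have := congrFun (congrFun h1 ![s 0, s 1, x]) ![t 0, t 1, y]
    rw [opAt_010_apply, Matrix.smul_apply, StrandSystem.opAt_zero_three, smul_eq_mul, mul_ite, mul_zero]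
      at this
    simpa only [fin_two_eta] using this
  have hskew : ∀ a b c d : Fin N, ∑ x, ∑ y, R ![a, x] ![c, y] * Ψ ![y, b] ![x, d] =
      if a = d ∧ b = c then 1 else 0 := by
    intro a b c d
    have := congrFun (congrFun h.1 ![a, b]) ![c, d]
    rwa [StrandSystem.trMid_mul_apply, permOp_apply] at this
  ext e' e
  have key : ∑ x, ∑ y, (∑ c, ∑ d, ∑ f, K s ![c, f] * R ![f, x] ![d, y] * K ![c, d] t) *
      Ψ ![y, e] ![x, e'] = ∑ x, ∑ y, (if x = y then κ * K s t else 0) * Ψ ![y, e] ![x, e'] := by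
    simp only [entry]
  have lhs : ∑ x, ∑ y, (∑ c, ∑ d, ∑ f, K s ![c, f] * R ![f, x] ![d, y] * K ![c, d] t) *
      Ψ ![y, e] ![x, e'] = ∑ c, ∑ d, ∑ f, K s ![c, f] * K ![c, d] t *
        ∑ x, ∑ y, R ![f, x] ![d, y] * Ψ ![y, e] ![x, e'] := by
    simp only [Finset.sum_mul, Finset.mul_sum]
    rw [Finset.sum_congr rfl fun x _ => Finset.sum_comm, Finset.sum_comm]
    refine Finset.sum_congr rfl fun c _ => ?_
    rw [Finset.sum_congr rfl fun x _ => Finset.sum_comm, Finset.sum_comm]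
    refine Finset.sum_congr rfl fun d _ => ?_
    rw [Finset.sum_congr rfl fun x _ => Finset.sum_comm, Finset.sum_comm]
    refine Finset.sum_congr rfl fun f _ => Finset.sum_congr rfl fun x _ =>
      Finset.sum_congr rfl fun y _ => by ring
  rw [lhs] at key
  simp only [hskew, ite_mul, zero_mul, Finset.sum_ite_eq, Finset.mem_univ, if_true, ite_and, mul_ite,
    mul_one, mul_zero, Finset.sum_ite_eq'] at key
  rw [Matrix.mul_apply, Matrix.smul_apply]
  simp only [Matrix.transpose_apply, rowMat, colMat, Matrix.of_apply, StrandSystem.ptr₁, smul_eq_mul,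
    Finset.mul_sum]
  exact key

/-- The mirror image, with $K_2R_1K_2$ and the partial trace of $\Psi$ over the other factor, for
the case that $D$ rather than $C$ is known to be invertible. -/
theorem rowMat_mul_transpose (h : IsSkewInverse R Ψ)
    (h1 : opAt (n := 2) K 1 * opAt R 0 * opAt K 1 = κ • opAt K 1) (s t : Fin 2 → Fin N) :
    rowMat K s * (colMat K t)ᵀ = (κ * K s t) • (StrandSystem.ptr₂ Ψ)ᵀ := by
  have entry : ∀ x y, ∑ d, ∑ c, ∑ e, K s ![e, c] * R ![x, e] ![y, d] * K ![d, c] t =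
      if x = y then κ * K s t else 0 := by
    intro x y
    have := congrFun (congrFun h1 ![x, s 0, s 1]) ![y, t 0, t 1]
    rw [opAt_101_apply, Matrix.smul_apply, StrandSystem.opAt_one_three, smul_eq_mul, mul_ite, mul_zero]
      at this
    simpa only [fin_two_eta] using this
  have hskew : ∀ a b c d : Fin N, ∑ y, ∑ x, Ψ ![a, y] ![c, x] * R ![x, b] ![y, d] =
      if a = d ∧ b = c then 1 else 0 := by
    intro a b c d
    have := congrFun (congrFun h.2 ![a, b]) ![c, d]
    rwa [StrandSystem.trMid_mul_apply, permOp_apply] at this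
  ext e' e
  have key : ∑ y, ∑ x, Ψ ![e, y] ![e', x] *
      (∑ d, ∑ c, ∑ f, K s ![f, c] * R ![x, f] ![y, d] * K ![d, c] t) =
        ∑ y, ∑ x, Ψ ![e, y] ![e', x] * (if x = y then κ * K s t else 0) := by
    simp only [entry]
  have lhs : ∑ y, ∑ x, Ψ ![e, y] ![e', x] *
      (∑ d, ∑ c, ∑ f, K s ![f, c] * R ![x, f] ![y, d] * K ![d, c] t) =
        ∑ d, ∑ c, ∑ f, K s ![f, c] * K ![d, c] t *
          ∑ y, ∑ x, Ψ ![e, y] ![e', x] * R ![x, f] ![y, d] := by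
    simp only [Finset.mul_sum]
    rw [Finset.sum_congr rfl fun x _ => Finset.sum_comm, Finset.sum_comm]
    refine Finset.sum_congr rfl fun c _ => ?_
    rw [Finset.sum_congr rfl fun x _ => Finset.sum_comm, Finset.sum_comm]
    refine Finset.sum_congr rfl fun d _ => ?_
    rw [Finset.sum_congr rfl fun x _ => Finset.sum_comm, Finset.sum_comm]
    refine Finset.sum_congr rfl fun f _ => Finset.sum_congr rfl fun x _ =>
      Finset.sum_congr rfl fun y _ => by ring
  rw [lhs] at key
  simp only [hskew, ite_and, mul_ite, mul_one, mul_zero] at key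
  rw [Matrix.mul_apply, Matrix.smul_apply]
  simp only [Matrix.transpose_apply, rowMat, colMat, Matrix.of_apply, StrandSystem.ptr₂, smul_eq_mul,
    Finset.mul_sum]
  refine Eq.trans ?_ (key.trans (Finset.sum_congr rfl fun x _ => ?_))
  swap
  · rw [Finset.sum_ite_eq', if_pos (Finset.mem_univ x), mul_comm]
  symm
  rw [Finset.sum_eq_single e (fun z _ hz => by simp [Ne.symm hz]) (by simp)]
  simp

/-- `K` has rank one when it obeys the contraction relations with a strict skew invertible operator. -/
theorem rank_one (h : IsSkewInverse R Ψ)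
    (hu : IsUnit (StrandSystem.ptr₁ Ψ) ∨ IsUnit (StrandSystem.ptr₂ Ψ)) (hκ : κ ≠ 0) (hK : K ≠ 0)
    (h1 : opAt (n := 2) K 0 * opAt R 1 * opAt K 0 = κ • opAt K 0)
    (h2 : opAt (n := 2) K 1 * opAt R 0 * opAt K 1 = κ • opAt K 1) :
    (∃ s, IsUnit (rowMat K s)) ∧ ∀ s t s' t', K s t * K s' t' = K s t' * K s' t := by
  obtain ⟨s₀, t₀, h0⟩ : ∃ s t, K s t ≠ 0 := by
    by_contra! hc
    exact hK (by ext s t; exact hc s t)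
  -- A row containing a nonzero entry has an invertible matrix, because its product with a column is
  -- an invertible matrix up to a nonzero factor. Dividing by it shows that each column is its entry
  -- in that row times one fixed matrix `G`.
  obtain ⟨hs, G, hG⟩ : IsUnit (rowMat K s₀) ∧
      ∃ G : Matrix (Fin N) (Fin N) ℂ, ∀ t, colMat K t = K s₀ t • G := by
    rcases hu with hu | hu
    · have e := fun t => rowMat_transpose_mul h h1 s₀ t
      have hunit : IsUnit (rowMat K s₀)ᵀ := by
        have h3 : IsUnit ((rowMat K s₀)ᵀ * colMat K t₀) := by
          rw [e]
          exact ((Matrix.isUnit_transpose _).2 hu).smul (Units.mk0 _ (mul_ne_zero hκ h0))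
        rw [Matrix.isUnit_iff_isUnit_det, Matrix.det_mul] at h3
        rw [Matrix.isUnit_iff_isUnit_det]
        exact isUnit_of_mul_isUnit_left h3
      refine ⟨(Matrix.isUnit_transpose _).1 hunit, ?_⟩
      obtain ⟨u, hu'⟩ := hunit
      refine ⟨κ • (u⁻¹.val * (StrandSystem.ptr₁ Ψ)ᵀ), fun t => ?_⟩
      have := congrArg (fun X => u⁻¹.val * X) (e t)
      simp only [← hu', ← mul_assoc, Units.inv_mul, one_mul, mul_smul_comm] at this
      rw [this, smul_smul, mul_comm]
    · have e := fun t => rowMat_mul_transpose h h2 s₀ t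
      have hunit : IsUnit (rowMat K s₀) := by
        have h3 : IsUnit (rowMat K s₀ * (colMat K t₀)ᵀ) := by
          rw [e]
          exact ((Matrix.isUnit_transpose _).2 hu).smul (Units.mk0 _ (mul_ne_zero hκ h0))
        rw [Matrix.isUnit_iff_isUnit_det, Matrix.det_mul] at h3
        rw [Matrix.isUnit_iff_isUnit_det]
        exact isUnit_of_mul_isUnit_left h3
      refine ⟨hunit, ?_⟩
      obtain ⟨u, hu'⟩ := hunit
      refine ⟨(κ • (u⁻¹.val * (StrandSystem.ptr₂ Ψ)ᵀ))ᵀ, fun t => ?_⟩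
      have := congrArg (fun X => (u⁻¹.val * X)ᵀ) (e t)
      simp only [← hu', ← mul_assoc, Units.inv_mul, one_mul, mul_smul_comm, Matrix.transpose_transpose]
        at this
      rw [this, ← Matrix.transpose_smul, smul_smul, mul_comm]
  have key : ∀ s t, K s t = K s₀ t * G (s 0) (s 1) := by
    intro s t
    have := congrFun (congrFun (hG t) (s 0)) (s 1)
    simpa [colMat, fin_two_eta] using this
  refine ⟨⟨s₀, hs⟩, fun s t s' t' => ?_⟩
  rw [key s t, key s' t', key s t', key s' t]
  ring

end RankOne

/-! ### Weighted traces of the contraction -/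

theorem BMWPair.kk₁ {H : Type*} [Ring H] [Algebra ℂ H] {l μ : ℂ} {r₁ s₁ k₁ r₂ s₂ k₂ : H}
    (h : BMWPair l μ r₁ s₁ k₁ r₂ s₂ k₂) : k₁ * k₁ = (l⁻¹ * (μ⁻¹ - μ + l)) • k₁ := by
  have := congrArg (fun x => x * k₁) h.skein₁
  simp only [add_mul, sub_mul, h.sk₁, h.rk₁, smul_mul_assoc, one_mul] at this
  rw [mul_smul, add_smul, sub_smul, this]
  rw [show μ • k₁ - l • k₁ + l • (k₁ * k₁) - μ • k₁ + l • k₁ = l • (k₁ * k₁) by abel, smul_smul,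
    inv_mul_cancel₀ h.l_ne, one_smul]

namespace StrandSystem

variable {N : ℕ} {A E : Type*} [Ring A] [Algebra ℂ A] [Ring E] [Algebra ℂ E]
  (S : StrandSystem N A E)

theorem three_add (k l m : ℕ) (X Y : TensorOp N 3 ℂ) :
    S.three k l m (X + Y) = S.three k l m X + S.three k l m Y := by
  simp only [three, Matrix.add_apply, add_smul, Finset.sum_add_distrib]

theorem three_one (k l m : ℕ) : S.three k l m 1 = 1 := by
  rw [← opAt_one (n := 2) (0 : Fin 2), three_opAt_zero, two_one]

/-- The algebra of numerical operators on `V ⊗ V ⊗ V` acting in three distinct strands. -/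
def threeHom {k l m : ℕ} (h : k ≠ l) (h' : k ≠ m) (h'' : l ≠ m) : TensorOp N 3 ℂ →ₐ[ℂ] E :=
  AlgHom.ofLinearMap
    { toFun := S.three k l m
      map_add' := S.three_add k l m
      map_smul' := S.three_smul k l m } (S.three_one k l m) (S.three_mul h h' h'')

theorem pair_two {R : RMatrix N} {q μ : ℂ} (hB : IsBMWType R q μ) {k l m : ℕ} (h : k ≠ l)
    (h' : k ≠ m) (h'' : l ≠ m) :
    BMWPair (q - q⁻¹) μ (S.two k l R.op) (S.two k l R.inv) (S.two k l (bmwK R q μ))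
      (S.two l m R.op) (S.two l m R.inv) (S.two l m (bmwK R q μ)) := by
  have := hB.pair.map (S.threeHom h h' h'')
  have e0 : ∀ X, S.threeHom h h' h'' (opAt X 0) = S.two k l X := S.three_opAt_zero k l m
  have e1 : ∀ X, S.threeHom h h' h'' (opAt X 1) = S.two l m X := S.three_opAt_one k l m
  simpa only [e0, e1] using this

/-- The Birman-Murakami-Wenzl tower generated by an R-matrix of BMW type. -/
noncomputable def bmwTower {R : RMatrix N} {q μ : ℂ} (hB : IsBMWType R q μ) : BMWTower (q - q⁻¹) μ E where
  sh := S.sh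
  r i := S.two i (i + 1) R.op
  s i := S.two i (i + 1) R.inv
  k i := S.two i (i + 1) (bmwK R q μ)
  sh_r i := S.sh_two _ _ _
  sh_s i := S.sh_two _ _ _
  sh_k i := S.sh_two _ _ _
  pair i := S.pair_two hB (by omega) (by omega) (by omega)
  far i j h := S.two_comm (S.two_mem_cen (by omega) (by omega) _)
    (S.two_mem_cen (by omega) (by omega) _) _

theorem tr_tr_unit₂_mul {k l : ℕ} (h : k ≠ l) (i j : Fin 2 → Fin N) (X : E) :
    S.tr k (S.tr l (S.unit₂ k l i j * X)) = ∑ z, S.unit₂ k l z j * X * S.unit₂ k l i z := by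
  have one : ∀ k a b (X : E), S.tr k (S.e k a b * X) = ∑ z, S.e k z b * X * S.e k a z := by
    intro k a b X
    simp only [tr_apply, ← mul_assoc, S.e_mul]
    rw [Finset.sum_eq_single a (by intro x _ hx; simp [hx]) (by simp)]
    simp
  rw [unit₂, mul_assoc, S.tr_mul_left (S.e_mem_cen h _ _), one, one, sum_fin_two]
  refine Finset.sum_congr rfl fun a _ => ?_
  rw [Finset.mul_sum, Finset.sum_mul]
  refine Finset.sum_congr rfl fun b _ => ?_
  simp only [unit₂, Matrix.cons_val_zero, Matrix.cons_val_one]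
  rw [S.e_comm k l h (i 0) a]
  simp only [mul_assoc]

theorem unit₂_mul_mul_unit₂ {k l : ℕ} (h : k ≠ l) (s t s' t' : Fin 2 → Fin N) (X : E) :
    S.unit₂ k l s t * X * S.unit₂ k l s' t' =
      S.unit₂ k l s t' * S.tr k (S.tr l (S.unit₂ k l s' t * X)) := by
  rw [S.tr_tr_unit₂_mul h, Finset.mul_sum,
    Finset.sum_eq_single t' (fun z _ hz => ?_) (by simp)]
  · rw [← mul_assoc, ← mul_assoc, S.unit₂_mul h, if_pos rfl]
  · rw [← mul_assoc, ← mul_assoc, S.unit₂_mul h, if_neg (Ne.symm hz), zero_mul, zero_mul]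

/-- Sandwiching between operators of rank one amounts to taking a trace. -/
theorem two_mul_mul_two {K : TensorOp N 2 ℂ} (hK : ∀ s t s' t', K s t * K s' t' = K s t' * K s' t)
    {k l : ℕ} (h : k ≠ l) (X : E) :
    S.two k l K * X * S.two k l K = S.two k l K * S.tr k (S.tr l (S.two k l K * X)) := by
  have e1 : S.two k l K * X * S.two k l K = ∑ s, ∑ s', ∑ t, ∑ t', (K s t * K s' t') •
      (S.unit₂ k l s t * X * S.unit₂ k l s' t') := by
    simp only [two_eq, Finset.sum_mul, smul_mul_assoc]
    refine Finset.sum_congr rfl fun s _ => ?_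
    refine Eq.trans (Finset.sum_congr rfl fun t _ => ?_) Finset.sum_comm
    simp only [Finset.mul_sum, Finset.smul_sum, mul_smul_comm, smul_smul]
  have e2 : S.two k l K * S.tr k (S.tr l (S.two k l K * X)) = ∑ s, ∑ s', ∑ t, ∑ t',
      (K s t * K s' t') • (S.unit₂ k l s t * S.tr k (S.tr l (S.unit₂ k l s' t' * X))) := by
    simp only [two_eq, Finset.sum_mul, smul_mul_assoc, map_sum, map_smul]
    refine Finset.sum_congr rfl fun s _ => ?_
    refine Eq.trans (Finset.sum_congr rfl fun t _ => ?_) Finset.sum_comm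
    simp only [Finset.mul_sum, Finset.smul_sum, mul_smul_comm, smul_smul]
  rw [e1, e2]
  refine Finset.sum_congr rfl fun s _ => Finset.sum_congr rfl fun s' _ => ?_
  rw [Finset.sum_comm]
  refine Finset.sum_congr rfl fun t' _ => Finset.sum_congr rfl fun t _ => ?_
  rw [S.unit₂_mul_mul_unit₂ h, hK]

theorem tr_e_mul_two {k l : ℕ} (h : k ≠ l) (X : TensorOp N 2 ℂ) (a b c x : Fin N) :
    S.tr k (S.e k c a * (S.e l x b * S.two k l X)) = ∑ d, X ![a, b] ![c, d] • S.e l x d := by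
  have e1 : S.e k c a * (S.e l x b * S.two k l X) =
      ∑ c', ∑ d, X ![a, b] ![c', d] • (S.e k c c' * S.e l x d) := by
    have : S.e k c a * S.e l x b = S.unit₂ k l ![c, x] ![a, b] := rfl
    rw [← mul_assoc, this, two_eq, Finset.mul_sum]
    simp only [Finset.mul_sum, mul_smul_comm, S.unit₂_mul h, smul_ite, smul_zero]
    rw [Finset.sum_comm]
    simp only [Finset.sum_ite_eq, Finset.mem_univ, if_true, sum_fin_two]
    rfl
  rw [e1]
  simp only [map_sum, map_smul, S.tr_mul_right (S.e_mem_cen h.symm _ _), S.tr_e, ite_mul,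
    _root_.one_mul, zero_mul, smul_ite, smul_zero]
  rw [Finset.sum_eq_single c (by intro z _ hz; simp [Ne.symm hz]) (by simp)]
  simp

/-- An operator that has an invertible row does not annihilate operators in its second strand. -/
theorem eq_zero_of_two_mul_eq_zero {K : TensorOp N 2 ℂ} (hK : ∃ s, IsUnit (rowMat K s)) {k l : ℕ}
    (h : k ≠ l) {y : E} (hy : y ∈ S.cen k) (h0 : S.two k l K * y = 0) : y = 0 := by
  obtain ⟨s, u, hu⟩ := hK
  have h1 : ∀ x c, ∑ d, u.val c d • (S.e l x d * y) = 0 := by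
    intro x c
    have := S.tr_e_mul_two h K (s 0) (s 1) c x
    have h2 : S.tr k (S.e k c (s 0) * (S.e l x (s 1) * S.two k l K)) * y = 0 := by
      rw [← S.tr_mul_right hy, mul_assoc, mul_assoc, h0, mul_zero, mul_zero, map_zero]
    rw [this, Finset.sum_mul, fin_two_eta] at h2
    rw [← h2]
    refine Finset.sum_congr rfl fun d _ => ?_
    rw [hu, smul_mul_assoc]
    rfl
  have h3 : ∀ x d, S.e l x d * y = 0 := by
    intro x d
    have e : ∑ c, u⁻¹.val d c • ∑ d', u.val c d' • (S.e l x d' * y) = S.e l x d * y := by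
      simp only [Finset.smul_sum, smul_smul]
      rw [Finset.sum_comm]
      simp only [← Finset.sum_smul, ← Matrix.mul_apply, Units.inv_mul, Matrix.one_apply, ite_smul,
        one_smul, zero_smul, Finset.sum_ite_eq, Finset.mem_univ, if_true]
    rw [← e]
    simp only [h1, smul_zero, Finset.sum_const_zero]
  rw [← _root_.one_mul y, ← S.sum_e l, Finset.sum_mul]
  exact Finset.sum_eq_zero fun x _ => h3 x x

section Contraction

variable {S}
variable {R : RMatrix N} {q μ : ℂ} (hB : IsBMWType R q μ)
  (hR : IsSkewInverse R.op (skewInverse R.op))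
  (hrow : ∃ s, IsUnit (rowMat (bmwK R q μ) s))

include hB hR hrow

/-- The `D`-weighted trace of `K` over the second factor. -/
theorem wtr_two_bmwK {l m : ℕ} (hlm : l ≠ m) :
    S.wtr (skewD R.op) m (S.two l m (bmwK R q μ)) = μ • 1 := by
  obtain ⟨k, hkl, hkm⟩ : ∃ k, k ≠ l ∧ k ≠ m := ⟨l + m + 1, by omega, by omega⟩
  have P := S.pair_two hB hkl hkm hlm
  have hm : ∀ X, S.two k l X ∈ S.cen m := fun X => S.two_mem_cen hkm hlm _
  have hw : S.wtr (skewD R.op) m (S.two l m R.op) = 1 := wtr_two hR hlm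
  refine sub_eq_zero.1 (S.eq_zero_of_two_mul_eq_zero hrow hkl (sub_mem (S.wtr_mem_cen _
    (S.two_mem_cen hkl.symm hkm.symm _)) (Subalgebra.smul_mem _ (one_mem _) _)) ?_)
  -- Multiplied by $K_{kl}$, the trace becomes that of $K_{kl}R_{lm}R_{kl}$. The trace of $R_{lm}$
  -- over $m$ is $1$, and $K_{kl}R_{kl}=\mu K_{kl}$.
  rw [mul_sub, ← S.wtr_mul_left _ (hm _), P.kk'_r', S.wtr_mul_right _ (hm _),
    S.wtr_mul_left _ (hm _), hw, mul_one, P.kr₁, mul_smul_comm, mul_one, sub_self]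

/-- The trace of `D`. -/
theorem wtr_one_eq (m : ℕ) : S.wtr (skewD R.op) m 1 =
    (μ * ((q - q⁻¹)⁻¹ * (μ⁻¹ - μ + (q - q⁻¹)))) • (1 : E) := by
  obtain ⟨l, hlm⟩ : ∃ l, l ≠ m := ⟨m + 1, by omega⟩
  obtain ⟨k, hkl, hkm⟩ : ∃ k, k ≠ l ∧ k ≠ m := ⟨l + m + 1, by omega, by omega⟩
  have P := S.pair_two hB hkl hkm hlm
  have hm : ∀ X, S.two k l X ∈ S.cen m := fun X => S.two_mem_cen hkm hlm _
  refine sub_eq_zero.1 (S.eq_zero_of_two_mul_eq_zero hrow hkl (sub_mem (S.wtr_mem_cen _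
    (one_mem _)) (Subalgebra.smul_mem _ (one_mem _) _)) ?_)
  have hkk : S.two k l (bmwK R q μ) * S.two k l (bmwK R q μ) =
      ((q - q⁻¹)⁻¹ * (μ⁻¹ - μ + (q - q⁻¹))) • S.two k l (bmwK R q μ) := P.kk₁
  rw [mul_sub, ← S.wtr_mul_left _ (hm _), mul_one]
  -- The trace over $m$ of $K_{kl}=K_{kl}K_{lm}K_{kl}$ involves only the known trace of $K_{lm}$ and
  -- the square of $K_{kl}$.
  conv_lhs => rw [← P.kkk]
  rw [S.wtr_mul_right _ (hm _), S.wtr_mul_left _ (hm _), wtr_two_bmwK hB hR hrow hlm, P.kkk]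
  rw [mul_smul_comm, mul_one, smul_mul_assoc, hkk, mul_smul_comm, mul_one, smul_smul, sub_self]

end Contraction

end StrandSystem

/-- The second factor is $-\mu^{-1}(\mu-q)(\mu+q^{-1})$, so it vanishes only at the two excluded
values of $\mu$. -/
theorem IsBMWType.trace_ne_zero {N : ℕ} {R : RMatrix N} {q μ : ℂ} (hB : IsBMWType R q μ) :
    (q - q⁻¹)⁻¹ * (μ⁻¹ - μ + (q - q⁻¹)) ≠ 0 := by
  have hq := hB.q_ne_zero
  have hμ := hB.μ_ne_zero
  have h1 : μ - q ≠ 0 := sub_ne_zero.2 hB.μ_ne_q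
  have h2 : μ + q⁻¹ ≠ 0 := fun h => hB.μ_ne_neg_q_inv (eq_neg_of_add_eq_zero_left h)
  refine mul_ne_zero (inv_ne_zero hB.l_ne) fun h => mul_ne_zero h1 h2 ?_
  field_simp at h ⊢
  linear_combination -h

/-! ### Copies of a matrix along the strands -/

namespace StrandSystem

variable {N : ℕ} {A E : Type*} [Ring A] [Algebra ℂ A] [Ring E] [Algebra ℂ E]
  (S : StrandSystem N A E)

section Copies

variable (F : RMatrix N)

theorem two_op_mul_inv (k : ℕ) : S.two k (k + 1) F.op * S.two k (k + 1) F.inv = 1 := by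
  rw [← S.two_mul (by omega), F.op_mul_inv, two_one]

theorem two_inv_mul_op (k : ℕ) : S.two k (k + 1) F.inv * S.two k (k + 1) F.op = 1 := by
  rw [← S.two_mul (by omega), F.inv_mul_op, two_one]

/-- Conjugation by `F` acting in the strands `k`, `k + 1`. -/
def conj (k : ℕ) : E →ₐ[ℂ] E :=
  AlgHom.ofLinearMap (LinearMap.mulRight ℂ (S.two k (k + 1) F.inv) ∘ₗ
    LinearMap.mulLeft ℂ (S.two k (k + 1) F.op))
    (by simp [two_op_mul_inv]) (fun X Y => by
      simp only [LinearMap.comp_apply, LinearMap.mulLeft_apply, LinearMap.mulRight_apply]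
      calc _ = S.two k (k + 1) F.op * X * 1 * Y * S.two k (k + 1) F.inv := by
            simp only [mul_assoc, _root_.one_mul]
        _ = _ := by rw [← S.two_inv_mul_op F k]; simp only [mul_assoc])

theorem conj_apply (k : ℕ) (X : E) :
    S.conj F k X = S.two k (k + 1) F.op * X * S.two k (k + 1) F.inv := rfl

theorem conj_of_mem {k : ℕ} {X : E} (h : X ∈ S.cen k) (h' : X ∈ S.cen (k + 1)) :
    S.conj F k X = X := by
  rw [conj_apply, S.two_comm h h', mul_assoc, two_op_mul_inv, mul_one]

theorem conj_mem_cen {k l : ℕ} (h : k ≠ l) (h' : k + 1 ≠ l) {X : E} (hX : X ∈ S.cen l) :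
    S.conj F k X ∈ S.cen l :=
  mul_mem (mul_mem (S.two_mem_cen h h' _) hX) (S.two_mem_cen h h' _)

theorem conj_mem_loc {k m : ℕ} (h : k + 2 ≤ m) {X : E} (hX : X ∈ S.loc m) :
    S.conj F k X ∈ S.loc m :=
  S.mem_loc.2 fun _ hl => S.conj_mem_cen F (by omega) (by omega) (S.mem_loc.1 hX _ hl)

theorem conj_ι (k : ℕ) (x : A) : S.conj F k (S.ι x) = S.ι x :=
  S.conj_of_mem F (S.ι_mem_cen _ _) (S.ι_mem_cen _ _)

variable {F}

/-- The twist relation read as a translation: two successive conjugations by $F$ move a compatible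
operator one strand up. -/
theorem conj_conj_two {X : TensorOp N 2 ℂ} (h : IsCompatiblePair X F.op) (k : ℕ) :
    S.conj F k (S.conj F (k + 1) (S.two k (k + 1) X)) = S.two (k + 1) (k + 2) X := by
  have := congrArg (S.three k (k + 1) (k + 2)) h.2
  simp only [S.three_mul (show k ≠ k + 1 by omega) (show k ≠ k + 2 by omega)
    (show k + 1 ≠ k + 2 by omega), three_opAt_zero, three_opAt_one] at this
  have e1 := S.two_op_mul_inv F k
  have e2 := S.two_op_mul_inv F (k + 1)
  rw [conj_apply, conj_apply, ← mul_assoc, ← mul_assoc, ← this, mul_assoc _ (S.two (k + 1) _ F.op),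
    e2, mul_one, mul_assoc, e1, mul_one]

theorem conj_conj_two' {X : TensorOp N 2 ℂ} (h : IsCompatiblePair X F.op) (k : ℕ) :
    S.conj F (k + 1) (S.conj F k (S.two (k + 1) (k + 2) X)) = S.two k (k + 1) X := by
  have := congrArg (S.three k (k + 1) (k + 2)) h.1
  simp only [S.three_mul (show k ≠ k + 1 by omega) (show k ≠ k + 2 by omega)
    (show k + 1 ≠ k + 2 by omega), three_opAt_zero, three_opAt_one] at this
  have e1 := S.two_op_mul_inv F k
  have e2 := S.two_op_mul_inv F (k + 1)
  rw [conj_apply, conj_apply, ← mul_assoc, ← mul_assoc, ← this, mul_assoc _ (S.two k _ F.op),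
    e1, mul_one, mul_assoc, e2, mul_one]

theorem isCompatiblePair_self (F : RMatrix N) : IsCompatiblePair F.op F.op := ⟨F.ybe, F.ybe.symm⟩

variable (F)

/-- Conjugation by `F` along the strands `0, …, m`, which shifts the strands by one. -/
def conjUp : ℕ → E →ₐ[ℂ] E
  | 0 => AlgHom.id ℂ E
  | m + 1 => (conjUp m).comp (S.conj F m)

theorem conjUp_succ (m : ℕ) (X : E) : S.conjUp F (m + 1) X = S.conjUp F m (S.conj F m X) := rfl

/-- Only finitely many conjugations matter for a local operator, so the translation may be taken as
long as convenient. -/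
theorem conjUp_of_loc {m n : ℕ} (h : m ≤ n) {X : E} (hX : X ∈ S.loc m) :
    S.conjUp F n X = S.conjUp F m X := by
  induction n, h using Nat.le_induction with
  | base => rfl
  | succ n hn ih =>
    rw [conjUp_succ, S.conj_of_mem F (S.mem_loc.1 hX _ hn) (S.mem_loc.1 hX _ (by omega)), ih]

theorem conjUp_of_cen {m : ℕ} {X : E} (hX : ∀ k ≤ m, X ∈ S.cen k) : S.conjUp F m X = X := by
  induction m with
  | zero => rfl
  | succ m ih =>
    rw [conjUp_succ, S.conj_of_mem F (hX _ (by omega)) (hX _ (by omega)),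
      ih fun k hk => hX k (by omega)]

theorem conjUp_ι (m : ℕ) (x : A) : S.conjUp F m (S.ι x) = S.ι x :=
  S.conjUp_of_cen F fun _ _ => S.ι_mem_cen _ _

-- Among the conjugations composing the translation, those beyond $i+1$ do not touch the operator,
-- those at $i+1$ and $i$ move it one strand up, and the remaining ones no longer reach it.
variable {F} in
theorem conjUp_two {X : TensorOp N 2 ℂ} (h : IsCompatiblePair X F.op) {i m : ℕ} (hi : i + 2 ≤ m) :
    S.conjUp F m (S.two i (i + 1) X) = S.two (i + 1) (i + 2) X := by
  rw [S.conjUp_of_loc F hi (S.mem_loc.2 fun k hk => S.two_mem_cen (by omega) (by omega) _),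
    conjUp_succ, conjUp_succ, S.conj_conj_two h,
    S.conjUp_of_cen F fun k hk => S.two_mem_cen (by omega) (by omega) _]

/-- The copy of an operator that acts in the first strand to the strand `n`. -/
def copy : ℕ → E →ₐ[ℂ] E
  | 0 => AlgHom.id ℂ E
  | n + 1 => (S.conj F n).comp (copy n)

theorem copy_zero (X : E) : S.copy F 0 X = X := rfl

theorem copy_succ (n : ℕ) (X : E) : S.copy F (n + 1) X = S.conj F n (S.copy F n X) := rfl

theorem copy_mem_loc {X : E} (hX : X ∈ S.loc 1) (n : ℕ) : S.copy F n X ∈ S.loc (n + 1) := by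
  induction n with
  | zero => exact hX
  | succ n ih => exact S.conj_mem_loc F (by omega) (S.loc_mono (by omega) ih)

theorem copy_ι (n : ℕ) (x : A) : S.copy F n (S.ι x) = S.ι x := by
  induction n with
  | zero => rfl
  | succ n ih => rw [copy_succ, ih, conj_ι]

theorem conjUp_conj {i m : ℕ} (hi : i + 2 ≤ m) (X : E) :
    S.conjUp F m (S.conj F i X) = S.conj F (i + 1) (S.conjUp F m X) := by
  have hF := isCompatiblePair_self F
  have h1 : S.conjUp F m (S.two i (i + 1) F.op) = S.two (i + 1) (i + 2) F.op := S.conjUp_two hF hi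
  have h2 : S.conjUp F m (S.two i (i + 1) F.inv) = S.two (i + 1) (i + 2) F.inv := by
    have e1 := congrArg (S.conjUp F m) (S.two_inv_mul_op F i)
    rw [map_mul, map_one, h1] at e1
    exact left_inv_eq_right_inv e1 (S.two_op_mul_inv F (i + 1))
  rw [conj_apply, map_mul, map_mul, h1, h2, conj_apply]

/-- The conjugations building the copy are themselves translated by `conjUp_conj`. So translation by
$F$ takes each copy to the next, just as it shifts compatible operators. -/
theorem conjUp_copy {X : E} (hX : X ∈ S.loc 1) {n m : ℕ} (h : n + 1 ≤ m) :
    S.conjUp F m (S.copy F n X) = S.copy F (n + 1) X := by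
  induction n generalizing m with
  | zero => exact S.conjUp_of_loc F h hX
  | succ n ih =>
    rw [copy_succ, S.conjUp_conj F (by omega), ih (by omega), copy_succ _ _ (n + 1)]

/-- The operators `X` compatible with `F` commute with remote copies. -/
theorem two_comm_copy {F : RMatrix N} {X : TensorOp N 2 ℂ} (h : IsCompatiblePair X F.op) {Y : E} (hY : Y ∈ S.loc 1)
    {i k : ℕ} (hk : k < i ∨ i + 2 ≤ k) :
    S.two i (i + 1) X * S.copy F k Y = S.copy F k Y * S.two i (i + 1) X := by
  rcases hk with hk | hk
  · have := S.mem_loc.1 (S.copy_mem_loc F hY k)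
    exact S.two_comm (this _ hk) (this _ (by omega)) _
  -- The operator $X_i$ and the copy in strand $i+2$ are images of $X_{i+1}$ and of the copy in
  -- strand $i$ under the same conjugations, and these two visibly commute.
  · induction k, hk using Nat.le_induction with
    | base =>
      have hc := S.mem_loc.1 (S.copy_mem_loc F hY i)
      rw [copy_succ, copy_succ, ← S.conj_conj_two' h, ← map_mul, ← map_mul,
        S.two_comm (hc _ (by omega)) (hc _ (by omega)), map_mul, map_mul]
    | succ k hk ih =>
      have e : S.conj F k (S.two i (i + 1) X) = S.two i (i + 1) X :=
        S.conj_of_mem F (S.two_mem_cen (by omega) (by omega) _)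
          (S.two_mem_cen (by omega) (by omega) _)
      rw [copy_succ, ← e, ← map_mul, ih, map_mul]

/-- The product of the copies of `M` to the strands `n, …, n + m - 1`. -/
def copies (M : E) (n : ℕ) : ℕ → E
  | 0 => 1
  | m + 1 => copies M n m * S.copy F (n + m) M

theorem copies_succ (M : E) (n m : ℕ) :
    S.copies F M n (m + 1) = S.copies F M n m * S.copy F (n + m) M := rfl

theorem copies_one (M : E) (n : ℕ) : S.copies F M n 1 = S.copy F n M := by
  rw [copies_succ, copies, _root_.one_mul, add_zero]

theorem copies_add (M : E) (n m p : ℕ) :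
    S.copies F M n (m + p) = S.copies F M n m * S.copies F M (n + m) p := by
  induction p with
  | zero => rw [add_zero, copies, mul_one]
  | succ p ih => rw [← add_assoc, copies_succ, ih, copies_succ, mul_assoc, add_assoc n m p]

theorem copies_mem_loc {M : E} (hM : M ∈ S.loc 1) (n m : ℕ) : S.copies F M n m ∈ S.loc (n + m) := by
  induction m with
  | zero => exact one_mem _
  | succ m ih =>
    exact mul_mem (S.loc_mono (by omega) ih) (S.copy_mem_loc F hM (n + m))

theorem conjUp_copies {M : E} (hM : M ∈ S.loc 1) (n m : ℕ) {k : ℕ} (hk : n + m ≤ k) :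
    S.conjUp F k (S.copies F M n m) = S.copies F M (n + 1) m := by
  induction m with
  | zero => exact map_one _
  | succ m ih =>
    rw [copies_succ, map_mul, ih (by omega), S.conjUp_copy F hM (by omega), copies_succ,
      show n + m + 1 = n + 1 + m by omega]

/-- The relation `r M₁ M₂ = M₁ M₂ r` in neighbouring strands. -/
theorem two_comm_copy_copy {F : RMatrix N} {X : TensorOp N 2 ℂ} (h : IsCompatiblePair X F.op) {M : E} (hM : M ∈ S.loc 1)
    (hX : S.two 0 1 X * (M * S.copy F 1 M) = (M * S.copy F 1 M) * S.two 0 1 X) (i : ℕ) :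
    S.two i (i + 1) X * (S.copy F i M * S.copy F (i + 1) M) =
      (S.copy F i M * S.copy F (i + 1) M) * S.two i (i + 1) X := by
  induction i with
  | zero => exact hX
  | succ i ih =>
    have := congrArg (S.conjUp F (i + 2)) ih
    simpa only [map_mul, S.conjUp_two h le_rfl, S.conjUp_copy F hM (show i + 1 ≤ i + 2 by omega),
      S.conjUp_copy F hM (show i + 1 + 1 ≤ i + 2 by omega)] using this

theorem two_comm_copies {F : RMatrix N} {X : TensorOp N 2 ℂ} (h : IsCompatiblePair X F.op) {M : E} (hM : M ∈ S.loc 1)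
    (hX : S.two 0 1 X * (M * S.copy F 1 M) = (M * S.copy F 1 M) * S.two 0 1 X) {i n m : ℕ}
    (hi : i + 2 ≤ n ∨ n + m ≤ i ∨ n ≤ i ∧ i + 2 ≤ n + m) :
    S.two i (i + 1) X * S.copies F M n m = S.copies F M n m * S.two i (i + 1) X := by
  have far : ∀ n m, i + 2 ≤ n ∨ n + m ≤ i →
      S.two i (i + 1) X * S.copies F M n m = S.copies F M n m * S.two i (i + 1) X := by
    intro n m hi
    induction m with
    | zero => rw [copies, mul_one, _root_.one_mul]
    | succ m ih =>
      rw [copies_succ, ← mul_assoc, ih (by omega), mul_assoc, S.two_comm_copy h hM (by omega),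
        mul_assoc]
  rcases hi with hi | hi | ⟨hi, hi'⟩
  · exact far _ _ (Or.inl hi)
  · exact far _ _ (Or.inr hi)
  · obtain ⟨a, rfl⟩ := Nat.exists_eq_add_of_le hi
    obtain ⟨b, rfl⟩ : ∃ b, m = a + 2 + b := ⟨m - a - 2, by omega⟩
    rw [copies_add, copies_add, copies_succ _ _ _ _ 1, copies_one, ← mul_assoc, ← mul_assoc,
      far _ _ (Or.inr le_rfl), mul_assoc _ (S.two _ _ _), add_assoc n a 1,
      show n + (a + 1) = n + a + 1 by omega,
      S.two_comm_copy_copy h hM hX, mul_assoc, mul_assoc, far _ _ (Or.inl (by omega))]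
    simp only [mul_assoc]

end Copies

/-! ### Weighted traces over several strands: cyclicity and translation -/

section Trace

variable (D : Matrix (Fin N) (Fin N) ℂ)

/-- The `D`-weighted trace over the strands `a, …, a + m - 1`. -/
def wtrs (a : ℕ) : ℕ → E →ₗ[ℂ] E
  | 0 => LinearMap.id
  | m + 1 => (wtrs a m).comp (S.wtr D (a + m))

theorem wtrs_zero (a : ℕ) (X : E) : S.wtrs D a 0 X = X := rfl

theorem wtrs_succ (a m : ℕ) (X : E) : S.wtrs D a (m + 1) X = S.wtrs D a m (S.wtr D (a + m) X) := rfl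

theorem wtrs_one (a : ℕ) (X : E) : S.wtrs D a 1 X = S.wtr D a X := rfl

theorem wtrs_add (a m p : ℕ) (X : E) :
    S.wtrs D a (m + p) X = S.wtrs D a m (S.wtrs D (a + m) p X) := by
  induction p generalizing X with
  | zero => rfl
  | succ p ih => rw [← add_assoc, wtrs_succ, ih, wtrs_succ, add_assoc]

theorem wtrs_mul_left {a : ℕ} (m : ℕ) {Y : E} (hY : Y ∈ S.loc a) (X : E) :
    S.wtrs D a m (Y * X) = Y * S.wtrs D a m X := by
  induction m generalizing X with
  | zero => rfl
  | succ m ih => rw [wtrs_succ, S.wtr_mul_left D (S.mem_loc.1 hY _ (by omega)), ih, wtrs_succ]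

theorem wtrs_mul_right {a : ℕ} (m : ℕ) {Y : E} (hY : Y ∈ S.loc a) (X : E) :
    S.wtrs D a m (X * Y) = S.wtrs D a m X * Y := by
  induction m generalizing X with
  | zero => rfl
  | succ m ih => rw [wtrs_succ, S.wtr_mul_right D (S.mem_loc.1 hY _ (by omega)), ih, wtrs_succ]

theorem wtrs_mem_loc {a m : ℕ} {X : E} (hX : X ∈ S.loc (a + m)) : S.wtrs D a m X ∈ S.loc a := by
  induction m generalizing X with
  | zero => exact hX
  | succ m ih => exact ih (S.wtr_mem_loc D hX)

end Trace

section CyclicTrace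

variable {S}
variable [Nontrivial E] {R F : RMatrix N} {Ψ : TensorOp N 2 ℂ} (h : IsSkewInverse R.op Ψ)

include h

omit [Nontrivial E] in
/-- Cyclicity of the trace over several strands. -/
theorem wtrs_two_mul {a m i : ℕ} (hi : a ≤ i) (hi' : i + 1 < a + m) (X : E) :
    S.wtrs (ptr₂ Ψ) a m (S.two i (i + 1) R.op * X) =
      S.wtrs (ptr₂ Ψ) a m (X * S.two i (i + 1) R.op) := by
  obtain ⟨b, rfl⟩ := Nat.exists_eq_add_of_le hi
  obtain ⟨c, rfl⟩ : ∃ c, m = b + (2 + c) := ⟨m - b - 2, by omega⟩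
  have hl : S.two (a + b) (a + b + 1) R.op ∈ S.loc (a + b + 2) :=
    S.mem_loc.2 fun k hk => S.two_mem_cen (by omega) (by omega) _
  rw [wtrs_add, wtrs_add, wtrs_add, wtrs_add, S.wtrs_mul_left _ _ hl, S.wtrs_mul_right _ _ hl]
  congr 1
  exact wtr_wtr_two h R.op_mul_inv R.inv_mul_op R.ybe (Nat.succ_ne_self (a + b)).symm _

theorem wtr_conj_of_mem (hRF : IsCompatiblePair R.op F.op) {k : ℕ} {Z : E} (hZ : Z ∈ S.cen (k + 1)) :
    S.wtr (ptr₂ Ψ) (k + 1) (S.conj F k Z) = S.wtr (ptr₂ Ψ) k Z :=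
  wtr_conj h F.inv_mul_op (conj_rel_of_compatible F.op_mul_inv F.inv_mul_op hRF.2) (by omega) hZ

/-- The last conjugation carries the trace over $k$ to the trace over $k+1$ by `wtr_conj`; the
others act in strands up to $k$ and come out of the trace. -/
theorem wtr_conjUp (hRF : IsCompatiblePair R.op F.op) {k : ℕ} {Z : E} (hZ : Z ∈ S.cen (k + 1)) :
    S.wtr (ptr₂ Ψ) (k + 1) (S.conjUp F (k + 1) Z) = S.conjUp F k (S.wtr (ptr₂ Ψ) k Z) := by
  have : ∀ m, m ≤ k → ∀ Z : E, S.wtr (ptr₂ Ψ) (k + 1) (S.conjUp F m Z) =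
      S.conjUp F m (S.wtr (ptr₂ Ψ) (k + 1) Z) := by
    intro m hm
    induction m with
    | zero => intro Z; rfl
    | succ m ih =>
      intro Z
      rw [conjUp_succ, ih (by omega), conjUp_succ, conj_apply,
        S.wtr_mul_right _ (S.two_mem_cen (by omega) (by omega) _),
        S.wtr_mul_left _ (S.two_mem_cen (by omega) (by omega) _), conj_apply]
  rw [conjUp_succ, this k le_rfl, wtr_conj_of_mem h hRF hZ]

theorem wtrs_conjUp (hRF : IsCompatiblePair R.op F.op) {a m : ℕ} {Z : E} (hZ : Z ∈ S.loc (a + m)) :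
    S.wtrs (ptr₂ Ψ) (a + 1) m (S.conjUp F (a + m) Z) =
      S.conjUp F a (S.wtrs (ptr₂ Ψ) a m Z) := by
  induction m generalizing Z with
  | zero => rfl
  | succ m ih =>
    rw [wtrs_succ, show a + 1 + m = a + m + 1 by omega, ← add_assoc,
      wtr_conjUp h hRF (S.mem_loc.1 hZ _ (by omega)), ih (S.wtr_mem_loc _ hZ), wtrs_succ]

end CyclicTrace

end StrandSystem

/-! ### The descent system of a quantum matrix -/

/-- A strand system together with a matrix `M` in the first strand that obeys the relations of
the quantum matrix algebra of a compatible pair `R`, `F` with `R` of BMW type. -/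
structure QuantumStrands {N : ℕ} (A E : Type*) [Ring A] [Algebra ℂ A] [Ring E] [Algebra ℂ E]
    (R F : RMatrix N) (q μ : ℂ) extends StrandSystem N A E where
  compat : IsCompatiblePair R.op F.op
  skew : IsSkewInverse R.op (skewInverse R.op)
  strict : IsUnit (skewC R.op) ∨ IsUnit (skewD R.op)
  bmw : IsBMWType R q μ
  M : E
  M_mem : M ∈ toStrandSystem.loc 1
  rel : toStrandSystem.two 0 1 R.op * (M * toStrandSystem.copy F 1 M) =
    (M * toStrandSystem.copy F 1 M) * toStrandSystem.two 0 1 R.op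
  trace_mem : ∀ n, ∀ w ∈ (toStrandSystem.bmwTower bmw).W 0 n,
    toStrandSystem.wtrs (skewD R.op) 0 (n + 1) (toStrandSystem.copies F M 0 (n + 1) * w) ∈ ι.range

namespace QuantumStrands

open StrandSystem

variable {N : ℕ} {A E : Type*} [Ring A] [Algebra ℂ A] [Ring E] [Algebra ℂ E]
  {R F : RMatrix N} {q μ : ℂ} (Q : QuantumStrands A E R F q μ)

/-- The underlying strand system. -/
abbrev S : StrandSystem N A E := Q.toStrandSystem

/-- The tower of braid words. -/
noncomputable abbrev B : BMWTower (q - q⁻¹) μ E := Q.S.bmwTower Q.bmw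

/-- The ordered product of the first `n` copies of `M`. -/
abbrev Mp (n : ℕ) : E := Q.S.copies F Q.M 0 n

/-- The weighted trace over the strands `a, …, a + m - 1`. -/
noncomputable abbrev TR (a m : ℕ) : E →ₗ[ℂ] E := Q.S.wtrs (skewD R.op) a m

theorem comm_of_r {U : E} {a b : ℕ} (h : ∀ i, a ≤ i → i < b → Q.B.r i * U = U * Q.B.r i) {w : E}
    (hw : w ∈ Q.B.W a b) : w * U = U * w :=
  Q.B.intertwine (AlgHom.id ℂ E) h hw

theorem W_le_of_r {U : Subalgebra ℂ E} {a b : ℕ}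
    (h : ∀ X i, a ≤ i → i < b → Q.S.two i (i + 1) X ∈ U) : Q.B.W a b ≤ U :=
  Q.B.W_le fun i hi hi' => ⟨h _ i hi hi', h _ i hi hi'⟩

theorem W_mem_loc {a b c : ℕ} (h : b + 1 ≤ c) {w : E} (hw : w ∈ Q.B.W a b) : w ∈ Q.S.loc c :=
  Q.W_le_of_r (fun _ i _ hi' => Q.S.mem_loc.2 fun _ hk => Q.S.two_mem_cen (by omega) (by omega) _)
    hw

theorem W_comm_ι {a b : ℕ} {w : E} (hw : w ∈ Q.B.W a b) (x : A) : w * Q.ι x = Q.ι x * w :=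
  Q.comm_of_r (fun _ _ _ => Q.S.two_comm (Q.S.ι_mem_cen _ _) (Q.S.ι_mem_cen _ _) _) hw

theorem W_comm_copies {a b n m : ℕ} (h : b + 1 ≤ n ∨ n + m ≤ a ∨ n ≤ a ∧ b + 1 ≤ n + m) {w : E}
    (hw : w ∈ Q.B.W a b) : w * Q.S.copies F Q.M n m = Q.S.copies F Q.M n m * w :=
  Q.comm_of_r (fun _ _ _ => Q.S.two_comm_copies Q.compat Q.M_mem Q.rel (by omega)) hw

theorem Mp_mem_loc (n : ℕ) : Q.Mp n ∈ Q.S.loc n := by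
  have := Q.S.copies_mem_loc F Q.M_mem 0 n
  rwa [zero_add] at this

theorem conjUp_W {a b k : ℕ} (h : b + 1 ≤ k) {w : E} (hw : w ∈ Q.B.W a b) :
    Q.S.conjUp F k w = Q.B.sh w := by
  have hr : ∀ i, i < b → Q.S.conjUp F k (Q.B.r i) = Q.B.r (i + 1) := fun i hi =>
    Q.S.conjUp_two Q.compat (by omega)
  have hle : Q.B.W a b ≤ AlgHom.equalizer (Q.S.conjUp F k) Q.B.sh := by
    refine Q.B.W_le fun i _ hi => ⟨(hr i hi).trans (Q.B.sh_r i).symm, ?_⟩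
    have e1 := congrArg (Q.S.conjUp F k) (Q.B.sr i)
    rw [map_mul, map_one, hr i hi] at e1
    exact (left_inv_eq_right_inv e1 (Q.B.rs (i + 1))).trans (Q.B.sh_s i).symm
  exact hle hw

theorem TR_conj {a m : ℕ} {p : E} (hp : p ∈ Q.B.W a (a + m)) (X : E) :
    Q.TR a (m + 1) (p * X) = Q.TR a (m + 1) (X * p) := by
  have hr : ∀ i, a ≤ i → i < a + m → ∀ X : E,
      Q.TR a (m + 1) (Q.B.r i * X) = Q.TR a (m + 1) (X * Q.B.r i) := fun i hi hi' X =>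
    wtrs_two_mul Q.skew hi (by omega) X
  induction hp using Algebra.adjoin_induction generalizing X with
  | mem x hx =>
    obtain ⟨i, hi, hi', rfl | rfl⟩ := hx
    · exact hr i hi hi' X
    -- Cyclicity for an inverse letter is cyclicity for the letter, applied to $s_iXs_i$.
    · have := hr i hi hi' (Q.B.s i * X * Q.B.s i)
      rw [mul_assoc (Q.B.s i), Q.B.rs_mul, ← mul_assoc, mul_assoc _ _ (Q.B.r i), Q.B.sr, mul_one]
        at this
      exact this.symm
  | algebraMap c => rw [Algebra.commutes]
  | add x y _ _ hx hy => rw [add_mul, mul_add, map_add, map_add, hx, hy]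
  | mul x y _ _ hx hy => rw [mul_assoc, hx, mul_assoc, hy, mul_assoc]

/-- The matrix descendant of a word on `n + 1` strands. -/
noncomputable def D (n : ℕ) : E →ₗ[ℂ] E := Q.TR 1 n ∘ₗ LinearMap.mulLeft ℂ (Q.Mp (n + 1))

theorem D_apply (n : ℕ) (w : E) : Q.D n w = Q.TR 1 n (Q.Mp (n + 1) * w) := rfl

theorem D_mem_loc {n : ℕ} {w : E} (hw : w ∈ Q.B.W 0 n) : Q.D n w ∈ Q.S.loc 1 :=
  Q.S.wtrs_mem_loc _ (Q.S.loc_mono (by omega) (mul_mem (Q.Mp_mem_loc (n + 1))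
    (Q.W_mem_loc le_rfl hw)))

/-- A left inverse of the embedding of the coefficients. -/
noncomputable def ιInv : E →ₗ[ℂ] A :=
  (Q.ι.toLinearMap.exists_leftInverse_of_injective (LinearMap.ker_eq_bot.2 Q.ι_injective)).choose

theorem ιInv_ι (x : A) : Q.ιInv (Q.ι x) = x :=
  LinearMap.congr_fun (Q.ι.toLinearMap.exists_leftInverse_of_injective
    (LinearMap.ker_eq_bot.2 Q.ι_injective)).choose_spec x

/-- The characteristic element of a word on `n + 1` strands. -/
noncomputable def ch (n : ℕ) : E →ₗ[ℂ] A :=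
  Q.ιInv ∘ₗ Q.TR 0 (n + 1) ∘ₗ LinearMap.mulLeft ℂ (Q.Mp (n + 1))

theorem ι_ch {n : ℕ} {w : E} (hw : w ∈ Q.B.W 0 n) :
    Q.ι (Q.ch n w) = Q.TR 0 (n + 1) (Q.Mp (n + 1) * w) := by
  obtain ⟨x, hx⟩ := Q.trace_mem n w hw
  have hx' : Q.ι x = Q.TR 0 (n + 1) (Q.Mp (n + 1) * w) := hx
  have : Q.ch n w = x := by
    show Q.ιInv (Q.TR 0 (n + 1) (Q.Mp (n + 1) * w)) = x
    rw [← hx', ιInv_ι]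
  rw [this, hx']

/-- Left multiplication of descendants by words. -/
noncomputable def L (n : ℕ) (w s : E) : E →ₗ[ℂ] E :=
  Q.TR 1 (n + 1) ∘ₗ LinearMap.mulRight ℂ s ∘ₗ LinearMap.mulLeft ℂ (Q.Mp (n + 1) * w) ∘ₗ
    (Q.S.copy F (n + 1)).toLinearMap

theorem L_apply (n : ℕ) (w s X : E) :
    Q.L n w s X = Q.TR 1 (n + 1) (Q.Mp (n + 1) * w * Q.S.copy F (n + 1) X * s) := rfl

variable [Nontrivial E]

/-- Translation by $F$ shifts the copies, the word and the traced strands together and fixes the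
coefficients, so the full trace does not depend on where the block begins. -/
theorem wtrs_copies_up_ch {n m : ℕ} {y : E} (hy : y ∈ Q.B.W 0 m) :
    Q.TR n (m + 1) (Q.S.copies F Q.M n (m + 1) * Q.B.up n y) = Q.ι (Q.ch m y) := by
  induction n with
  | zero => exact (Q.ι_ch hy).symm
  | succ n ih =>
    have hup : Q.B.up n y ∈ Q.B.W n (n + m) := by
      have := Q.B.up_mem hy n
      rwa [zero_add, add_comm m] at this
    rw [← Q.S.conjUp_copies F Q.M_mem n (m + 1) le_rfl, Q.B.up_succ,
      ← Q.conjUp_W (k := n + (m + 1)) (by omega) hup, ← map_mul]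
    exact (wtrs_conjUp Q.skew Q.compat (mul_mem (Q.S.copies_mem_loc F Q.M_mem _ _)
      (Q.W_mem_loc (by omega) hup))).trans ((congrArg _ ih).trans (Q.S.conjUp_ι F _ _))

/-- The same translation with the first strand of the block left open. This is what makes a product
with a shifted word depend only on the descendant of that word. -/
theorem wtrs_copies_up_D {n m : ℕ} {y : E} (hy : y ∈ Q.B.W 0 m) :
    Q.TR (n + 1) m (Q.S.copies F Q.M n (m + 1) * Q.B.up n y) = Q.S.copy F n (Q.D m y) := by
  induction n with
  | zero => rfl
  | succ n ih =>
    have hup : Q.B.up n y ∈ Q.B.W n (n + m) := by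
      have := Q.B.up_mem hy n
      rwa [zero_add, add_comm m] at this
    rw [← Q.S.conjUp_copies F Q.M_mem n (m + 1) (show n + (m + 1) ≤ n + 1 + m by omega),
      Q.B.up_succ, ← Q.conjUp_W (k := n + 1 + m) (by omega) hup, ← map_mul]
    exact (wtrs_conjUp Q.skew Q.compat (mul_mem (Q.S.loc_mono (by omega)
      (Q.S.copies_mem_loc F Q.M_mem _ _)) (Q.W_mem_loc (by omega) hup))).trans
        ((congrArg _ ih).trans (Q.S.conjUp_copy F (Q.D_mem_loc hy) le_rfl))

omit [Nontrivial E] in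
theorem Mp_mul_up {n m : ℕ} {w y : E} (hw : w ∈ Q.B.W 0 n) :
    Q.Mp (n + m + 2) * (w * Q.B.up (n + 1) y) =
      (Q.Mp (n + 1) * w) * (Q.S.copies F Q.M (n + 1) (m + 1) * Q.B.up (n + 1) y) := by
  have : Q.Mp (n + m + 2) = Q.Mp (n + 1) * Q.S.copies F Q.M (n + 1) (m + 1) := by
    have := Q.S.copies_add F Q.M 0 (n + 1) (m + 1)
    rwa [zero_add, show n + 1 + (m + 1) = n + m + 2 by omega] at this
  rw [this, ← mul_assoc, mul_assoc (Q.Mp (n + 1)), ← Q.W_comm_copies (Or.inl le_rfl) hw]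
  simp only [mul_assoc]

/-- With `a = 0` this is multiplicativity of `ch`, with `a = 1` the factorization of descendants. -/
theorem TR_mul_up {a n m : ℕ} {w y : E} (hw : w ∈ Q.B.W 0 n) (hy : y ∈ Q.B.W 0 m) (p : ℕ)
    (hp : a + p = n + 1) : Q.TR a (p + (m + 1)) (Q.Mp (n + m + 2) * (w * Q.B.up (n + 1) y)) =
      Q.TR a p (Q.Mp (n + 1) * w) * Q.ι (Q.ch m y) := by
  rw [wtrs_add, hp, Q.Mp_mul_up hw, Q.S.wtrs_mul_left _ _ (mul_mem (Q.Mp_mem_loc _)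
    (Q.W_mem_loc le_rfl hw)), Q.wtrs_copies_up_ch hy, Q.S.wtrs_mul_right _ _ (Q.S.ι_mem_loc _ _)]

/-- Conjugation by $R$ moves the weighted trace one strand down, which reduces the braid to $r_0$,
whose trace is $1$. -/
theorem wtr_S (n : ℕ) : Q.S.wtr (skewD R.op) (n + 1) (Q.B.S n) = 1 := by
  induction n with
  | zero => exact wtr_two Q.skew (by omega)
  | succ n ih =>
    rw [Q.B.S_succ]
    refine Eq.trans ?_ ih
    exact wtr_conj Q.skew R.inv_mul_op (conj_rel_of_compatible R.op_mul_inv R.inv_mul_op R.ybe.symm)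
      (by omega) (Q.S.mem_loc.1 (Q.W_mem_loc le_rfl (Q.B.S_mem n)) _ (by omega))

/-- The coefficient of `K` in `M₁ M₂ K`. -/
noncomputable def zK : E :=
  ((q - q⁻¹)⁻¹ * (μ⁻¹ - μ + (q - q⁻¹)))⁻¹ • Q.S.tr 0 (Q.S.tr 1 (Q.B.k 0 * Q.Mp 2))

omit [Nontrivial E] in
theorem zK_mem (k : ℕ) : Q.zK ∈ Q.S.cen k := by
  refine Subalgebra.smul_mem _ ?_ _
  rcases k with _ | _ | k
  · exact Q.S.tr_mem_cen_self _ _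
  · exact Q.S.tr_mem_cen (Q.S.tr_mem_cen_self _ _)
  · exact Q.S.tr_mem_cen (Q.S.tr_mem_cen (mul_mem (Q.S.two_mem_cen (by omega) (by omega) _)
      (Q.S.mem_loc.1 (Q.Mp_mem_loc 2) _ (by omega))))

omit [Nontrivial E] in
include Q in
theorem rank_one_bmwK : (∃ s, IsUnit (rowMat (bmwK R q μ) s)) ∧ ∀ s t s' t',
    bmwK R q μ s t * bmwK R q μ s' t' = bmwK R q μ s t' * bmwK R q μ s' t :=
  rank_one Q.skew Q.strict (inv_ne_zero Q.bmw.μ_ne_zero) Q.bmw.K_ne_zero Q.bmw.pair.krk₁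
    Q.bmw.pair.krk₂

-- The product $M_{\overline1}M_{\overline2}$ commutes with $K$, and $K$ is a nonzero multiple of
-- $K^2$. Sandwiching it between two operators of rank one gives $K$ times a trace.
omit [Nontrivial E] in
theorem Mp_two_mul_k : Q.Mp 2 * Q.B.k 0 = Q.B.k 0 * Q.zK := by
  have h := two_mul_mul_two Q.S Q.rank_one_bmwK.2 zero_ne_one (Q.Mp 2)
  have hk : Q.S.two 0 1 (bmwK R q μ) = Q.B.k 0 := rfl
  have hδ := Q.bmw.trace_ne_zero
  rw [hk, Q.W_comm_copies (a := 0) (b := 1) (by omega) (Q.B.k_mem le_rfl one_pos), mul_assoc,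
    Q.B.kk_eq, mul_smul_comm, ← Q.W_comm_copies (a := 0) (b := 1) (by omega)
      (Q.B.k_mem le_rfl one_pos)] at h
  rw [← Q.W_comm_copies (a := 0) (b := 1) (by omega) (Q.B.k_mem le_rfl one_pos), zK, mul_smul_comm,
    ← h, smul_smul, inv_mul_cancel₀ hδ, one_smul]

omit [Nontrivial E] in
theorem D_k_eq : Q.D 1 (Q.B.k 0) = μ • Q.zK := by
  rw [D_apply, Q.Mp_two_mul_k, wtrs_one, Q.S.wtr_mul_right _ (Q.zK_mem 1)]
  have : Q.S.wtr (skewD R.op) 1 (Q.B.k 0) = μ • 1 :=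
    wtr_two_bmwK Q.bmw Q.skew Q.rank_one_bmwK.1 zero_ne_one
  rw [this, smul_mul_assoc, _root_.one_mul]

/-- The trace of the weight matrix. -/
noncomputable abbrev dim (_ : QuantumStrands A E R F q μ) : ℂ :=
  μ * ((q - q⁻¹)⁻¹ * (μ⁻¹ - μ + (q - q⁻¹)))

omit [Nontrivial E] in
theorem dim_ne_zero : Q.dim ≠ 0 := mul_ne_zero Q.bmw.μ_ne_zero Q.bmw.trace_ne_zero

-- The element `zK` commutes with all matrix units but is not yet known to be a coefficient. Tracing
-- over the first strand multiplies it by the trace of the weight, a nonzero number, and full traces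
-- of words are coefficients.
omit [Nontrivial E] in
theorem D_k_eq_ch : Q.D 1 (Q.B.k 0) = Q.ι (Q.dim⁻¹ • Q.ch 1 (Q.B.k 0)) := by
  have h := Q.ι_ch (n := 1) (Q.B.k_mem le_rfl one_pos)
  have e : Q.TR 0 2 (Q.Mp 2 * Q.B.k 0) = Q.S.wtr (skewD R.op) 0 (Q.D 1 (Q.B.k 0)) := rfl
  rw [e, D_k_eq, ← _root_.one_mul (μ • Q.zK), Q.S.wtr_mul_right _
    (Subalgebra.smul_mem _ (Q.zK_mem 0) _), wtr_one_eq Q.bmw Q.skew Q.rank_one_bmwK.1,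
    smul_mul_assoc, _root_.one_mul] at h
  rw [map_smul, h, D_k_eq, smul_smul (Q.dim⁻¹), inv_mul_cancel₀ Q.dim_ne_zero, one_smul]

/-- The descent system of the quantum matrix algebra. -/
noncomputable def descentSystem : DescentSystem Q.B A where
  ι := Q.ι
  D := Q.D
  ch := Q.ch
  L := Q.L
  D_conj {n p w} hp hw := by
    rcases n with _ | n
    · obtain ⟨c, rfl⟩ := Q.B.W_self 0 hw
      rw [mul_smul_comm, smul_mul_assoc, mul_one, _root_.one_mul]
    · rw [D_apply, D_apply, ← mul_assoc, ← mul_assoc, ← Q.W_comm_copies (by omega) hp, mul_assoc,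
        Q.TR_conj (a := 1) (m := n) (by rwa [add_comm])]
  D_mul {n m w y} hw hy := by
    have := Q.TR_mul_up (a := 1) hw hy n (by omega)
    exact this
  ch_conj {n p w} hp hw := by
    apply Q.ι_injective
    rw [Q.ι_ch (mul_mem hp hw), Q.ι_ch (mul_mem hw hp), ← mul_assoc, ← mul_assoc,
      ← Q.W_comm_copies (by omega) hp, mul_assoc, Q.TR_conj (a := 0) (m := n) (by rwa [zero_add])]
  ch_mul {n m w y} hw hy := by
    apply Q.ι_injective
    rw [Q.ι_ch (mul_mem (Q.B.W_mono le_rfl (by omega) hw)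
      (Q.B.up_mem' hy _ (by omega) (by omega))), map_mul Q.ι, Q.ι_ch hw]
    have := Q.TR_mul_up (a := 0) hw hy (n + 1) (by omega)
    rw [← this, show n + 1 + (m + 1) = n + m + 1 + 1 by omega]
  D_L {n m w y s} hw hy hs := by
    rw [D_apply, L_apply, ← mul_assoc, show n + m + 1 + 1 = n + m + 2 by omega, Q.Mp_mul_up hw,
      show n + m + 1 = n + 1 + m by omega, wtrs_add, add_comm 1 (n + 1),
      Q.S.wtrs_mul_right _ _ (Q.W_mem_loc le_rfl hs), Q.S.wtrs_mul_left _ _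
      (Q.S.loc_mono (Nat.le_succ _) (mul_mem (Q.Mp_mem_loc _) (Q.W_mem_loc le_rfl hw))),
      Q.wtrs_copies_up_D hy]
  L_ι {n w s} hw hs X x := by
    rw [L_apply, map_mul (Q.S.copy F (n + 1)), copy_ι]
    have e : Q.Mp (n + 1) * w * (Q.S.copy F (n + 1) X * Q.ι x) * s =
        Q.Mp (n + 1) * w * Q.S.copy F (n + 1) X * s * Q.ι x := by
      rw [mul_assoc _ s, Q.W_comm_ι hs]
      simp only [mul_assoc]
    exact (congrArg _ e).trans (Q.S.wtrs_mul_right _ _ (Q.S.ι_mem_loc _ _) _)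
  L_one {n w} hw := by
    rw [L_apply, map_one, mul_one, D_apply, wtrs_succ, Q.S.wtr_mul_left _ (Q.S.mem_loc.1
      (mul_mem (Q.Mp_mem_loc (n + 1)) (Q.W_mem_loc le_rfl hw)) _ (by omega)), add_comm 1 n,
      Q.wtr_S, mul_one]
  g := Q.dim⁻¹ • Q.ch 1 (Q.B.k 0)
  D_k := Q.D_k_eq_ch
  g_ch := ⟨_, rfl⟩
  L_k_one := by
    have : Q.S.wtr (skewD R.op) 1 (Q.B.k 0) = μ • 1 :=
      wtr_two_bmwK Q.bmw Q.skew Q.rank_one_bmwK.1 zero_ne_one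
    rw [L_apply, map_one, mul_one, mul_one, wtrs_one, Q.S.wtr_mul_left _ (Q.S.mem_loc.1
      (Q.Mp_mem_loc 1) _ le_rfl), this, mul_smul_comm, mul_one, D_apply, mul_one, wtrs_zero]

end QuantumStrands

/-! ### Realization by operators on functions of infinite sequences -/

/-- The first `n` letters of a sequence. -/
def seqInit {N : ℕ} (n : ℕ) (i : ℕ → Fin N) : Fin n → Fin N := fun k => i k

/-- Replacing the first `n` letters of a sequence. -/
def seqReplace {N : ℕ} (n : ℕ) (i : ℕ → Fin N) (j : Fin n → Fin N) : ℕ → Fin N := fun k =>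
  if h : k < n then j ⟨k, h⟩ else i k

section Sequences

variable {N : ℕ}

theorem seqInit_seqReplace (n : ℕ) (i : ℕ → Fin N) (j : Fin n → Fin N) :
    seqInit n (seqReplace n i j) = j := by
  funext k; simp [seqInit, seqReplace]

theorem seqReplace_seqReplace (n : ℕ) (i : ℕ → Fin N) (j j' : Fin n → Fin N) :
    seqReplace n (seqReplace n i j) j' = seqReplace n i j' := by
  funext k; simp only [seqReplace]; split_ifs <;> rfl

theorem seqReplace_seqInit (n : ℕ) (i : ℕ → Fin N) : seqReplace n i (seqInit n i) = i := by
  funext k; simp only [seqReplace, seqInit]; split_ifs <;> rfl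

theorem seqReplace_snoc (n : ℕ) (i : ℕ → Fin N) (j : Fin n → Fin N) (x z : Fin N) :
    Function.update (seqReplace (n + 1) i (Fin.snoc j x)) n z =
      seqReplace n (Function.update i n z) j := by
  funext k
  simp only [Function.update_apply, seqReplace]
  rcases lt_trichotomy k n with h | rfl | h
  · simp [h, h.ne, Nat.lt_succ_of_lt h, Fin.snoc]
  · simp
  · simp [h.ne', not_lt.2 h.le, show ¬ k < n + 1 by omega]

theorem seqInit_update (n : ℕ) (i : ℕ → Fin N) (y : Fin N) :
    seqInit (n + 1) (Function.update i n y) = Fin.snoc (seqInit n i) y := by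
  funext k
  refine Fin.lastCases ?_ (fun k => ?_) k
  · simp [seqInit]
  · simp [seqInit, k.2.ne]

end Sequences

section Action

variable (N : ℕ) (A : Type*) [Ring A] [Algebra ℂ A]

/-- The endomorphisms of the space of `A`-valued functions of infinitely many indices. -/
abbrev SeqEnd := Module.End ℂ ((ℕ → Fin N) → A)

variable {N}

/-- The matrix unit in the strand `k`. -/
def seqUnit (k : ℕ) (a b : Fin N) : SeqEnd N A where
  toFun f i := if i k = a then f (Function.update i k b) else 0
  map_add' f g := by funext i; simp only [Pi.add_apply]; split_ifs <;> simp
  map_smul' c f := by funext i; simp only [Pi.smul_apply]; split_ifs <;> simp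

variable {A}

theorem seqUnit_apply (k : ℕ) (a b : Fin N) (f : (ℕ → Fin N) → A) (i : ℕ → Fin N) :
    seqUnit A k a b f i = if i k = a then f (Function.update i k b) else 0 := rfl

variable (N A)

/-- Left multiplication by coefficients. -/
def seqCoeff : A →ₐ[ℂ] SeqEnd N A where
  toFun x :=
    { toFun := fun f i => x * f i
      map_add' := fun f g => by funext i; exact mul_add _ _ _
      map_smul' := fun c f => by funext i; exact mul_smul_comm _ _ _ }
  map_one' := by ext f i; exact one_mul _
  map_mul' x y := by ext f i; exact mul_assoc _ _ _
  map_zero' := by ext f i; exact zero_mul _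
  map_add' x y := by ext f i; exact add_mul _ _ _
  commutes' c := by ext f i; exact (Algebra.smul_def c (f i)).symm

variable {N A}

theorem seqCoeff_apply (x : A) (f : (ℕ → Fin N) → A) (i : ℕ → Fin N) :
    seqCoeff N A x f i = x * f i := rfl

/-- Adding a letter in front of a sequence. -/
def seqCons (a : Fin N) (t : ℕ → Fin N) : ℕ → Fin N
  | 0 => a
  | n + 1 => t n

theorem seqCons_tail (i : ℕ → Fin N) : seqCons (i 0) (fun n => i (n + 1)) = i := by
  funext n; cases n <;> rfl

theorem seqCons_update (i : ℕ → Fin N) (k : ℕ) (b : Fin N) :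
    seqCons (i 0) (Function.update (fun n => i (n + 1)) k b) = Function.update i (k + 1) b := by
  funext n
  cases n with
  | zero => simp [seqCons]
  | succ n => simp [seqCons, Function.update_apply]

variable (N A)

/-- The shift of strands. -/
def seqShift : SeqEnd N A →ₐ[ℂ] SeqEnd N A where
  toFun X :=
    { toFun := fun f i => X (fun t => f (seqCons (i 0) t)) fun n => i (n + 1)
      map_add' := fun f g => by funext i; exact congrFun (map_add X _ _) _
      map_smul' := fun c f => by funext i; exact congrFun (map_smul X c _) _ }
  map_one' := by
    ext f i
    exact congrArg f (seqCons_tail i)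
  map_mul' X Y := rfl
  map_zero' := rfl
  map_add' X Y := rfl
  commutes' c := by
    ext f i
    exact congrArg (fun j => c • f j) (seqCons_tail i)

/-- The strand system on the functions of infinitely many indices. -/
def seqStrands [NeZero N] : StrandSystem N A (SeqEnd N A) where
  e := seqUnit A
  e_mul k a b c d := by
    ext f i
    simp only [Module.End.mul_apply, seqUnit_apply, Function.update_self, Function.update_idem]
    by_cases h : b = c
    · simp [h, seqUnit_apply]
    · simp [h]
  e_comm k l h a b c d := by
    ext f i
    simp only [Module.End.mul_apply, seqUnit_apply, Function.update_of_ne h,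
      Function.update_of_ne h.symm, Function.update_comm h]
    split_ifs <;> rfl
  sum_e k := by
    ext f i
    simp only [LinearMap.sum_apply, Finset.sum_apply, seqUnit_apply, Finset.sum_ite_eq,
      Finset.mem_univ, if_true, Function.update_eq_self, Module.End.one_apply]
  ι := seqCoeff N A
  ι_injective x y h := by
    -- Evaluation at a constant sequence needs a letter, hence a space of positive dimension.
    have := congrFun (LinearMap.congr_fun h fun _ => (1 : A)) fun _ => 0
    simpa only [seqCoeff_apply, mul_one] using this
  ι_comm x k a b := by
    ext f i
    simp only [Module.End.mul_apply, seqUnit_apply, seqCoeff_apply, mul_ite, mul_zero]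
  sh := seqShift N A
  sh_e k a b := by
    ext f i
    show (if i (k + 1) = a then f (seqCons (i 0) (Function.update (fun n => i (n + 1)) k b)) else 0) = _
    rw [seqCons_update]; rfl

/-- The action of operators on the first `n` tensor factors. -/
def seqOp (n : ℕ) : TensorOp N n A →ₐ[ℂ] SeqEnd N A where
  toFun X :=
    { toFun := fun f i => ∑ j, X (seqInit n i) j * f (seqReplace n i j)
      map_add' := fun f g => by
        funext i; simp only [Pi.add_apply, mul_add, Finset.sum_add_distrib]
      map_smul' := fun c f => by
        funext i; simp only [Pi.smul_apply, mul_smul_comm, Finset.smul_sum, RingHom.id_apply] }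
  map_one' := by
    ext f i
    simp [Matrix.one_apply, seqReplace_seqInit]
  map_mul' X Y := by
    ext f i
    simp only [LinearMap.coe_mk, AddHom.coe_mk, Module.End.mul_apply, Matrix.mul_apply,
      Finset.sum_mul, Finset.mul_sum, seqInit_seqReplace, seqReplace_seqReplace, mul_assoc]
    exact Finset.sum_comm
  map_zero' := by ext f i; simp
  map_add' X Y := by ext f i; simp [add_mul, Finset.sum_add_distrib]
  commutes' c := by
    ext f i
    simp [Matrix.algebraMap_matrix_apply, seqReplace_seqInit, Algebra.smul_def]

variable {N A}

theorem seqOp_apply {n : ℕ} (X : TensorOp N n A) (f : (ℕ → Fin N) → A) (i : ℕ → Fin N) :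
    seqOp N A n X f i = ∑ j, X (seqInit n i) j * f (seqReplace n i j) := rfl

variable (N A)

/-- The action of matrices in the first strand. -/
def seqSite : Matrix (Fin N) (Fin N) A →ₐ[ℂ] SeqEnd N A where
  toFun X :=
    { toFun := fun f i => ∑ b, X (i 0) b * f (Function.update i 0 b)
      map_add' := fun f g => by
        funext i; simp only [Pi.add_apply, mul_add, Finset.sum_add_distrib]
      map_smul' := fun c f => by
        funext i; simp only [Pi.smul_apply, mul_smul_comm, Finset.smul_sum, RingHom.id_apply] }
  map_one' := by
    ext f i
    simp [Matrix.one_apply]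
  map_mul' X Y := by
    ext f i
    simp only [LinearMap.coe_mk, AddHom.coe_mk, Module.End.mul_apply, Matrix.mul_apply,
      Finset.sum_mul, Finset.mul_sum, Function.update_self, Function.update_idem, mul_assoc]
    exact Finset.sum_comm
  map_zero' := by ext f i; simp
  map_add' X Y := by ext f i; simp [add_mul, Finset.sum_add_distrib]
  commutes' c := by
    ext f i
    simp [Matrix.algebraMap_matrix_apply, Algebra.smul_def]

variable {N A}

theorem seqSite_apply (X : Matrix (Fin N) (Fin N) A) (f : (ℕ → Fin N) → A) (i : ℕ → Fin N) :
    seqSite N A X f i = ∑ b, X (i 0) b * f (Function.update i 0 b) := rfl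

theorem seqSite_injective : Function.Injective (seqSite N A) := by
  intro X Y h
  ext a b
  have key : ∀ Z : Matrix (Fin N) (Fin N) A,
      seqSite N A Z (fun i => if i 0 = b then 1 else 0) (fun _ => a) = Z a b := by
    intro Z
    simp [seqSite_apply]
  rw [← key X, h, key]

theorem seqOp_firstSite {n : ℕ} (M : Matrix (Fin N) (Fin N) A) :
    seqOp N A (n + 1) (firstSite M) = seqSite N A M := by
  ext f i
  rw [seqOp_apply, seqSite_apply, ← (Fin.consEquiv fun _ : Fin (n + 1) => Fin N).sum_comp,
    Fintype.sum_prod_type]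
  refine Finset.sum_congr rfl fun b _ => ?_
  rw [Finset.sum_eq_single fun k : Fin n => i (k + 1)]
  · have e : seqReplace (n + 1) i (Fin.cons b fun k : Fin n => i (k + 1)) =
        Function.update i 0 b := by
      funext k
      cases k with
      | zero => simp [seqReplace]
      | succ k =>
        rw [Function.update_of_ne (Nat.succ_ne_zero k)]
        simp only [seqReplace]
        split_ifs
        · rfl
        · rfl
    simp [firstSite, seqInit, Fin.consEquiv, e]
  · intro j _ hj
    have : ¬ ∀ k : Fin n, i (k + 1) = j k := fun h => hj (funext fun k => (h k).symm)
    simp [firstSite, seqInit, Fin.consEquiv, this]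
  · simp

theorem seqSite_mem_loc [NeZero N] (M : Matrix (Fin N) (Fin N) A) :
    seqSite N A M ∈ (seqStrands N A).loc 1 := by
  refine (seqStrands N A).mem_loc.2 fun k hk => (seqStrands N A).mem_cen.2 fun a b => ?_
  ext f i
  have h0 : (0 : ℕ) ≠ k := by omega
  show seqUnit A k a b (seqSite N A M f) i = seqSite N A M (seqUnit A k a b f) i
  simp only [seqUnit_apply, seqSite_apply, Function.update_of_ne h0, Function.update_of_ne h0.symm,
    Function.update_comm h0.symm]
  split_ifs <;> simp

theorem seqStrands_two_apply [NeZero N] (k : ℕ) (X : TensorOp N 2 ℂ) (f : (ℕ → Fin N) → A)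
    (i : ℕ → Fin N) : (seqStrands N A).two k (k + 1) X f i =
      ∑ c, ∑ d, X ![i k, i (k + 1)] ![c, d] •
        f (Function.update (Function.update i k c) (k + 1) d) := by
  have h : ∀ a b c d, ((seqStrands N A).e k a c * (seqStrands N A).e (k + 1) b d) f i =
      if i k = a then if i (k + 1) = b then
        f (Function.update (Function.update i k c) (k + 1) d) else 0 else 0 := by
    intro a b c d
    show seqUnit A k a c (seqUnit A (k + 1) b d f) i = _
    simp only [seqUnit_apply, Function.update_of_ne (Nat.succ_ne_self k)]
  simp only [StrandSystem.two, LinearMap.sum_apply, Finset.sum_apply, LinearMap.smul_apply,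
    Pi.smul_apply, h, smul_ite, smul_zero]
  rw [Finset.sum_eq_single (i k) (by intro z _ hz; simp [Ne.symm hz]) (by simp),
    Finset.sum_eq_single (i (k + 1)) (by intro z _ hz; simp [Ne.symm hz]) (by simp)]
  simp

theorem seqOp_opAt [NeZero N] {n : ℕ} (m : Fin n) (X : TensorOp N 2 ℂ) :
    seqOp N A (n + 1) (coeffs A (opAt X m)) = (seqStrands N A).two m (m + 1) X := by
  ext f i
  rw [seqStrands_two_apply, seqOp_apply]
  refine Eq.symm ((StrandSystem.sum_fin_two fun z : Fin 2 → Fin N =>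
    X ![i m, i (m + 1)] z •
      f (Function.update (Function.update i m (z 0)) (m + 1) (z 1))).symm.trans ?_)
  -- Only multi-indices that agree with $i$ off the two positions contribute; `g` lists them.
  set g : (Fin 2 → Fin N) → (Fin (n + 1) → Fin N) := fun z =>
    Function.extend (adj m) z (seqInit (n + 1) i) with hg
  have hgi : ∀ z, g z ∘ adj m = z := fun z => by
    funext a; simp [hg, (adj_injective m).extend_apply]
  have hi : seqInit (n + 1) i ∘ adj m = ![i m, i (m + 1)] := by
    funext a; fin_cases a <;> simp [seqInit, adj]
  have hout : ∀ z p, p ∉ Set.range (adj m) → g z p = seqInit (n + 1) i p := fun z p hp =>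
    Function.extend_apply' _ _ _ fun ⟨a, ha⟩ => hp ⟨a, ha⟩
  refine Finset.sum_of_injOn g (fun z _ z' _ h => by rw [← hgi z, h, hgi]) (by simp) ?_ ?_
  · intro j _ hj
    have : ¬ ∀ p, p ∉ Set.range (adj m) → seqInit (n + 1) i p = j p := by
      intro h
      apply hj
      refine ⟨j ∘ adj m, by simp, ?_⟩
      funext p
      by_cases hp : p ∈ Set.range (adj m)
      · obtain ⟨a, rfl⟩ := hp
        exact congrFun (hgi (j ∘ adj m)) a
      · rw [hout _ p hp, h p hp]
    simp only [coeffs, Matrix.map_apply, opAt, place, Matrix.of_apply]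
    rw [if_neg this, map_zero, zero_mul]
  · intro z _
    have h1 : ∀ p, p ∉ Set.range (adj m) → seqInit (n + 1) i p = g z p := fun p hp =>
      (hout z p hp).symm
    have h2 : seqReplace (n + 1) i (g z) =
        Function.update (Function.update i m (z 0)) (m + 1) (z 1) := by
      funext k
      have hz0 : g z m.castSucc = z 0 := congrFun (hgi z) 0
      have hz1 : g z m.succ = z 1 := congrFun (hgi z) 1
      by_cases hk1 : k = m + 1
      · subst hk1
        rw [Function.update_self, ← hz1]
        simp only [seqReplace, dif_pos, show (m : ℕ) + 1 < n + 1 by omega]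
        rfl
      · rw [Function.update_of_ne hk1]
        by_cases hk : k = m
        · subst hk
          rw [Function.update_self, ← hz0]
          simp only [seqReplace, show (m : ℕ) < n + 1 by omega, dif_pos]
          rfl
        · rw [Function.update_of_ne hk]
          simp only [seqReplace]
          split_ifs with h
          · rw [hout]
            · rfl
            · rintro ⟨a, ha⟩
              have := congrArg Fin.val ha
              fin_cases a <;> simp [adj] at this <;> omega
          · rfl
    rw [h2]
    simp only [coeffs, Matrix.map_apply, opAt, place, Matrix.of_apply]
    rw [if_pos h1, hgi, hi, Algebra.smul_def]

end Action

/-! ### Weighted traces in coordinates -/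

section Traces

variable {N : ℕ} [NeZero N] {A : Type*} [Ring A] [Algebra ℂ A]

/-- The weighted trace over the last factor. -/
def lastTrace (D : Matrix (Fin N) (Fin N) ℂ) {n : ℕ} (X : TensorOp N (n + 1) A) : TensorOp N n A :=
  Matrix.of fun i j => ∑ x, ∑ y, D x y • X (Fin.snoc i y) (Fin.snoc j x)

theorem seqStrands_wtr_apply (D : Matrix (Fin N) (Fin N) ℂ) (n : ℕ) (X : SeqEnd N A)
    (f : (ℕ → Fin N) → A) (i : ℕ → Fin N) : (seqStrands N A).wtr D n X f i =
      ∑ x, ∑ y, D x y • X (seqUnit A n x (i n) f) (Function.update i n y) := by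
  have htr : ∀ Y : SeqEnd N A, (seqStrands N A).tr n Y f i =
      ∑ x, Y (seqUnit A n x (i n) f) (Function.update i n x) := by
    intro Y
    simp only [StrandSystem.tr_apply, LinearMap.sum_apply, Finset.sum_apply]
    refine Finset.sum_congr rfl fun x _ => ?_
    have : ∀ z, ((seqStrands N A).e n z x * Y * (seqStrands N A).e n x z) f i =
        if i n = z then Y (seqUnit A n x z f) (Function.update i n x) else 0 := fun z => rfl
    simp only [this, Finset.sum_ite_eq, Finset.mem_univ, if_true]
  rw [StrandSystem.wtr_apply, htr]
  refine Finset.sum_congr rfl fun x _ => ?_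
  simp only [StrandSystem.one, Finset.sum_mul, smul_mul_assoc, LinearMap.sum_apply,
    Finset.sum_apply, LinearMap.smul_apply, Pi.smul_apply]
  have : ∀ a b, ((seqStrands N A).e n a b * X) (seqUnit A n x (i n) f) (Function.update i n x) =
      if x = a then X (seqUnit A n x (i n) f) (Function.update i n b) else 0 := by
    intro a b
    show seqUnit A n a b _ _ = _
    rw [seqUnit_apply, Function.update_self, Function.update_idem]
  simp only [this, smul_ite, smul_zero]
  rw [Finset.sum_comm]
  simp only [Finset.sum_ite_eq, Finset.mem_univ, if_true]

/-- Traces are taken one strand at a time from the last, so that each step stays among operators on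
finitely many factors. -/
theorem wtr_seqOp (D : Matrix (Fin N) (Fin N) ℂ) {n : ℕ} (X : TensorOp N (n + 1) A) :
    (seqStrands N A).wtr D n (seqOp N A (n + 1) X) = seqOp N A n (lastTrace D X) := by
  ext f i
  rw [seqStrands_wtr_apply, seqOp_apply]
  have h : ∀ x y, seqOp N A (n + 1) X (seqUnit A n x (i n) f) (Function.update i n y) =
      ∑ j, X (Fin.snoc (seqInit n i) y) (Fin.snoc j x) * f (seqReplace n i j) := by
    intro x y
    rw [seqOp_apply, ← (Fin.snocEquiv fun _ : Fin (n + 1) => Fin N).sum_comp,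
      Fintype.sum_prod_type]
    have h2 : ∀ x' (j : Fin n → Fin N), X (seqInit (n + 1) (Function.update i n y))
        ((Fin.snocEquiv fun _ : Fin (n + 1) => Fin N) (x', j)) *
        seqUnit A n x (i n) f (seqReplace (n + 1) (Function.update i n y)
          ((Fin.snocEquiv fun _ : Fin (n + 1) => Fin N) (x', j))) =
        if x' = x then X (Fin.snoc (seqInit n i) y) (Fin.snoc j x') * f (seqReplace n i j) else 0 := by
      intro x' j
      have e1 : (Fin.snocEquiv fun _ : Fin (n + 1) => Fin N) (x', j) = Fin.snoc j x' := rfl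
      have e2 : seqReplace (n + 1) (Function.update i n y) (Fin.snoc j x') n = x' := by
        simp [seqReplace, Fin.snoc]
      rw [e1, seqInit_update, seqUnit_apply, e2, seqReplace_snoc, Function.update_idem,
        Function.update_eq_self, mul_ite, mul_zero]
    simp only [h2]
    rw [Finset.sum_comm]
    simp only [Finset.sum_ite_eq', Finset.mem_univ, if_true]
  simp only [h, lastTrace, Matrix.of_apply, Finset.sum_mul, Finset.smul_sum, smul_mul_assoc]
  rw [Finset.sum_congr rfl fun x _ => Finset.sum_comm]
  exact Finset.sum_comm

omit [NeZero N] in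
theorem sum_fin_succ_snoc {n : ℕ} {P : Type*} [AddCommMonoid P] (f : (Fin (n + 1) → Fin N) → P) :
    ∑ j, f j = ∑ j : Fin n → Fin N, ∑ x, f (Fin.snoc j x) := by
  rw [← (Fin.snocEquiv fun _ : Fin (n + 1) => Fin N).sum_comp, Fintype.sum_prod_type,
    Finset.sum_comm]
  rfl

omit [NeZero N] in
theorem fullTrace_succ (D : Matrix (Fin N) (Fin N) ℂ) {n : ℕ} (X : TensorOp N (n + 1) A) :
    fullTrace D X = fullTrace D (lastTrace D X) := by
  simp only [fullTrace, sum_fin_succ_snoc, lastTrace, Matrix.of_apply, Fin.prod_univ_castSucc,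
    Fin.snoc_castSucc, Fin.snoc_last, Finset.smul_sum, mul_smul]
  refine Finset.sum_congr rfl fun x _ => ?_
  exact Finset.sum_comm

omit [NeZero N] in
theorem tailTrace_succ (D : Matrix (Fin N) (Fin N) ℂ) {n : ℕ} (X : TensorOp N (n + 1 + 1) A) :
    tailTrace D X = tailTrace D (lastTrace D X) := by
  ext a b
  simp only [tailTrace, sum_fin_succ_snoc, lastTrace, Matrix.of_apply, Fin.prod_univ_castSucc,
    Fin.snoc_castSucc, Fin.snoc_last, Finset.smul_sum, mul_smul, Fin.cons_snoc_eq_snoc_cons]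
  refine Finset.sum_congr rfl fun x _ => ?_
  exact Finset.sum_comm

theorem wtrs_zero_seqOp (D : Matrix (Fin N) (Fin N) ℂ) {n : ℕ} (X : TensorOp N n A) :
    (seqStrands N A).wtrs D 0 n (seqOp N A n X) = (seqStrands N A).ι (fullTrace D X) := by
  induction n with
  | zero =>
    ext f i
    show seqOp N A 0 X f i = fullTrace D X * f i
    rw [seqOp_apply]
    simp only [fullTrace, Finset.univ_unique, Finset.sum_singleton, Finset.univ_eq_empty, Finset.prod_empty, one_smul]
    congr 2
    exact Subsingleton.elim _ _
  | succ n ih => rw [StrandSystem.wtrs_succ, zero_add, wtr_seqOp, ih, fullTrace_succ]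

theorem wtrs_one_seqOp (D : Matrix (Fin N) (Fin N) ℂ) {n : ℕ} (X : TensorOp N (n + 1) A) :
    (seqStrands N A).wtrs D 1 n (seqOp N A (n + 1) X) = seqSite N A (tailTrace D X) := by
  induction n with
  | zero =>
    have : X = firstSite (tailTrace D X) := by
      ext i j
      simp only [firstSite, tailTrace, Matrix.of_apply, Finset.univ_unique, Finset.sum_singleton,
        Finset.univ_eq_empty, Finset.prod_empty, one_smul, IsEmpty.forall_iff, if_true]
      congr 1 <;> · funext k; fin_cases k; rfl
    conv_lhs => rw [this]
    exact seqOp_firstSite _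
  | succ n ih =>
    rw [StrandSystem.wtrs_succ, add_comm 1 n, wtr_seqOp, ih, ← tailTrace_succ]

end Traces

/-! ### Matrix copies in coordinates -/

section MatrixCopies

variable {N : ℕ} [NeZero N] {A : Type*} [Ring A] [Algebra ℂ A]

theorem seqOp_matrixCopy (F : RMatrix N) (M : Matrix (Fin N) (Fin N) A) {n : ℕ} (i : Fin (n + 1)) :
    seqOp N A (n + 1) (matrixCopy F M i) = (seqStrands N A).copy F i (seqSite N A M) := by
  induction i using Fin.induction with
  | zero => exact seqOp_firstSite M
  | succ k ih =>
    have e : matrixCopy F M k.succ = coeffs A (opAt F.op k) * matrixCopy F M k.castSucc *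
        coeffs A (opAt F.inv k) := rfl
    rw [e, map_mul, map_mul, seqOp_opAt, seqOp_opAt, ih]
    rfl

omit [NeZero N] in
theorem StrandSystem.prod_ofFn_copy {A E : Type*} [Ring A] [Algebra ℂ A] [Ring E] [Algebra ℂ E]
    (S : StrandSystem N A E) (F : RMatrix N) (M : E) (n : ℕ) :
    (List.ofFn fun i : Fin n => S.copy F i M).prod = S.copies F M 0 n := by
  induction n with
  | zero => rfl
  | succ n ih =>
    rw [List.ofFn_succ', List.concat_eq_append, List.prod_append, List.prod_singleton,
      StrandSystem.copies_succ, zero_add]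
    exact congrArg (· * _) ih

theorem seqOp_copyProd (F : RMatrix N) (M : Matrix (Fin N) (Fin N) A) (n : ℕ) :
    seqOp N A (n + 1) (copyProd F M n) = (seqStrands N A).copies F (seqSite N A M) 0 (n + 1) := by
  rw [← StrandSystem.prod_ofFn_copy, copyProd, map_list_prod, List.map_ofFn]
  congr 2
  funext i
  exact seqOp_matrixCopy F M i

omit [NeZero N] in
theorem opAt_eq_self (X : TensorOp N 2 ℂ) : opAt X (0 : Fin 1) = X := by
  have h : adj (0 : Fin 1) = id := by funext a; fin_cases a <;> rfl
  ext i j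
  simp [opAt, h, place]

end MatrixCopies

/-! ### Braids as words of the tower -/

section Words

variable {N : ℕ} [NeZero N] (A : Type*) [Ring A] [Algebra ℂ A] (R : RMatrix N)

/-- The representation of the braid group by operators on the strands. -/
def braidWord (n : ℕ) : Braid n →* SeqEnd N A :=
  ((seqOp N A (n + 1)).toRingHom.toMonoidHom.comp
    ((algebraMap ℂ A).mapMatrix (m := Fin (n + 1) → Fin N)).toMonoidHom).comp
      ((Units.coeHom _).comp (R.rep n))

omit [NeZero N] in
theorem braidWord_apply {n : ℕ} (α : Braid n) :
    braidWord A R n α = seqOp N A (n + 1) (coeffs A (R.rep n α).val) := rfl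

omit [NeZero N] in
theorem rep_σ {n : ℕ} (i : Fin n) : R.rep n (Braid.σ i) = R.unitAt i := by
  simp [RMatrix.rep, Braid.lift, Braid.σ]

theorem braidWord_σ {n : ℕ} (i : Fin n) :
    braidWord A R n (Braid.σ i) = (seqStrands N A).two i (i + 1) R.op := by
  rw [braidWord_apply, rep_σ]
  exact seqOp_opAt i R.op

theorem braidWord_σ_inv {n : ℕ} (i : Fin n) :
    braidWord A R n (Braid.σ i)⁻¹ = (seqStrands N A).two i (i + 1) R.inv := by
  rw [braidWord_apply, map_inv, rep_σ]
  exact seqOp_opAt i R.inv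

/-- The target is only a monoid, but a homomorphism from a group takes values in the units, where
the presentation applies. -/
theorem Braid.hom_ext {n : ℕ} {H : Type*} [Monoid H] {f g : Braid n →* H}
    (h : ∀ i, f (Braid.σ i) = g (Braid.σ i)) : f = g := by
  have : f.toHomUnits = g.toHomUnits := PresentedGroup.ext fun i => Units.ext (h i)
  ext x
  exact congrArg Units.val (DFunLike.congr_fun this x)

theorem shift_σ {m n s : ℕ} (h : m + s ≤ n) (i : Fin m) :
    Braid.shift s h (Braid.σ i) = Braid.σ ⟨i + s, by omega⟩ := by
  simp [Braid.shift, Braid.lift, Braid.σ]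

variable {R} {q μ : ℂ} (hB : IsBMWType R q μ)

theorem braidWord_shift {m n s : ℕ} (h : m + s ≤ n) (α : Braid m) :
    braidWord A R n (Braid.shift s h α) =
      ((seqStrands N A).bmwTower hB).up s (braidWord A R m α) := by
  have : (braidWord A R n).comp (Braid.shift s h) =
      ((((seqStrands N A).bmwTower hB).up s).toRingHom.toMonoidHom).comp (braidWord A R m) := by
    refine Braid.hom_ext fun i => ?_
    show braidWord A R n (Braid.shift s h (Braid.σ i)) =
      ((seqStrands N A).bmwTower hB).up s (braidWord A R m (Braid.σ i))
    rw [shift_σ, braidWord_σ, braidWord_σ]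
    exact (((seqStrands N A).bmwTower hB).up_r s i).symm
  exact DFunLike.congr_fun this α

theorem braidWord_mem {n : ℕ} (α : Braid n) :
    braidWord A R n α ∈ ((seqStrands N A).bmwTower hB).W 0 n := by
  have key : ∀ x ∈ Subgroup.closure (Set.range (Braid.σ (n := n))),
      braidWord A R n x ∈ ((seqStrands N A).bmwTower hB).W 0 n ∧
        braidWord A R n x⁻¹ ∈ ((seqStrands N A).bmwTower hB).W 0 n := by
    intro x hx
    induction hx using Subgroup.closure_induction with
    | mem x hx =>
      obtain ⟨i, rfl⟩ := hx
      rw [braidWord_σ, braidWord_σ_inv]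
      exact ⟨((seqStrands N A).bmwTower hB).r_mem (Nat.zero_le _) i.2,
        ((seqStrands N A).bmwTower hB).s_mem (Nat.zero_le _) i.2⟩
    | one => simp only [inv_one, map_one]; exact ⟨one_mem _, one_mem _⟩
    | mul x y _ _ hx hy =>
      rw [mul_inv_rev, map_mul, map_mul]
      exact ⟨mul_mem hx.1 hy.1, mul_mem hy.2 hx.2⟩
    | inv x _ hx => rw [inv_inv]; exact ⟨hx.2, hx.1⟩
  have htop : Subgroup.closure (Set.range (Braid.σ (n := n))) = ⊤ :=
    PresentedGroup.closure_range_of _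
  exact (key α (htop ▸ Subgroup.mem_top α)).1

/-- Images of braids are closed under products, so their linear span is already the algebra they
generate. Linear statements about words can thus be checked on braids. -/
theorem W_le_span_braidWord (n : ℕ) : ∀ w ∈ ((seqStrands N A).bmwTower hB).W 0 n,
    w ∈ Submodule.span ℂ (Set.range (braidWord A R n)) := by
  have e : Submodule.span ℂ (Set.range (braidWord A R n)) =
      (Algebra.adjoin ℂ (Set.range (braidWord A R n))).toSubmodule := by
    rw [Algebra.adjoin_eq_span, ← MonoidHom.coe_mrange, Submonoid.closure_eq]
  intro w hw
  rw [e]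
  refine ((seqStrands N A).bmwTower hB).W_le (U := Algebra.adjoin ℂ (Set.range (braidWord A R n)))
    (fun i _ hi => ⟨?_, ?_⟩) hw
  · exact Algebra.subset_adjoin ⟨Braid.σ ⟨i, hi⟩, braidWord_σ A R _⟩
  · exact Algebra.subset_adjoin ⟨(Braid.σ ⟨i, hi⟩)⁻¹, braidWord_σ_inv A R _⟩

theorem braidWord_star {n m : ℕ} (α : Braid n) (β : Braid m) :
    braidWord A R (n + m + 1) (Braid.star α β) =
      ((seqStrands N A).bmwTower hB).star n (braidWord A R n α) (braidWord A R m β) := by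
  set B := (seqStrands N A).bmwTower hB
  -- The ambient number of strands is kept general so that the induction on the length of the braid
  -- does not change it.
  have hS : ∀ (p k : ℕ) (h : k + 1 ≤ p), braidWord A R p
      ((List.ofFn fun j : Fin (k + 1) => (Braid.σ ⟨j, by omega⟩ : Braid p)).reverse.prod *
        (List.ofFn fun j : Fin k => (Braid.σ ⟨j + 1, by omega⟩ : Braid p)⁻¹).prod) = B.S k := by
    intro p k
    induction k with
    | zero =>
      intro h
      simp only [List.ofFn_succ, List.ofFn_zero, List.reverse_singleton, List.prod_singleton,
        List.prod_nil, mul_one]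
      exact braidWord_σ A R _
    | succ k ih =>
      intro h
      have e1 : (List.ofFn fun j : Fin (k + 1 + 1) =>
          (Braid.σ ⟨j, by omega⟩ : Braid p)).reverse.prod = Braid.σ ⟨k + 1, by omega⟩ *
          (List.ofFn fun j : Fin (k + 1) => (Braid.σ ⟨j, by omega⟩ : Braid p)).reverse.prod := by
        rw [List.ofFn_succ', List.concat_eq_append, List.reverse_append, List.prod_append,
          List.reverse_singleton, List.prod_singleton]
        rfl
      have e2 : (List.ofFn fun j : Fin (k + 1) => (Braid.σ ⟨j + 1, by omega⟩ : Braid p)⁻¹).prod =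
          (List.ofFn fun j : Fin k => (Braid.σ ⟨j + 1, by omega⟩ : Braid p)⁻¹).prod *
            (Braid.σ ⟨k + 1, by omega⟩)⁻¹ := by
        rw [List.ofFn_succ', List.concat_eq_append, List.prod_append, List.prod_singleton]
        rfl
      have h1 : braidWord A R p (Braid.σ ⟨k + 1, by omega⟩) = B.r (k + 1) := braidWord_σ A R _
      have h2 : braidWord A R p (Braid.σ ⟨k + 1, by omega⟩)⁻¹ = B.s (k + 1) := braidWord_σ_inv A R _
      rw [e1, e2, B.S_succ, ← ih (by omega), ← h1, ← h2, ← map_mul, ← map_mul]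
      simp only [mul_assoc]
  rw [Braid.star, map_mul, map_mul, braidWord_shift A hB, braidWord_shift A hB, hS _ _ (by omega)]
  rfl

end Words

theorem IsSkewInvertible.skewInverse {N : ℕ} {X : TensorOp N 2 ℂ} (h : IsSkewInvertible X) :
    IsSkewInverse X (skewInverse X) := by
  rw [_root_.skewInverse, dif_pos h]
  exact h.choose_spec

/-! ### The defining relation in the quotient algebra -/

section Relation

variable {N : ℕ} {A A' : Type*} [Ring A] [Algebra ℂ A] [Ring A'] [Algebra ℂ A'] (φ : A →ₐ[ℂ] A')

theorem coeffs_map {n : ℕ} (X : TensorOp N n ℂ) : (coeffs A X).map φ = coeffs A' X := by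
  ext i j
  exact φ.commutes _

theorem matrixCopy_succ (F : RMatrix N) (M : Matrix (Fin N) (Fin N) A) {n : ℕ} (k : Fin n) :
    matrixCopy F M k.succ = coeffs A (opAt F.op k) * matrixCopy F M k.castSucc *
      coeffs A (opAt F.inv k) := rfl

theorem matrixCopy_map (F : RMatrix N) (M : Matrix (Fin N) (Fin N) A) {n : ℕ} (i : Fin (n + 1)) :
    matrixCopy F (M.map φ) i = (matrixCopy F M i).map φ := by
  induction i using Fin.induction with
  | zero =>
    ext i j
    simp only [matrixCopy, Fin.induction_zero, firstSite, Matrix.of_apply, Matrix.map_apply]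
    split_ifs
    · rfl
    · exact (map_zero φ).symm
  | succ k ih =>
    rw [matrixCopy_succ, matrixCopy_succ, Matrix.map_mul, Matrix.map_mul, coeffs_map, coeffs_map, ih]

theorem copyProd_map (F : RMatrix N) (M : Matrix (Fin N) (Fin N) A) (n : ℕ) :
    copyProd F (M.map φ) n = (copyProd F M n).map φ := by
  have : (copyProd F M n).map φ = φ.toRingHom.mapMatrix (copyProd F M n) := rfl
  rw [this, copyProd, copyProd, map_list_prod, List.map_ofFn]
  congr 2
  funext i
  exact matrixCopy_map φ F M i

theorem coeffs_mul_copyProd_genM (R F : RMatrix N) :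
    coeffs (QMAlgebra R F) R.op * copyProd F (genM R F) 1 =
      copyProd F (genM R F) 1 * coeffs (QMAlgebra R F) R.op := by
  let φ := RingQuot.mkAlgHom ℂ (QMRel R F)
  have e : genM R F = (freeGen N).map φ := rfl
  rw [e, copyProd_map, ← coeffs_map φ, ← Matrix.map_mul, ← Matrix.map_mul]
  ext i j
  exact RingQuot.mkAlgHom_rel ℂ (QMRel.entry i j)

end Relation

/-! ### The descent system of the quantum matrix algebra -/

section QuantumMatrixAlgebra

variable {N : ℕ} [NeZero N] {R F : RMatrix N} {q μ : ℂ}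

theorem seqOp_copyProd_mul_rep {n : ℕ} (α : Braid n) :
    seqOp N (QMAlgebra R F) (n + 1) (copyProd F (genM R F) n * coeffs _ (R.rep n α).val) =
      (seqStrands N (QMAlgebra R F)).copies F (seqSite N _ (genM R F)) 0 (n + 1) *
        braidWord (QMAlgebra R F) R n α := by
  rw [map_mul, seqOp_copyProd, braidWord_apply]

theorem wtrs_zero_braidWord {n : ℕ} (α : Braid n) :
    (seqStrands N (QMAlgebra R F)).wtrs (skewD R.op) 0 (n + 1)
      ((seqStrands N (QMAlgebra R F)).copies F (seqSite N _ (genM R F)) 0 (n + 1) *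
        braidWord (QMAlgebra R F) R n α) = (seqStrands N (QMAlgebra R F)).ι (ch R F α) := by
  rw [← seqOp_copyProd_mul_rep, wtrs_zero_seqOp, ch]

theorem wtrs_one_braidWord {n : ℕ} (α : Braid n) :
    (seqStrands N (QMAlgebra R F)).wtrs (skewD R.op) 1 n
      ((seqStrands N (QMAlgebra R F)).copies F (seqSite N _ (genM R F)) 0 (n + 1) *
        braidWord (QMAlgebra R F) R n α) = seqSite N _ (descendant R F α) := by
  rw [← seqOp_copyProd_mul_rep, wtrs_one_seqOp, descendant]

/-- The generating matrix of the quantum matrix algebra, acting in the first strand. -/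
noncomputable def qmStrands (hRF : IsCompatiblePair R.op F.op) (hR : IsStrictSkewInvertible R.op)
    (hB : IsBMWType R q μ) :
    QuantumStrands (QMAlgebra R F) (SeqEnd N (QMAlgebra R F)) R F q μ where
  toStrandSystem := seqStrands N (QMAlgebra R F)
  compat := hRF
  skew := hR.1.skewInverse
  strict := hR.2
  bmw := hB
  M := seqSite N _ (genM R F)
  M_mem := seqSite_mem_loc _
  rel := by
    have h := congrArg (seqOp N (QMAlgebra R F) 2) (coeffs_mul_copyProd_genM R F)
    rw [map_mul, map_mul, seqOp_copyProd] at h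
    have e1 : seqOp N (QMAlgebra R F) 2 (coeffs _ R.op) =
        (seqStrands N (QMAlgebra R F)).two 0 1 R.op := by
      have := seqOp_opAt (A := QMAlgebra R F) (0 : Fin 1) R.op
      rwa [opAt_eq_self] at this
    rwa [e1, StrandSystem.copies_succ _ _ _ _ 1, StrandSystem.copies_one,
      StrandSystem.copy_zero] at h
  trace_mem n w hw := by
    have hle : Submodule.span ℂ (Set.range (braidWord (QMAlgebra R F) R n)) ≤
        (Subalgebra.toSubmodule (seqStrands N (QMAlgebra R F)).ι.range).comap
          ((seqStrands N (QMAlgebra R F)).wtrs (skewD R.op) 0 (n + 1) ∘ₗ LinearMap.mulLeft ℂ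
            ((seqStrands N (QMAlgebra R F)).copies F (seqSite N _ (genM R F)) 0 (n + 1))) := by
      refine Submodule.span_le.2 ?_
      rintro _ ⟨α, rfl⟩
      exact ⟨ch R F α, (wtrs_zero_braidWord α).symm⟩
    exact hle (W_le_span_braidWord _ hB n w hw)

variable [Nontrivial (QMAlgebra R F)] (hRF : IsCompatiblePair R.op F.op)
  (hR : IsStrictSkewInvertible R.op) (hB : IsBMWType R q μ)

instance : Nontrivial (SeqEnd N (QMAlgebra R F)) :=
  (seqStrands N (QMAlgebra R F)).ι_injective.nontrivial

/-- The descent system of the quantum matrix algebra. -/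
noncomputable def qmDescent : DescentSystem ((seqStrands N (QMAlgebra R F)).bmwTower hB)
    (QMAlgebra R F) :=
  (qmStrands hRF hR hB).descentSystem

/-- Matrices over the quantum matrix algebra as operators in the first strand. -/
noncomputable def qmSite (R F : RMatrix N) :
    Matrix (Fin N) (Fin N) (QMAlgebra R F) →ₗ[ℂ] SeqEnd N (QMAlgebra R F) :=
  (seqSite N (QMAlgebra R F)).toLinearMap

omit [NeZero N] [Nontrivial (QMAlgebra R F)] in
theorem qmSite_injective : Function.Injective (qmSite R F) := seqSite_injective

theorem qmDescent_D {n : ℕ} (α : Braid n) :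
    (qmDescent hRF hR hB).D n (braidWord _ R n α) = qmSite R F (descendant R F α) :=
  wtrs_one_braidWord α

theorem qmDescent_ch {n : ℕ} (α : Braid n) :
    (qmDescent hRF hR hB).ch n (braidWord _ R n α) = ch R F α := by
  apply (qmStrands hRF hR hB).ι_injective
  exact ((qmStrands hRF hR hB).ι_ch (braidWord_mem _ hB α)).trans (wtrs_zero_braidWord α)

theorem qmSite_scalarMat (c : QMAlgebra R F) :
    qmSite R F (scalarMat R F c) = (qmDescent hRF hR hB).ι c := by
  ext f i
  show seqSite N _ (scalarMat R F c) f i = c * f i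
  simp [seqSite_apply, scalarMat, Matrix.diagonal_apply]

theorem qmSite_rightMul (X : Matrix (Fin N) (Fin N) (QMAlgebra R F)) (c : QMAlgebra R F) :
    qmSite R F (rightMul R F X c) = qmSite R F X * (qmDescent hRF hR hB).ι c := by
  ext f i
  show seqSite N _ (rightMul R F X c) f i = seqSite N _ X (fun i => c * f i) i
  simp only [seqSite_apply, rightMul, Matrix.map_apply, mul_assoc]

/-- The operator $T$ is the weighted trace over the second strand of $M$, the copy of $X$ and $K$;
the factor $M$ leaves the trace, and what remains is $\xi(X)$. -/
theorem qmDescent_opT (X : Matrix (Fin N) (Fin N) (QMAlgebra R F)) :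
    (qmDescent hRF hR hB).opT (qmSite R F X) = qmSite R F (MtMap R F q μ X) := by
  set S := seqStrands N (QMAlgebra R F) with hS
  have hM : S.copies F (seqSite N _ (genM R F)) 0 1 = seqSite N _ (genM R F) := by
    rw [S.copies_one, S.copy_zero]
  have e1 : (qmDescent hRF hR hB).opT (qmSite R F X) = S.wtr (skewD R.op) 1
      (S.copies F (seqSite N _ (genM R F)) 0 1 * 1 * S.copy F 1 (seqSite N _ X) *
        S.two 0 1 (bmwK R q μ)) := rfl
  have e2 : seqSite N _ (xiMap R F q μ X) = S.wtr (skewD R.op) 1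
      (S.copy F 1 (seqSite N _ X) * S.two 0 1 (bmwK R q μ)) := by
    rw [xiMap, ← wtrs_one_seqOp, map_mul (seqOp _ _ _), map_mul (seqOp _ _ _), map_mul (seqOp _ _ _),
      seqOp_opAt, seqOp_opAt, seqOp_opAt,
      seqOp_firstSite]
    rfl
  rw [e1, hM, mul_one, mul_assoc, S.wtr_mul_left _ (S.mem_loc.1 (seqSite_mem_loc _) _ le_rfl), ← e2,
    ← map_mul]
  rfl

/-- Admitting all words in place of braids does not enlarge the span, since words are combinations
of braids. -/
theorem charSub_qmDescent : (qmDescent hRF hR hB).charSub = charSpace R F := by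
  apply le_antisymm
  · refine Submodule.span_le.2 ?_
    rintro x (rfl | ⟨n, w, hw, rfl⟩)
    · exact Submodule.subset_span (Or.inl rfl)
    · have hle : Submodule.span ℂ (Set.range (braidWord (QMAlgebra R F) R n)) ≤
          (charSpace R F).comap ((qmDescent hRF hR hB).ch n) := by
        refine Submodule.span_le.2 ?_
        rintro _ ⟨α, rfl⟩
        rw [SetLike.mem_coe, Submodule.mem_comap, qmDescent_ch]
        exact Submodule.subset_span (Or.inr ⟨n, α, rfl⟩)
      exact hle (W_le_span_braidWord _ hB n w hw)
  · refine Submodule.span_le.2 ?_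
    rintro x (rfl | ⟨n, α, rfl⟩)
    · exact (qmDescent hRF hR hB).one_mem_charSub
    · rw [← qmDescent_ch hRF hR hB]
      exact (qmDescent hRF hR hB).ch_mem_charSub (braidWord_mem _ hB α)

theorem map_descSpace : (descSpace R F).map (qmSite R F) = (qmDescent hRF hR hB).desc := by
  rw [descSpace, Submodule.map_span]
  apply le_antisymm
  · refine Submodule.span_le.2 ?_
    rintro _ ⟨x, ⟨c, hc, rfl⟩ | ⟨n, α, rfl⟩, rfl⟩
    · rw [qmSite_scalarMat hRF hR hB]
      exact (qmDescent hRF hR hB).ι_mem (by rwa [charSub_qmDescent])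
    · rw [← qmDescent_D hRF hR hB]
      exact (qmDescent hRF hR hB).D_mem (braidWord_mem _ hB α)
  · refine Submodule.span_le.2 ?_
    rintro x (⟨c, hc, rfl⟩ | ⟨n, w, hw, rfl⟩)
    · rw [charSub_qmDescent] at hc
      exact Submodule.subset_span ⟨_, Or.inl ⟨c, hc, rfl⟩, qmSite_scalarMat hRF hR hB c⟩
    · have hle : Submodule.span ℂ (Set.range (braidWord (QMAlgebra R F) R n)) ≤
          (Submodule.span ℂ (qmSite R F '' ({X | ∃ c ∈ charSpace R F, X = scalarMat R F c} ∪
            {X | ∃ (n : ℕ) (α : Braid n), X = descendant R F α}))).comap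
              ((qmDescent hRF hR hB).D n) := by
        refine Submodule.span_le.2 ?_
        rintro _ ⟨α, rfl⟩
        rw [SetLike.mem_coe, Submodule.mem_comap, qmDescent_D]
        exact Submodule.subset_span ⟨_, Or.inr ⟨n, α, rfl⟩, rfl⟩
      exact hle (W_le_span_braidWord _ hB n w hw)

theorem qmSite_mem_desc {X : Matrix (Fin N) (Fin N) (QMAlgebra R F)} :
    qmSite R F X ∈ (qmDescent hRF hR hB).desc ↔ X ∈ descSpace R F := by
  rw [← map_descSpace hRF hR hB]
  exact qmSite_injective.mem_set_image

/-- The space of descendants realized by operators. -/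
noncomputable def descEquiv : descSpace R F ≃ₗ[ℂ] (qmDescent hRF hR hB).desc :=
  (Submodule.equivMapOfInjective (qmSite R F) qmSite_injective (descSpace R F)).trans
    (LinearEquiv.ofEq _ _ (map_descSpace hRF hR hB))

-- The defining formulas prescribe the product of any two members of the spanning set.
omit [NeZero N] [Nontrivial (QMAlgebra R F)] in
theorem star_eq_of_isStarProduct {s s' : descSpace R F →ₗ[ℂ] descSpace R F →ₗ[ℂ] descSpace R F}
    (h : IsStarProduct R F s) (h' : IsStarProduct R F s') : s' = s := by
  refine bilinear_ext_span (V := Matrix (Fin N) (Fin N) (QMAlgebra R F)) (W := descSpace R F)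
    (P := descSpace R F) (X := {X | ∃ c ∈ charSpace R F, X = scalarMat R F c} ∪
    {X | ∃ (n : ℕ) (α : Braid n), X = descendant R F α}) rfl ?_
  rintro x y (⟨c, hc, hx⟩ | ⟨n, α, hx⟩) (⟨d, hd, hy⟩ | ⟨m, β, hy⟩) <;> apply Subtype.ext
  · rw [h.scalar_scalar c d x y hc hd hx hy, h'.scalar_scalar c d x y hc hd hx hy]
  · rw [h.scalar_desc c β x y hc hx hy, h'.scalar_desc c β x y hc hx hy]
  · rw [h.desc_scalar d α x y hd hx hy, h'.desc_scalar d α x y hd hx hy]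
  · rw [h.desc_desc α β x y hx hy, h'.desc_desc α β x y hx hy]

end QuantumMatrixAlgebra

/-! ### The ⋆-product on matrices -/

section StarProduct

variable {N : ℕ} [NeZero N] {R F : RMatrix N} {q μ : ℂ} [Nontrivial (QMAlgebra R F)]
  (hRF : IsCompatiblePair R.op F.op) (hR : IsStrictSkewInvertible R.op) (hB : IsBMWType R q μ)

include hRF hR hB in
theorem rightMul_mem_descSpace {X : Matrix (Fin N) (Fin N) (QMAlgebra R F)}
    (hX : X ∈ descSpace R F) {c : QMAlgebra R F} (hc : c ∈ charSpace R F) :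
    rightMul R F X c ∈ descSpace R F := by
  rw [← qmSite_mem_desc hRF hR hB, qmSite_rightMul hRF hR hB]
  exact (qmDescent hRF hR hB).mul_ι_mem ((qmSite_mem_desc hRF hR hB).2 hX)
    (by rwa [charSub_qmDescent])

theorem exists_isStarProduct :
    ∃ s : descSpace R F →ₗ[ℂ] descSpace R F →ₗ[ℂ] descSpace R F, IsStarProduct R F s ∧
      (∀ x y z, s (s x y) z = s x (s y z)) ∧ (∀ x y, s x y = s y x) ∧
      ∀ x, qmSite R F (s ⟨genM R F, genM_mem_descSpace R F⟩ x).val =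
        (qmDescent hRF hR hB).opA (qmSite R F x.val) := by
  obtain ⟨s, hD, hι⟩ := (qmDescent hRF hR hB).exists_star
  let e := descEquiv hRF hR hB
  -- The product found on operators is transported to matrices along the injective embedding in the
  -- first strand.
  let t : descSpace R F →ₗ[ℂ] descSpace R F →ₗ[ℂ] descSpace R F :=
    (s.compl₁₂ e.toLinearMap e.toLinearMap).compr₂ e.symm.toLinearMap
  have ht : ∀ x y, e (t x y) = s (e x) (e y) := fun x y => e.apply_symm_apply _
  have htv : ∀ x y, qmSite R F (t x y).val = (s (e x) (e y)).val := fun x y =>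
    congrArg Subtype.val (ht x y)
  have hsc : ∀ {c : QMAlgebra R F} {x : descSpace R F}, x.val = scalarMat R F c →
      (e x).val = (qmDescent hRF hR hB).ι c := by
    intro c x hx
    rw [← qmSite_scalarMat hRF hR hB, ← hx]; rfl
  have hdesc : ∀ {n : ℕ} {α : Braid n} {x : descSpace R F}, x.val = descendant R F α →
      (e x).val = (qmDescent hRF hR hB).D n (braidWord _ R n α) := by
    intro n α x hx
    rw [qmDescent_D, ← hx]; rfl
  have hch : ∀ {c}, c ∈ charSpace R F → c ∈ (qmDescent hRF hR hB).charSub := fun hc => by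
    rwa [charSub_qmDescent]
  refine ⟨t, ⟨?_, ?_, ?_, ?_⟩, ?_, ?_, ?_⟩
  · intro n m α β x y hx hy
    apply qmSite_injective (R := R) (F := F)
    rw [htv, hD n _ (braidWord_mem _ hB α) _ _ (hdesc hx), hdesc hy,
      ← (qmDescent hRF hR hB).D_star_eq (braidWord_mem _ hB α) (braidWord_mem _ hB β),
      ← braidWord_star, qmDescent_D]
  · intro n c α x y hc hx hy
    apply qmSite_injective (R := R) (F := F)
    rw [htv, hι c (hch hc) _ _ (hsc hx), qmSite_rightMul hRF hR hB, ← hy]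
    rfl
  · intro n c α x y hc hx hy
    apply qmSite_injective (R := R) (F := F)
    rw [htv, hD n _ (braidWord_mem _ hB α) _ _ (hdesc hx), hsc hy,
      DescentSystem.L_S_ι _ (braidWord_mem _ hB α), qmDescent_D, qmSite_rightMul hRF hR hB]
  · intro c d x y hc hd hx hy
    apply qmSite_injective (R := R) (F := F)
    rw [htv, hι c (hch hc) _ _ (hsc hx), hsc hy, ← map_mul,
      (qmDescent hRF hR hB).charSub_comm (hch hd) (hch hc), qmSite_scalarMat hRF hR hB]
  · intro x y z
    apply e.injective
    rw [ht, ht, ht, ht, DescentSystem.star_assoc_of hD hι]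
  · intro x y
    apply e.injective
    rw [ht, ht, DescentSystem.star_comm_of hD hι]
  · intro x
    rw [htv, hD 0 1 (one_mem _) _ _ (by
      rw [hdesc (α := (1 : Braid 0)) (descendant_one R F).symm, map_one])]
    rfl

theorem descSpace_eq_span {s : descSpace R F →ₗ[ℂ] descSpace R F →ₗ[ℂ] descSpace R F}
    (hs : ∀ x, qmSite R F (s ⟨genM R F, genM_mem_descSpace R F⟩ x).val =
        (qmDescent hRF hR hB).opA (qmSite R F x.val)) :
    descSpace R F = Submodule.span ℂ
      {X | ∃ (n : ℕ) (c : QMAlgebra R F), c ∈ charSpace R F ∧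
        (X = rightMul R F (starPow R F s n).val c ∨
          X = rightMul R F (MtMap R F q μ (starPow R F s (n + 2)).val) c)} := by
  have hpow : ∀ n, qmSite R F (starPow R F s n).val = (qmDescent hRF hR hB).pow n := by
    intro n
    induction n with
    | zero => exact map_one (seqSite N (QMAlgebra R F))
    | succ n ih => exact (hs _).trans (congrArg _ ih)
  apply Submodule.map_injective_of_injective (f := qmSite R F) qmSite_injective
  rw [map_descSpace hRF hR hB, DescentSystem.desc_eq_powSpan, Submodule.map_span]
  unfold DescentSystem.powSpan
  congr 1
  rw [charSub_qmDescent]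
  ext Y
  constructor
  · rintro ⟨n, c, hc, rfl | rfl⟩
    · exact ⟨_, ⟨n, c, hc, Or.inl rfl⟩, by rw [qmSite_rightMul hRF hR hB, hpow]⟩
    · exact ⟨_, ⟨n, c, hc, Or.inr rfl⟩, by
        rw [qmSite_rightMul hRF hR hB, ← qmDescent_opT hRF hR hB, hpow]⟩
  · rintro ⟨_, ⟨n, c, hc, rfl | rfl⟩, rfl⟩
    · exact ⟨n, c, hc, Or.inl (by rw [qmSite_rightMul hRF hR hB, hpow])⟩
    · exact ⟨n, c, hc, Or.inr (by
        rw [qmSite_rightMul hRF hR hB, ← qmDescent_opT hRF hR hB, hpow])⟩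

end StarProduct

/-! ### Nontriviality and the theorem -/

/-- The augmentation of the quantum matrix algebra, which annihilates the generators. -/
theorem QMAlgebra.nontrivial {N : ℕ} (R F : RMatrix N) : Nontrivial (QMAlgebra R F) := by
  let ε : FreeAlgebra ℂ (Fin N × Fin N) →ₐ[ℂ] ℂ := FreeAlgebra.lift ℂ fun _ => 0
  have hM : (freeGen N).map ε = 0 := by
    ext a b
    exact FreeAlgebra.lift_ι_apply _ _
  have hcopy : ∀ i : Fin 2, matrixCopy F (0 : Matrix (Fin N) (Fin N) ℂ) i = 0 := by
    intro i
    induction i using Fin.induction with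
    | zero => ext i j; simp [matrixCopy, firstSite]
    | succ k ih => rw [matrixCopy_succ, ih, mul_zero, zero_mul]
  have hprod : (copyProd F (freeGen N) 1).map ε = 0 := by
    rw [← copyProd_map, hM, copyProd, List.ofFn_succ, List.prod_cons, hcopy, zero_mul]
  have hrel : ∀ ⦃x y⦄, QMRel R F x y → ε x = ε y := by
    rintro _ _ ⟨i, j⟩
    have e1 : (coeffs (FreeAlgebra ℂ (Fin N × Fin N)) R.op * copyProd F (freeGen N) 1).map ε =
        0 := by
      rw [Matrix.map_mul, hprod, mul_zero]
    have e2 : (copyProd F (freeGen N) 1 * coeffs (FreeAlgebra ℂ (Fin N × Fin N)) R.op).map ε =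
        0 := by
      rw [Matrix.map_mul, hprod, zero_mul]
    exact (congrFun (congrFun e1 i) j).trans (congrFun (congrFun e2 i) j).symm
  exact (RingQuot.liftAlgHom ℂ ⟨ε, hrel⟩).toRingHom.domain_nontrivial

theorem proposition4p14 {N : ℕ} (R F : RMatrix N) (q μ : ℂ)
    (hRF : IsCompatiblePair R.op F.op)
    (hR : IsStrictSkewInvertible R.op)
    (hF : IsStrictSkewInvertible F.op)
    (hBMW : IsBMWType R q μ) :
    -- the span of `1` and all `ch(α)` is closed under products,
    -- and the space of descendants is a right module over it
    (∀ a ∈ charSpace R F, ∀ b ∈ charSpace R F, a * b ∈ charSpace R F) ∧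
    (∀ X ∈ descSpace R F, ∀ c ∈ charSpace R F, rightMul R F X c ∈ descSpace R F) ∧
    -- the `⋆`-product exists, is unique, associative and commutative
    ∃ s : descSpace R F →ₗ[ℂ] descSpace R F →ₗ[ℂ] descSpace R F,
      IsStarProduct R F s ∧
      (∀ s', IsStarProduct R F s' → s' = s) ∧
      (∀ x y z, s (s x y) z = s x (s y z)) ∧
      (∀ x y, s x y = s y x) ∧
      -- the module is spanned by the `⋆`-powers and the images of those of order at least two
      descSpace R F = Submodule.span ℂ
        {X | ∃ (n : ℕ) (c : QMAlgebra R F), c ∈ charSpace R F ∧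
          (X = rightMul R F (starPow R F s n).val c ∨
            X = rightMul R F (MtMap R F q μ (starPow R F s (n + 2)).val) c)} := by

  -- In dimension zero every operator on $V\otimes V$ vanishes, while $K$ does not.
  have : NeZero N := ⟨by
    rintro rfl
    exact hBMW.K_ne_zero (Matrix.ext fun i _ => (i 0).elim0)⟩
  have := QMAlgebra.nontrivial R F
  obtain ⟨s, hs, hassoc, hcomm, hM⟩ := exists_isStarProduct hRF hR hBMW
  refine ⟨fun a ha b hb => ?_, fun X hX c hc => rightMul_mem_descSpace hRF hR hBMW hX hc,
    s, hs, fun s' hs' => star_eq_of_isStarProduct hs hs', hassoc, hcomm,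
    descSpace_eq_span hRF hR hBMW hM⟩
  rw [← charSub_qmDescent hRF hR hBMW] at ha hb ⊢
  exact (qmDescent hRF hR hBMW).mul_mem_charSub ha hb
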